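/- **Setting.** Let $k\ge 2$, $p\ge 1$, $d\ge 0$. Let $\gamma\in\mathbb R^p$ be phaser angles and $\beta_1,\dots,\beta_p\in\mathbb R^\ell$ mixer angles, let $U_B(\cdot)$ be a family of $k\times k$ unitary matrices indexed by $\mathbb R^\ell$, put $U_t=U_B(\beta_t)$, and let $\psi\in\mathbb C^k$ be a unit vector. Let $\varphi,\xi:\mathbb Z_k\to\mathbb R$ with $\varphi$ even (so that $\varphi(x_u-x_v)$ is well defined on unordered edges). For a finite graph $G=(V,E)$ let $C(x)=\sum_{\{u,v\}\in E}\varphi(x_u-x_v)$ for $x\in\mathbb Z_k^V$, and $$|\gamma,\beta\rangle=U_p^{\otimes V}e^{-i\gamma_pC}\cdots U_1^{\otimes V}e^{-i\gamma_1C}\,|\psi\rangle^{\otimes V}.$$ Index $a\in\mathbb Z_k^{2p+2}$ as $(a_1,\dots,a_{p+1},a_{-p-1},\dots,a_{-1})$ and define $$f(a)=\mathbf 1[a_{p+1}=a_{-p-1}]\,\langle\psi|a_1\rangle\langle a_{-1}|\psi\rangle\prod_{t=1}^p\langle a_t|U_t^\dagger|a_{t+1}\rangle\langle a_{-t-1}|U_t|a_{-t}\rangle,$$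 $$\Phi(a,b)=\sum_{t=1}^p\gamma_t\big(\varphi(a_t-b_t)-\varphi(a_{-t}-b_{-t})\big),$$ $$H^{(0)}=1,\qquad H^{(r+1)}(a)=\Big(\sum_{b\in\mathbb Z_k^{2p+2}}f(b)H^{(r)}(b)e^{i\Phi(a,b)}\Big)^d .$$ Let $\mathbf H$ be the Hadamard transform on $\mathbb Z_k^{n}$ with $n=2p+2$, that is, $\mathbf H_{x,y}=k^{-n/2}e^{-2\pi i\,x\cdot y/k}$. **Claim.** (1) Let $M_{a,b}=e^{i\Phi(a,b)}$ and $M'_{a,b}=e^{i\Phi(a,b)}\xi(a_{p+1}-b_{p+1})$, and let $$m(c)=\exp\Big(i\sum_{t=1}^p\gamma_t\big(\varphi(c_t)-\varphi(c_{-t})\big)\Big),\qquad m'(c)=m(c)\,\xi(c_{p+1}).$$ Then $M_{a,b}=m(a-b)$ and $M'_{a,b}=m'(a-b)$, so both matrices act by convolution on $\mathbb Z_k^{2p+2}$. The matrix $\mathbf H$ is unitary and diagonalizes both: $M=\mathbf H^\dagger\,\mathrm{diag}(k^{n/2}\,\mathbf Hm)\,\mathbf H$ and $M'=\mathbf H^\dagger\,\mathrm{diag}(k^{n/2}\,\mathbf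 Hm')\,\mathbf H$. Moreover $H^{(r+1)}(a)=\big((M\,(fH^{(r)}))(a)\big)^d$ for all $r\ge 0$ and all $a$. (2) Let $G$ be any finite $(d+1)$-regular graph of girth at least $2p+2$ (a graph without cycles has girth $\infty$). For every pair of adjacent vertices $u,v$, $$\langle\gamma,\beta|\xi(Z_u-Z_v)|\gamma,\beta\rangle=\sum_a f(a)H^{(p)}(a)\,\big(M'(fH^{(p)})\big)(a).$$ (3) There are a single program and a constant $K$, both independent of $k,p,d$ and of all the other data, with the following property. On input $k,p,d$, the numbers $\gamma_1,\dots,\gamma_p$, the values of $\varphi,\xi,\psi$ and the entries of $U_1,\dots,U_p$, the program outputs the expectation in (2), for every $G,u,v$ as in (2). It makes at most $K\,p^2k^{2p+2}\log k$ steps and uses at most $K\,k^{2p+2}$ memory cells; in particular, neither bound depends on the degree. The machine is a random access machine with finitely many integer registers and with memory cells that hold complex numbers. Each of the following counts as one step: an integer operation $+,-,\times$, division or remainder; a comparison of two integers; starting a loop or a loop iteration; loading an integer constant, a quotient of two integers, $\pi$ or $i$; copying a complex number; and a complex operation $+,-,\times$, conjugation, exponential, or power with an integer exponent. All integers that the program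 computes are at most $K\,k^{2p+2}$. -/

import Mathlib

open scoped Matrix

noncomputable section

/-! ## QAOA states on qudits -/

section State

variable {V : Type*} [Fintype V] [DecidableEq V] {k : ℕ} [NeZero k]

/-- The cost `C(x) = ∑_{ {u,v} ∈ E } φ(x_u, x_v)`. The sum runs over unordered edges, so `φ` has
to be symmetric for it to make sense. -/
def qaoaCost (G : SimpleGraph V) [DecidableRel G.Adj] (φ : ZMod k → ZMod k → ℝ)
    (hφ : ∀ x y, φ x y = φ y x) (x : V → ZMod k) : ℝ :=
  ∑ e ∈ G.edgeFinset,
    Sym2.lift ⟨fun u v => φ (x u) (x v), fun u v => hφ (x u) (x v)⟩ e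

/-- The phaser `U_C(γ) = exp(-i γ C)`, diagonal in the computational basis. -/
def phaser (C : (V → ZMod k) → ℝ) (γ : ℝ) : Matrix (V → ZMod k) (V → ZMod k) ℂ :=
  Matrix.diagonal fun x => Complex.exp (-(Complex.I * (γ : ℂ) * (C x : ℂ)))

/-- The mixer `⨂_{v ∈ V} U`, the same single-qudit operator `U` on every qudit. -/
def mixer (V : Type*) [Fintype V] (U : Matrix (ZMod k) (ZMod k) ℂ) :
    Matrix (V → ZMod k) (V → ZMod k) ℂ :=
  Matrix.of fun x y => ∏ v, U (x v) (y v)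

/-- The `p`-layer QAOA state `U_M(β_p) U_C(γ_p) ⋯ U_M(β_1) U_C(γ_1) |ψ⟩^{⊗V}`, where
`U t` is the single-qudit mixer of layer `t + 1`. -/
def qaoaState {p : ℕ} (C : (V → ZMod k) → ℝ) (γ : Fin p → ℝ)
    (U : Fin p → Matrix (ZMod k) (ZMod k) ℂ) (ψ : ZMod k → ℂ) : (V → ZMod k) → ℂ :=
  Fin.foldl p (fun Ψ t => mixer V (U t) *ᵥ (phaser C (γ t) *ᵥ Ψ)) (fun x => ∏ v, ψ (x v))

/-- The expectation `⟨Ψ| ξ(Z_u, Z_v) |Ψ⟩` of a diagonal two-qudit observable. -/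
def edgeExpectation (ξ : ZMod k → ZMod k → ℝ) (u v : V) (Ψ : (V → ZMod k) → ℂ) : ℂ :=
  star Ψ ⬝ᵥ (Matrix.diagonal (fun x : V → ZMod k => (ξ (x u) (x v) : ℂ)) *ᵥ Ψ)

end State

/-! ## The iteration

A ditstring `(a_1, …, a_{p+1}, a_{-p-1}, …, a_{-1})` is a function on `Fin (2 * p + 2)`. -/

/-- The position of the index `t + 1`, for `0 ≤ t ≤ p`. -/
def posIdx {p : ℕ} (t : Fin (p + 1)) : Fin (2 * p + 2) := ⟨t, by omega⟩

/-- The position of the index `-(t + 1)`, for `0 ≤ t ≤ p`. -/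
def negIdx {p : ℕ} (t : Fin (p + 1)) : Fin (2 * p + 2) := ⟨2 * p + 1 - t, by omega⟩

section Iteration

variable {k p : ℕ} [NeZero k]

/-- A function of the difference of two labels, as a function of the two labels. -/
def onDiff (φ : ZMod k → ℝ) (x y : ZMod k) : ℝ := φ (x - y)

/-- `f(a) = ∏_{1 ≤ t ≤ p} ⟨a_t|U_t†|a_{t+1}⟩ ⟨a_{-t-1}|U_t|a_{-t}⟩ · 1[a_{p+1} = a_{-p-1}]
· ⟨ψ|a_1⟩ ⟨a_{-1}|ψ⟩`. -/
def pathWeight (U : Fin p → Matrix (ZMod k) (ZMod k) ℂ) (ψ : ZMod k → ℂ)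
    (a : Fin (2 * p + 2) → ZMod k) : ℂ :=
  (∏ t : Fin p, (U t)ᴴ (a (posIdx t.castSucc)) (a (posIdx t.succ)) *
      U t (a (negIdx t.succ)) (a (negIdx t.castSucc))) *
    (if a (posIdx (Fin.last p)) = a (negIdx (Fin.last p)) then 1 else 0) *
    star (ψ (a (posIdx 0))) * ψ (a (negIdx 0))

/-- `Φ(a, b) = ∑_{1 ≤ t ≤ p} γ_t (φ(a_t, b_t) - φ(a_{-t}, b_{-t}))`. -/
def phaseFun (γ : Fin p → ℝ) (φ : ZMod k → ZMod k → ℝ) (a b : Fin (2 * p + 2) → ZMod k) : ℝ :=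
  ∑ t : Fin p, γ t * (φ (a (posIdx t.castSucc)) (b (posIdx t.castSucc)) -
    φ (a (negIdx t.castSucc)) (b (negIdx t.castSucc)))

/-- `H^{(0)} = 1`, `H^{(r)}(a) = (∑_b f(b) H^{(r-1)}(b) e^{iΦ(a,b)})^d`. -/
def branchTensor (d : ℕ) (γ : Fin p → ℝ) (U : Fin p → Matrix (ZMod k) (ZMod k) ℂ)
    (ψ : ZMod k → ℂ) (φ : ZMod k → ZMod k → ℝ) : ℕ → (Fin (2 * p + 2) → ZMod k) → ℂ
  | 0 => fun _ => 1
  | r + 1 => fun a =>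
      (∑ b, pathWeight U ψ b * branchTensor d γ U ψ φ r b *
        Complex.exp (Complex.I * (phaseFun γ φ a b : ℂ))) ^ d

/-- The matrix `e^{iΦ(a,b)}` of the iteration. -/
def phaseMatrix (γ : Fin p → ℝ) (φ : ZMod k → ZMod k → ℝ) :
    Matrix (Fin (2 * p + 2) → ZMod k) (Fin (2 * p + 2) → ZMod k) ℂ :=
  Matrix.of fun a b => Complex.exp (Complex.I * (phaseFun γ φ a b : ℂ))

/-- The matrix `e^{iΦ(a,b)} ξ(a_{p+1}, b_{p+1})` of the final sum. -/
def lossMatrix (γ : Fin p → ℝ) (φ ξ : ZMod k → ZMod k → ℝ) :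
    Matrix (Fin (2 * p + 2) → ZMod k) (Fin (2 * p + 2) → ZMod k) ℂ :=
  Matrix.of fun a b => Complex.exp (Complex.I * (phaseFun γ φ a b : ℂ)) *
    (ξ (a (posIdx (Fin.last p))) (b (posIdx (Fin.last p))) : ℂ)

/-- `m(c) = exp(i ∑_{1 ≤ t ≤ p} γ_t (φ(c_t) - φ(c_{-t})))`, for `φ` a function on `ℤ_k`. -/
def phaseKernel (γ : Fin p → ℝ) (φ : ZMod k → ℝ) (c : Fin (2 * p + 2) → ZMod k) : ℂ :=
  Complex.exp (Complex.I *
    ((∑ t : Fin p, γ t * (φ (c (posIdx t.castSucc)) - φ (c (negIdx t.castSucc))) : ℝ) : ℂ))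

/-- `m(c) ξ(c_{p+1})`, for `φ` and `ξ` functions on `ℤ_k`. -/
def lossKernel (γ : Fin p → ℝ) (φ ξ : ZMod k → ℝ) (c : Fin (2 * p + 2) → ZMod k) : ℂ :=
  phaseKernel γ φ c * (ξ (c (posIdx (Fin.last p))) : ℂ)

end Iteration

/-! ## The Hadamard transform -/

/-- The Hadamard transform over `n` qudits, with entries `k^{-n/2} exp(-2πi x·y / k)`. -/
def hadamard (k n : ℕ) : Matrix (Fin n → ZMod k) (Fin n → ZMod k) ℂ :=
  Matrix.of fun x y => ((Real.sqrt k : ℂ) ^ n)⁻¹ *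
    Complex.exp (-(2 * Real.pi * Complex.I * (∑ j, ((x j).val : ℂ) * ((y j).val : ℂ)) / k))

/-- `M` acts as the convolution with `m` on `ℤ_k^n`, and the Hadamard transform diagonalizes it:
`M_{a,b} = m(a - b)` and `M = H† diag(k^{n/2} m̂) H` with `m̂ = H m`. -/
def IsHadamardConvolution {k n : ℕ} [NeZero k] (M : Matrix (Fin n → ZMod k) (Fin n → ZMod k) ℂ)
    (m : (Fin n → ZMod k) → ℂ) : Prop :=
  (∀ a b, M a b = m (a - b)) ∧
    M = (hadamard k n)ᴴ *
      Matrix.diagonal (fun x => (Real.sqrt k : ℂ) ^ n * (hadamard k n *ᵥ m) x) * hadamard k n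

/-! ## The machine model

A random access machine with finitely many integer registers (those the program mentions) and
complex memory cells, which are grouped in arrays. Integers steer loops, branches and addressing.
Complex numbers cannot be tested or turned into integers. Every instruction costs one step.
A program has no other access to its data than these instructions. -/

/-- Binary operations on integer registers (subtraction is truncated). -/
inductive IntOp
  | add | sub | mul | div | mod

/-- The value of a binary operation on integer registers. -/
def IntOp.eval : IntOp → ℕ → ℕ → ℕ
  | .add, x, y => x + y
  | .sub, x, y => x - y
  | .mul, x, y => x * y
  | .div, x, y => x / y
  | .mod, x, y => x % y

/-- Binary operations on complex numbers. -/
inductive CpxOp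
  | add | sub | mul

/-- The value of a binary operation on complex numbers. -/
def CpxOp.eval : CpxOp → ℂ → ℂ → ℂ
  | .add, x, y => x + y
  | .sub, x, y => x - y
  | .mul, x, y => x * y

/-- Unary operations on complex numbers. -/
inductive CpxFun
  | copy | conj | exp

/-- The value of a unary operation on complex numbers. -/
def CpxFun.eval : CpxFun → ℂ → ℂ
  | .copy, x => x
  | .conj, x => star x
  | .exp, x => Complex.exp x

/-- Constants that can be loaded into a complex cell. -/
inductive CpxConst
  | pi | imag

/-- The value of a complex constant. -/
def CpxConst.eval : CpxConst → ℂ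
  | .pi => Real.pi
  | .imag => Complex.I

/-- An address: the name of an array, which is fixed in the program, and the number of the integer
register that holds the index. -/
structure Addr where
  /-- The name of the array. -/
  arr : ℕ
  /-- The register that holds the index into the array. -/
  idx : ℕ

/-- Programs; `i`, `x`, `y` are numbers of integer registers. -/
inductive Prog
  /-- do nothing -/
  | skip
  /-- one program after another -/
  | seq (P Q : Prog)
  /-- `if x < y then P else Q` -/
  | ifLt (x y : ℕ) (P Q : Prog)
  /-- `for i = 0, …, x - 1 do P`, where `x` is read once, at the start -/
  | forLt (i x : ℕ) (P : Prog)
  /-- `i := c` for a constant `c` -/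
  | intConst (i c : ℕ)
  /-- `i := x ∘ y` -/
  | intOp (o : IntOp) (i x y : ℕ)
  /-- `A := x / y`, a rational number -/
  | cpxRat (A : Addr) (x y : ℕ)
  /-- `A := c` -/
  | cpxConst (A : Addr) (c : CpxConst)
  /-- `A := g(B)` -/
  | cpxFun (g : CpxFun) (A B : Addr)
  /-- `A := B ∘ D` -/
  | cpxOp (o : CpxOp) (A B D : Addr)
  /-- `A := B ^ x` -/
  | cpxPow (A B : Addr) (x : ℕ)

/-- The state of the machine, with a record of the resources used so far. -/
structure Config where
  /-- the integer registers -/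
  reg : ℕ → ℕ
  /-- the complex memory cells, by array and index -/
  mem : ℕ → ℕ → ℂ
  /-- the number of steps made -/
  time : ℕ
  /-- the memory cells read or written -/
  touched : Finset (ℕ × ℕ)
  /-- the largest integer written into a register -/
  word : ℕ

/-- The cell that an address denotes. -/
def Config.cell (s : Config) (A : Addr) : ℕ × ℕ := (A.arr, s.reg A.idx)

/-- The content of the cell that an address denotes. -/
def Config.get (s : Config) (A : Addr) : ℂ := s.mem A.arr (s.reg A.idx)

/-- One step without any other effect. -/
def Config.tick (s : Config) : Config := { s with time := s.time + 1 }

/-- One step that writes `n` into register `i`. -/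
def Config.setReg (s : Config) (i n : ℕ) : Config :=
  { s with
    reg := Function.update s.reg i n
    time := s.time + 1
    word := max s.word n }

/-- One step that writes `z` into the cell `A`, having read the cells in `S`. -/
def Config.setCell (s : Config) (A : Addr) (z : ℂ) (S : Finset (ℕ × ℕ)) : Config :=
  { s with
    mem := Function.update s.mem A.arr
      (Function.update (s.mem A.arr) (s.reg A.idx) z)
    time := s.time + 1
    touched := s.touched ∪ insert (s.cell A) S }

/-- Apply `F 0`, then `F 1`, up to `F (n - 1)`. -/
def Config.loop (F : ℕ → Config → Config) : ℕ → Config → Config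
  | 0, s => s
  | n + 1, s => F n (Config.loop F n s)

/-- Execution of a program. -/
def Prog.run : Prog → Config → Config
  | .skip, s => s.tick
  | .seq P Q, s => Q.run (P.run s)
  | .ifLt x y P Q, s => if s.reg x < s.reg y then P.run s.tick else Q.run s.tick
  | .forLt i x P, s =>
      Config.loop (fun j s' => P.run (s'.setReg i j)) (s.reg x) s.tick
  | .intConst i c, s => s.setReg i c
  | .intOp o i x y, s => s.setReg i (o.eval (s.reg x) (s.reg y))
  | .cpxRat A x y, s => s.setCell A ((s.reg x : ℂ) / (s.reg y : ℂ)) ∅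
  | .cpxConst A c, s => s.setCell A c.eval ∅
  | .cpxFun g A B, s => s.setCell A (g.eval (s.get B)) {s.cell B}
  | .cpxOp o A B D, s => s.setCell A (o.eval (s.get B) (s.get D)) {s.cell B, s.cell D}
  | .cpxPow A B x, s => s.setCell A (s.get B ^ s.reg x) {s.cell B}

/-- The initial configuration. Registers `0, 1, 2` hold `k, p, d`. Array `0` holds the angles
`γ_1, …, γ_p`, arrays `1, 2, 3` hold the values of `φ`, `ξ`, `ψ` at `0, …, k - 1`, and array `4`
holds the entries of the matrices `U_1, …, U_p` one after another, each by rows. All other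
registers and cells hold `0`. -/
def inputConfig {k p : ℕ} (d : ℕ) (γ : Fin p → ℝ) (U : Fin p → Matrix (ZMod k) (ZMod k) ℂ)
    (ψ : ZMod k → ℂ) (φ ξ : ZMod k → ℝ) : Config where
  reg i := if i = 0 then k else if i = 1 then p else if i = 2 then d else 0
  mem A x :=
    if A = 0 then (if h : x < p then (γ ⟨x, h⟩ : ℂ) else 0)
    else if A = 1 then (if x < k then (φ (x : ZMod k) : ℂ) else 0)
    else if A = 2 then (if x < k then (ξ (x : ZMod k) : ℂ) else 0)
    else if A = 3 then (if x < k then ψ (x : ZMod k) else 0)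
    else if A = 4 then
      (if h : x / (k * k) < p then
        U ⟨x / (k * k), h⟩ ((x / k % k : ℕ) : ZMod k) ((x % k : ℕ) : ZMod k) else 0)
    else 0
  time := 0
  touched := ∅
  word := 0

/-- The output of a computation: cell `0` of array `5`. -/
def Config.output (s : Config) : ℂ := s.mem 5 0

end

noncomputable section

set_option linter.unusedSectionVars false

/-! ## The Hadamard transform diagonalizes convolutions -/

section Hadamard

variable {k n : ℕ} [NeZero k]

/-! The expectation is a sum over histories. The observable is diagonal, so the bra and ket
histories of a vertex join into one ditstring. Mixers and initial state then give a product of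
weights `f` over the vertices, and the phasers give one factor e^{iΦ} per edge
(`edgeExpectation_eq_sum_paths`). This is a mean over independent labels with a complex density of
total mass one (`sum_pathWeight`).

Unitarity of the mixers yields the light cone. If a function reads a label only in the layers up to
`s`, the later layers can be summed out, and bra and ket are forced to agree in layer `s`
(`sum_pathWeight_diagonal`). The phases between two such vertices cancel in that layer. Peeling off
layers from the last one, every edge without an end at distance less than `p` from `uv` drops out
(`labelMean_edgePhases_congr`). By the girth bound the edges that remain form a tree around `uv`:
two routes to `uv` would close a cycle of length at most `2p + 1` (`parent_unique`,
`eq_edge_of_edgeDepth_eq`). Regularity gives each inner vertex `d` children. Summing out the leaves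
therefore applies `M` to `f H^{(r)}` and raises the result to the power `d`
(`labelMean_branch_step`); after `p` rounds each end of `uv` carries `H^{(p)}`.

The diagonalization is orthogonality of the characters of ℤ_k^n.

For the running time, both kernels are products over the `2p + 2` coordinates, so a convolution can
be done one axis at a time (`axisIter_apply`): `k^{2p+1}` lines of length `k` per axis. Each line is
padded to a power-of-two length between `2k` and `4k` and convolved by a fast Fourier transform,
which costs O(k log k) for every `k`. With `p + 1` rounds of `2p + 2` axes this makes O(p² k^{2p+2}
log k) steps; the degree enters only as an exponent in a single instruction. A weakest-precondition
calculus (`wp_sound`) proves the output, the time and the size of the integers. The memory bound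
follows from the syntax of the program (`Prog.AddressesIn.bounded_run`). -/

theorem hadamard_apply_eq_prod (x y : Fin n → ZMod k) :
    hadamard k n x y =
      ((Real.sqrt k : ℂ) ^ n)⁻¹ * ∏ j, ZMod.stdAddChar (-(x j * y j)) := by
  have h (j : Fin n) : (ZMod.stdAddChar (-(x j * y j)) : ℂ) =
      Complex.exp (-(2 * Real.pi * Complex.I * (((x j).val : ℂ) * ((y j).val : ℂ)) / k)) := by
    have h1 : -(x j * y j) = ((-(((x j).val : ℤ) * ((y j).val : ℤ)) : ℤ) : ZMod k) := by
      push_cast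
      simp only [ZMod.natCast_val, ZMod.cast_id', id_eq]
    rw [h1, ZMod.stdAddChar_coe]
    congr 1
    push_cast
    ring
  simp only [hadamard, Matrix.of_apply, h, ← Complex.exp_sum]
  congr 2
  rw [Finset.sum_neg_distrib, Finset.mul_sum, Finset.sum_div]

theorem star_stdAddChar (x : ZMod k) :
    (starRingEnd ℂ) (ZMod.stdAddChar x) = ZMod.stdAddChar (-x) := by
  rw [ZMod.stdAddChar_apply, ZMod.stdAddChar_apply, ← Circle.coe_inv_eq_conj, AddChar.map_neg_eq_inv]

/-- The sum factors over the coordinates. A coordinate with `z j ≠ 0` carries a nontrivial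
character, because the standard character is primitive, and its sum vanishes. -/
theorem sum_prod_stdAddChar (z : Fin n → ZMod k) :
    ∑ x : Fin n → ZMod k, ∏ j, (ZMod.stdAddChar (x j * z j) : ℂ) =
      if z = 0 then (k : ℂ) ^ n else 0 := by
  rw [← Fintype.piFinset_univ,
    Finset.sum_prod_piFinset Finset.univ (fun j y => (ZMod.stdAddChar (y * z j) : ℂ))]
  have h (w : ZMod k) : ∑ y : ZMod k, (ZMod.stdAddChar (y * w) : ℂ) = if w = 0 then (k : ℂ) else 0 := by
    rw [AddChar.sum_mulShift w (ZMod.isPrimitive_stdAddChar k), ZMod.card]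
    split_ifs <;> simp
  simp only [h]
  split_ifs with hz
  · simp [hz]
  · obtain ⟨j, hj⟩ := Function.ne_iff.mp hz
    exact Finset.prod_eq_zero (Finset.mem_univ j) (by rw [if_neg (by simpa using hj)])

theorem sqrt_pow_mul_self (k n : ℕ) :
    ((Real.sqrt k : ℂ) ^ n) * ((Real.sqrt k : ℂ) ^ n) = (k : ℂ) ^ n := by
  rw [← mul_pow, ← Complex.ofReal_mul, Real.mul_self_sqrt (Nat.cast_nonneg k)]
  simp

theorem sqrt_pow_ne_zero (k n : ℕ) [NeZero k] : ((Real.sqrt k : ℂ) ^ n) ≠ 0 := by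
  have : 0 < Real.sqrt k := Real.sqrt_pos.mpr (Nat.cast_pos.mpr (NeZero.pos k))
  exact pow_ne_zero _ (by exact_mod_cast this.ne')

theorem star_hadamard_apply (x y : Fin n → ZMod k) :
    star (hadamard k n x y) =
      ((Real.sqrt k : ℂ) ^ n)⁻¹ * ∏ j, ZMod.stdAddChar (x j * y j) := by
  rw [hadamard_apply_eq_prod, ← starRingEnd_apply, map_mul, map_prod, map_inv₀, map_pow,
    Complex.conj_ofReal]
  simp only [star_stdAddChar, neg_neg]

theorem hadamard_mem_unitaryGroup (k n : ℕ) [NeZero k] :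
    hadamard k n ∈ Matrix.unitaryGroup (Fin n → ZMod k) ℂ := by
  rw [Matrix.mem_unitaryGroup_iff']
  ext a b
  rw [Matrix.mul_apply, Matrix.one_apply]
  simp only [Matrix.star_apply, star_hadamard_apply]
  simp only [hadamard_apply_eq_prod]
  have h (x : Fin n → ZMod k) :
      ((Real.sqrt k : ℂ) ^ n)⁻¹ * (∏ j, (ZMod.stdAddChar (x j * a j) : ℂ)) *
        (((Real.sqrt k : ℂ) ^ n)⁻¹ * ∏ j, (ZMod.stdAddChar (-(x j * b j)) : ℂ)) =
      ((k : ℂ) ^ n)⁻¹ * ∏ j, (ZMod.stdAddChar (x j * (a - b) j) : ℂ) := by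
    rw [← sqrt_pow_mul_self, mul_inv, mul_mul_mul_comm, ← Finset.prod_mul_distrib]
    simp only [← AddChar.map_add_eq_mul, Pi.sub_apply, sub_eq_add_neg, mul_add, mul_neg]
  have hk : (k : ℂ) ^ n ≠ 0 := pow_ne_zero _ (NeZero.ne _)
  simp only [h, ← Finset.mul_sum, sum_prod_stdAddChar, sub_eq_zero]
  split_ifs <;> simp [hk]

/-- The entry of the product is k^{-n} ∑_c m(c) ∑_x χ(x·(a - b - c)), and orthogonality of
characters leaves only `c = a - b`. -/
theorem isHadamardConvolution_of_apply {M : Matrix (Fin n → ZMod k) (Fin n → ZMod k) ℂ}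
    {m : (Fin n → ZMod k) → ℂ} (h : ∀ a b, M a b = m (a - b)) : IsHadamardConvolution M m := by
  refine ⟨h, ?_⟩
  ext a b
  rw [Matrix.mul_apply]
  simp only [Matrix.mul_diagonal, Matrix.conjTranspose_apply, Matrix.mulVec, dotProduct,
    star_hadamard_apply, h]
  simp only [hadamard_apply_eq_prod]
  have hs := sqrt_pow_ne_zero k n
  have hk : (k : ℂ) ^ n ≠ 0 := pow_ne_zero _ (NeZero.ne _)
  have h1 (x : Fin n → ZMod k) :
      ((Real.sqrt k : ℂ) ^ n)⁻¹ * (∏ j, (ZMod.stdAddChar (x j * a j) : ℂ)) *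
        ((Real.sqrt k : ℂ) ^ n * ∑ c, ((Real.sqrt k : ℂ) ^ n)⁻¹ *
          (∏ j, (ZMod.stdAddChar (-(x j * c j)) : ℂ)) * m c) *
        (((Real.sqrt k : ℂ) ^ n)⁻¹ * ∏ j, (ZMod.stdAddChar (-(x j * b j)) : ℂ)) =
      ∑ c, ((k : ℂ) ^ n)⁻¹ * m c * ∏ j, (ZMod.stdAddChar (x j * (a - b - c) j) : ℂ) := by
    rw [← sqrt_pow_mul_self, Finset.mul_sum, Finset.mul_sum, Finset.sum_mul]
    refine Finset.sum_congr rfl fun c _ => ?_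
    have h2 : ∏ j, (ZMod.stdAddChar (x j * (a - b - c) j) : ℂ) =
        (∏ j, (ZMod.stdAddChar (x j * a j) : ℂ)) * (∏ j, (ZMod.stdAddChar (-(x j * c j)) : ℂ)) *
          ∏ j, (ZMod.stdAddChar (-(x j * b j)) : ℂ) := by
      simp only [← Finset.prod_mul_distrib, ← AddChar.map_add_eq_mul, Pi.sub_apply]
      refine Finset.prod_congr rfl fun j _ => ?_
      congr 1
      ring
    rw [h2]
    field_simp
  simp only [h1]
  rw [Finset.sum_comm]
  simp only [← Finset.mul_sum, sum_prod_stdAddChar, sub_eq_zero]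
  rw [Finset.sum_eq_single (a - b)]
  · simp only [if_true]
    field_simp
  · intro c _ hc
    rw [if_neg (Ne.symm hc), mul_zero]
  · simp

end Hadamard

/-! ### The matrices of the iteration as convolutions -/

section

variable {k p : ℕ} [NeZero k]

theorem phaseMatrix_isHadamardConvolution (γ : Fin p → ℝ) (φ : ZMod k → ℝ) :
    IsHadamardConvolution (phaseMatrix γ (onDiff φ)) (phaseKernel γ φ) :=
  isHadamardConvolution_of_apply fun _ _ => rfl

theorem lossMatrix_isHadamardConvolution (γ : Fin p → ℝ) (φ ξ : ZMod k → ℝ) :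
    IsHadamardConvolution (lossMatrix γ (onDiff φ) (onDiff ξ)) (lossKernel γ φ ξ) :=
  isHadamardConvolution_of_apply fun _ _ => rfl

theorem branchTensor_succ (d : ℕ) (γ : Fin p → ℝ) (U : Fin p → Matrix (ZMod k) (ZMod k) ℂ)
    (ψ : ZMod k → ℂ) (φ : ZMod k → ZMod k → ℝ) (r : ℕ) (a : Fin (2 * p + 2) → ZMod k) :
    branchTensor d γ U ψ φ (r + 1) a =
      ((phaseMatrix γ φ *ᵥ fun b => pathWeight U ψ b * branchTensor d γ U ψ φ r b) a) ^ d := by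
  simp only [branchTensor, Matrix.mulVec, dotProduct, phaseMatrix, Matrix.of_apply, mul_comm]

end

/-! ## Expansion of the expectation over paths -/

section PathExpansion

variable {V : Type*} [Fintype V] [DecidableEq V] {k p : ℕ} [NeZero k]

/-- The amplitude of a history of configurations, one per layer boundary. -/
def historyAmplitude {p : ℕ} (C : (V → ZMod k) → ℝ) (γ : Fin p → ℝ)
    (U : Fin p → Matrix (ZMod k) (ZMod k) ℂ) (ψ : ZMod k → ℂ) (y : Fin (p + 1) → V → ZMod k) : ℂ :=
  (∏ v, ψ (y 0 v)) * ∏ t : Fin p, (Complex.exp (-(Complex.I * (γ t : ℂ) * (C (y t.castSucc) : ℂ))) *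
    ∏ v, U t (y t.succ v) (y t.castSucc v))

theorem historyAmplitude_snoc {p : ℕ} (C : (V → ZMod k) → ℝ) (γ : Fin (p + 1) → ℝ)
    (U : Fin (p + 1) → Matrix (ZMod k) (ZMod k) ℂ) (ψ : ZMod k → ℂ)
    (y : Fin (p + 1) → V → ZMod k) (x : V → ZMod k) :
    historyAmplitude C γ U ψ (Fin.snoc y x : Fin (p + 1 + 1) → V → ZMod k) =
      historyAmplitude C (fun t => γ t.castSucc) (fun t => U t.castSucc) ψ y *
        (Complex.exp (-(Complex.I * (γ (Fin.last p) : ℂ) * (C (y (Fin.last p)) : ℂ))) *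
          ∏ v, U (Fin.last p) (x v) (y (Fin.last p) v)) := by
  have h0 : (Fin.snoc y x : Fin (p + 1 + 1) → V → ZMod k) 0 = y 0 := by
    rw [← Fin.castSucc_zero, Fin.snoc_castSucc]
  rw [historyAmplitude, historyAmplitude, Fin.prod_univ_castSucc, h0]
  simp only [Fin.snoc_castSucc, Fin.succ_last, Fin.snoc_last, Fin.succ_castSucc, mul_assoc]

/-- A complete basis is inserted between consecutive layers. Induction peels off the last layer,
whose output is the last configuration of the history. -/
theorem qaoaState_apply {p : ℕ} (C : (V → ZMod k) → ℝ) (γ : Fin p → ℝ)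
    (U : Fin p → Matrix (ZMod k) (ZMod k) ℂ) (ψ : ZMod k → ℂ) (x : V → ZMod k) :
    qaoaState C γ U ψ x =
      ∑ y : Fin (p + 1) → V → ZMod k,
        if y (Fin.last p) = x then historyAmplitude C γ U ψ y else 0 := by
  induction p generalizing x with
  | zero =>
    rw [← (Equiv.funUnique (Fin 1) (V → ZMod k)).symm.sum_comp]
    simp [qaoaState, historyAmplitude]
  | succ p ih =>
    have h1 : qaoaState C γ U ψ = mixer V (U (Fin.last p)) *ᵥ (phaser C (γ (Fin.last p)) *ᵥ
        qaoaState C (fun t => γ t.castSucc) (fun t => U t.castSucc) ψ) := by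
      rw [qaoaState, Fin.foldl_succ_last]
      rfl
    rw [h1, ← (Fin.snocEquiv (fun _ : Fin (p + 1 + 1) => V → ZMod k)).sum_comp,
      Fintype.sum_prod_type_right]
    simp only [Matrix.mulVec, dotProduct, mixer, phaser, Matrix.of_apply, Matrix.diagonal_apply,
      ite_mul, zero_mul, Finset.sum_ite_eq, Finset.mem_univ, if_true, ih]
    simp only [Fin.snocEquiv, Equiv.coe_fn_mk, Fin.snoc_last, historyAmplitude_snoc,
      Finset.sum_ite_eq', Finset.mem_univ, if_true, Finset.mul_sum, mul_ite, mul_zero]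
    rw [Finset.sum_comm]
    refine Finset.sum_congr rfl fun y _ => ?_
    rw [Finset.sum_ite_eq, if_pos (Finset.mem_univ _)]
    ring

theorem posIdx_or_negIdx (i : Fin (2 * p + 2)) : (∃ t, posIdx t = i) ∨ ∃ t, negIdx t = i := by
  by_cases h : (i : ℕ) ≤ p
  · exact Or.inl ⟨⟨i, by omega⟩, rfl⟩
  · refine Or.inr ⟨⟨2 * p + 1 - i, by omega⟩, Fin.ext ?_⟩
    simp only [negIdx]
    omega

/-- Splitting the ditstrings of all vertices into the histories of the bra and of the ket. -/
theorem bijective_histories :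
    Function.Bijective (fun a : V → Fin (2 * p + 2) → ZMod k =>
      ((fun t v => a v (posIdx t), fun t v => a v (negIdx t)) :
        (Fin (p + 1) → V → ZMod k) × (Fin (p + 1) → V → ZMod k))) := by
  constructor
  · intro a b h
    rw [Prod.mk.injEq] at h
    funext v i
    rcases posIdx_or_negIdx i with ⟨t, rfl⟩ | ⟨t, rfl⟩
    · exact congrFun (congrFun h.1 t) v
    · exact congrFun (congrFun h.2 t) v
  · rintro ⟨y, z⟩
    refine ⟨fun v i => if h : (i : ℕ) ≤ p then y ⟨i, by omega⟩ v
      else z ⟨2 * p + 1 - i, by omega⟩ v, ?_⟩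
    refine Prod.ext ?_ ?_
    · funext t v
      have : (t : ℕ) ≤ p := by omega
      simp [posIdx, this]
    · funext t v
      have h1 : ¬ (2 * p + 1 - (t : ℕ) ≤ p) := by omega
      have h2 : 2 * p + 1 - (2 * p + 1 - (t : ℕ)) = t := by omega
      simp [negIdx, h1, h2]

/-- The difference of the costs of an edge between bra and ket in layer `t + 1`. -/
def edgeDiff (φ : ZMod k → ZMod k → ℝ) (hφ : ∀ x y, φ x y = φ y x)
    (a : V → Fin (2 * p + 2) → ZMod k) (t : Fin p) (e : Sym2 V) : ℝ :=
  Sym2.lift ⟨fun w w' => φ (a w (posIdx t.castSucc)) (a w' (posIdx t.castSucc)) -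
    φ (a w (negIdx t.castSucc)) (a w' (negIdx t.castSucc)),
    fun w w' => by dsimp only; rw [hφ (a w (posIdx t.castSucc)), hφ (a w (negIdx t.castSucc))]⟩ e

/-- The product of the phases of the edges in `E`, where edge `e` has angle `c e t` in
layer `t + 1`. -/
def edgePhases (E : Finset (Sym2 V)) (φ : ZMod k → ZMod k → ℝ) (hφ : ∀ x y, φ x y = φ y x)
    (c : Sym2 V → Fin p → ℝ) (a : V → Fin (2 * p + 2) → ZMod k) : ℂ :=
  ∏ e ∈ E, Complex.exp (Complex.I * ((∑ t, c e t * edgeDiff φ hφ a t e : ℝ) : ℂ))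

theorem prod_pathWeight (U : Fin p → Matrix (ZMod k) (ZMod k) ℂ) (ψ : ZMod k → ℂ)
    (a : V → Fin (2 * p + 2) → ZMod k) :
    ∏ v, pathWeight U ψ (a v) =
      if (fun v => a v (negIdx (Fin.last p))) = (fun v => a v (posIdx (Fin.last p))) then
        star ((∏ v, ψ (a v (posIdx 0))) * ∏ t : Fin p, ∏ v,
          U t (a v (posIdx t.succ)) (a v (posIdx t.castSucc))) *
        ((∏ v, ψ (a v (negIdx 0))) * ∏ t : Fin p, ∏ v,
          U t (a v (negIdx t.succ)) (a v (negIdx t.castSucc)))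
      else 0 := by
  split_ifs with h
  · have h' (v : V) : a v (posIdx (Fin.last p)) = a v (negIdx (Fin.last p)) := (congrFun h v).symm
    simp only [pathWeight, h', if_true, mul_one, Finset.prod_mul_distrib,
      Matrix.conjTranspose_apply, star_mul', star_prod]
    rw [Finset.prod_comm, Finset.prod_comm (s := Finset.univ (α := V))]
    ring
  · obtain ⟨v, hv⟩ := Function.ne_iff.mp h
    refine Finset.prod_eq_zero (Finset.mem_univ v) ?_
    rw [pathWeight, if_neg (fun h => hv h.symm)]
    simp

/-- A diagonal observable forces bra and ket to end in the same configuration, which is the product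
of the indicators in `f`. The phases of the bra enter conjugated, so each edge contributes the
difference of its two costs. -/
theorem edgeExpectation_eq_sum_paths (G : SimpleGraph V) [DecidableRel G.Adj]
    (φ ξ : ZMod k → ZMod k → ℝ) (hφ : ∀ x y, φ x y = φ y x) (γ : Fin p → ℝ)
    (U : Fin p → Matrix (ZMod k) (ZMod k) ℂ) (ψ : ZMod k → ℂ) (u v : V) :
    edgeExpectation ξ u v (qaoaState (qaoaCost G φ hφ) γ U ψ) =
      ∑ a : V → Fin (2 * p + 2) → ZMod k, (∏ w, pathWeight U ψ (a w)) *
        (edgePhases G.edgeFinset φ hφ (fun _ t => γ t) a *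
          (ξ (a u (posIdx (Fin.last p))) (a v (posIdx (Fin.last p))) : ℂ)) := by
  set C := qaoaCost G φ hφ with hC
  have h1 : edgeExpectation ξ u v (qaoaState C γ U ψ) =
      ∑ yz : (Fin (p + 1) → V → ZMod k) × (Fin (p + 1) → V → ZMod k),
        if yz.2 (Fin.last p) = yz.1 (Fin.last p) then
          star (historyAmplitude C γ U ψ yz.1) * historyAmplitude C γ U ψ yz.2 *
            (ξ (yz.1 (Fin.last p) u) (yz.1 (Fin.last p) v) : ℂ) else 0 := by
    rw [Fintype.sum_prod_type]
    simp only [edgeExpectation, dotProduct, Matrix.mulVec_diagonal, Pi.star_apply]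
    simp only [qaoaState_apply, star_sum, Finset.sum_mul]
    rw [Finset.sum_comm]
    refine Finset.sum_congr rfl fun y _ => ?_
    rw [Finset.sum_eq_single (y (Fin.last p))]
    · rw [if_pos rfl, Finset.mul_sum, Finset.mul_sum]
      refine Finset.sum_congr rfl fun z _ => ?_
      split_ifs
      · ring
      · simp
    · intro x _ hx
      rw [if_neg hx.symm]
      simp
    · simp
  rw [h1, ← (bijective_histories (V := V) (k := k) (p := p)).sum_comp]
  refine Finset.sum_congr rfl fun a _ => ?_
  rw [prod_pathWeight]
  split_ifs with h
  swap
  · simp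
  have h2 (y : Fin (p + 1) → V → ZMod k) : historyAmplitude C γ U ψ y =
      Complex.exp (-(Complex.I * ((∑ t, γ t * C (y t.castSucc) : ℝ) : ℂ))) *
        ((∏ v, ψ (y 0 v)) * ∏ t : Fin p, ∏ v, U t (y t.succ v) (y t.castSucc v)) := by
    rw [historyAmplitude, Finset.prod_mul_distrib, ← Complex.exp_sum, Finset.sum_neg_distrib]
    push_cast
    simp only [Finset.mul_sum, mul_assoc]
    ring
  have h3 : edgePhases G.edgeFinset φ hφ (fun _ t => γ t) a =
      star (Complex.exp (-(Complex.I *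
        ((∑ t, γ t * C (fun v => a v (posIdx t.castSucc)) : ℝ) : ℂ)))) *
      Complex.exp (-(Complex.I *
        ((∑ t, γ t * C (fun v => a v (negIdx t.castSucc)) : ℝ) : ℂ))) := by
    rw [edgePhases, ← Complex.exp_sum, ← starRingEnd_apply, ← Complex.exp_conj, ← Complex.exp_add]
    congr 1
    rw [map_neg, map_mul, Complex.conj_I, Complex.conj_ofReal, ← Finset.mul_sum,
      ← Complex.ofReal_sum]
    have h4 : ∑ e ∈ G.edgeFinset, ∑ t, γ t * edgeDiff φ hφ a t e =
        ∑ t, γ t * C (fun v => a v (posIdx t.castSucc)) -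
          ∑ t, γ t * C (fun v => a v (negIdx t.castSucc)) := by
      rw [Finset.sum_comm, ← Finset.sum_sub_distrib]
      refine Finset.sum_congr rfl fun t _ => ?_
      rw [← Finset.mul_sum, ← mul_sub, hC, qaoaCost, qaoaCost, ← Finset.sum_sub_distrib]
      congr 1
      refine Finset.sum_congr rfl fun e _ => ?_
      induction e with
      | h w w' => rfl
    rw [h4]
    push_cast
    ring
  rw [h2, h2, h3, star_mul']
  ring

end PathExpansion

/-! ## Means over independent labels -/

section LabelMean

variable {V A : Type*} [Fintype V] [DecidableEq V] [Fintype A]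

/-- The mean of `g` when the labels of the vertices are independent with complex density `f`. -/
def labelMean (f : A → ℂ) (g : (V → A) → ℂ) : ℂ := ∑ a, (∏ w, f (a w)) * g a

/-- Stated as a product, not as a quotient, since `f (a w)` may vanish. -/
theorem prod_update_mul (f : A → ℂ) (a : V → A) (w : V) (b : A) :
    (∏ v, f (Function.update a w b v)) * f (a w) = (∏ v, f (a v)) * f b := by
  rw [Fintype.prod_eq_mul_prod_compl w, Fintype.prod_eq_mul_prod_compl w (fun v => f (a v)),
    Function.update_self]
  have h : ∏ v ∈ {w}ᶜ, f (Function.update a w b v) = ∏ v ∈ {w}ᶜ, f (a v) := by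
    refine Finset.prod_congr rfl fun v hv => ?_
    rw [Function.update_of_ne (by simpa using hv)]
  rw [h]
  ring

/-- Total mass one allows a fresh independent label to be added. Exchanging it with the label of `w`
is an involution that preserves the weight. Positivity plays no role, so this holds for complex
densities. -/
theorem labelMean_resample (f : A → ℂ) (hf : ∑ b, f b = 1) (g : (V → A) → ℂ) (w : V) :
    labelMean f g = labelMean f (fun a => ∑ b, f b * g (Function.update a w b)) := by
  have hinv : Function.Involutive
      (fun x : (V → A) × A => (Function.update x.1 w x.2, x.1 w)) := by
    rintro ⟨a, b⟩
    simp
  calc labelMean f g = ∑ x : (V → A) × A, (∏ v, f (x.1 v)) * f x.2 * g x.1 := by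
        rw [Fintype.sum_prod_type]
        simp only [mul_right_comm _ _ (g _), ← Finset.mul_sum, hf, mul_one, labelMean]
    _ = ∑ x : (V → A) × A, (∏ v, f (x.1 v)) * f x.2 * g (Function.update x.1 w x.2) := by
        rw [← hinv.bijective.sum_comp]
        exact Finset.sum_congr rfl fun x _ => by rw [prod_update_mul]
    _ = _ := by
        rw [Fintype.sum_prod_type]
        simp only [labelMean, Finset.mul_sum, mul_assoc]

theorem labelMean_congr_of_sum_update {f : A → ℂ} (hf : ∑ b, f b = 1) {g h : (V → A) → ℂ} (w : V)
    (H : ∀ a, ∑ b, f b * g (Function.update a w b) = ∑ b, f b * h (Function.update a w b)) :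
    labelMean f g = labelMean f h := by
  rw [labelMean_resample f hf g w, labelMean_resample f hf h w]
  simp only [H]

end LabelMean

/-! ## The single-vertex weight -/

section Weight

variable {k : ℕ} [NeZero k]

/-- The weight of a single vertex in terms of the pairs of bra and ket labels. -/
def pairWeight {p : ℕ} (U : Fin p → Matrix (ZMod k) (ZMod k) ℂ) (ψ : ZMod k → ℂ)
    (c : Fin (p + 1) → ZMod k × ZMod k) : ℂ :=
  (∏ t : Fin p, star (U t (c t.succ).1 (c t.castSucc).1) * U t (c t.succ).2 (c t.castSucc).2) *
    (if (c (Fin.last p)).1 = (c (Fin.last p)).2 then 1 else 0) *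
    (star (ψ (c 0).1) * ψ (c 0).2)

theorem pathWeight_eq_pairWeight {p : ℕ} (U : Fin p → Matrix (ZMod k) (ZMod k) ℂ)
    (ψ : ZMod k → ℂ) (a : Fin (2 * p + 2) → ZMod k) :
    pathWeight U ψ a = pairWeight U ψ (fun t => (a (posIdx t), a (negIdx t))) := by
  rw [pathWeight, pairWeight, mul_assoc _ (star _)]
  rfl

theorem sum_star_mul_of_unitary {U : Matrix (ZMod k) (ZMod k) ℂ} (hU : Uᴴ * U = 1) (x y : ZMod k) :
    ∑ z, star (U z x) * U z y = if x = y then 1 else 0 := by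
  rw [← Matrix.one_apply, ← hU, Matrix.mul_apply]
  rfl

/-- The indicator identifies the two labels of the last layer. Unitarity of the last mixer then
turns the sum over them into the indicator one layer earlier, which completes the weight with one
layer fewer. -/
theorem sum_pairWeight_init {p : ℕ} (U : Fin (p + 1) → Matrix (ZMod k) (ZMod k) ℂ)
    (hU : ∀ t, (U t)ᴴ * U t = 1) (ψ : ZMod k → ℂ)
    (g : (Fin (p + 1) → ZMod k × ZMod k) → ℂ) :
    ∑ c : Fin (p + 1 + 1) → ZMod k × ZMod k, pairWeight U ψ c * g (Fin.init c) =
      ∑ c, pairWeight (fun t => U t.castSucc) ψ c * g c := by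
  rw [← (Fin.snocEquiv (fun _ : Fin (p + 1 + 1) => ZMod k × ZMod k)).sum_comp,
    Fintype.sum_prod_type_right]
  refine Finset.sum_congr rfl fun c _ => ?_
  have h0 (z : ZMod k × ZMod k) :
      (Fin.snoc c z : Fin (p + 1 + 1) → ZMod k × ZMod k) 0 = c 0 := by
    rw [← Fin.castSucc_zero, Fin.snoc_castSucc]
  have hw (z : ZMod k × ZMod k) :
      pairWeight U ψ (Fin.snoc c z : Fin (p + 1 + 1) → ZMod k × ZMod k) =
      (∏ t : Fin p, star (U t.castSucc (c t.succ).1 (c t.castSucc).1) *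
        U t.castSucc (c t.succ).2 (c t.castSucc).2) * (star (ψ (c 0).1) * ψ (c 0).2) *
      (if z.1 = z.2 then star (U (Fin.last p) z.1 (c (Fin.last p)).1) *
        U (Fin.last p) z.2 (c (Fin.last p)).2 else 0) := by
    rw [pairWeight, Fin.prod_univ_castSucc, h0]
    simp only [Fin.snoc_castSucc, Fin.succ_last, Fin.snoc_last, Fin.succ_castSucc]
    split_ifs <;> ring
  simp only [Fin.snocEquiv, Equiv.coe_fn_mk, Fin.init_snoc, hw]
  rw [← Finset.sum_mul, ← Finset.mul_sum, Fintype.sum_prod_type]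
  simp only [Finset.sum_ite_eq, Finset.mem_univ, if_true]
  rw [sum_star_mul_of_unitary (hU _), pairWeight]
  ring

theorem sum_pairWeight {p : ℕ} (U : Fin p → Matrix (ZMod k) (ZMod k) ℂ)
    (hU : ∀ t, (U t)ᴴ * U t = 1) (ψ : ZMod k → ℂ) (hψ : ∑ a, ‖ψ a‖ ^ 2 = 1) :
    ∑ c, pairWeight U ψ c = 1 := by
  induction p with
  | zero =>
    rw [← (Equiv.funUnique (Fin 1) (ZMod k × ZMod k)).symm.sum_comp, Fintype.sum_prod_type]
    have h : (∑ a, star (ψ a) * ψ a) = 1 := by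
      rw [← Complex.ofReal_one, ← hψ, Complex.ofReal_sum]
      refine Finset.sum_congr rfl fun a _ => ?_
      rw [← starRingEnd_apply, Complex.conj_mul']
      simp
    simpa [pairWeight] using h
  | succ p ih =>
    have h := sum_pairWeight_init U hU ψ (fun _ => 1)
    simp only [mul_one] at h
    rw [h]
    exact ih (fun t => U t.castSucc) (fun t => hU _)

/-- The layers after `s`, which `g` does not read, are summed out one by one; the weight that
remains contains the indicator for layer `s`. This is the cancellation of U†U behind the light cone.
-/
theorem sum_pairWeight_diagonal {p : ℕ} (U : Fin p → Matrix (ZMod k) (ZMod k) ℂ)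
    (hU : ∀ t, (U t)ᴴ * U t = 1) (ψ : ZMod k → ℂ) (s : Fin (p + 1))
    (g : (Fin (p + 1) → ZMod k × ZMod k) → ℂ)
    (hg : ∀ c c', (∀ t ≤ s, c t = c' t) → g c = g c') :
    ∑ c, pairWeight U ψ c * g c =
      ∑ c, pairWeight U ψ c * (if (c s).1 = (c s).2 then g c else 0) := by
  induction p with
  | zero =>
    refine Finset.sum_congr rfl fun c _ => ?_
    have hs : s = Fin.last 0 := Fin.ext (by have := s.isLt; simp only [Fin.val_last]; omega)
    subst hs
    split_ifs with h
    · rfl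
    · rw [pairWeight, if_neg h]
      simp
  | succ p ih =>
    induction s using Fin.lastCases with
    | last =>
      refine Finset.sum_congr rfl fun c _ => ?_
      split_ifs with h
      · rfl
      · rw [pairWeight, if_neg h]
        simp
    | cast s =>
      -- Since `g` ignores the last layer, its entry there can be replaced by an arbitrary value,
      -- here `0`.
      have h1 (c : Fin (p + 1 + 1) → ZMod k × ZMod k) :
          g c = g (Fin.snoc (Fin.init c) 0) := by
        refine hg _ _ fun t ht => ?_
        obtain ⟨t, rfl⟩ := Fin.exists_castSucc_eq.mpr (Fin.ne_last_of_lt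
          (lt_of_le_of_lt ht (Fin.castSucc_lt_last s)))
        rw [Fin.snoc_castSucc, Fin.init]
      have h2 := ih (fun t => U t.castSucc) (fun t => hU _) s (fun c => g (Fin.snoc c 0)) ?_
      · rw [← sum_pairWeight_init U hU ψ, ← sum_pairWeight_init U hU ψ] at h2
        simp only [← h1] at h2
        exact h2
      · intro c c' h
        refine hg _ _ fun t ht => ?_
        obtain ⟨t, rfl⟩ := Fin.exists_castSucc_eq.mpr (Fin.ne_last_of_lt
          (lt_of_le_of_lt ht (Fin.castSucc_lt_last s)))
        rw [Fin.snoc_castSucc, Fin.snoc_castSucc]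
        exact h t (Fin.castSucc_le_castSucc_iff.mp ht)

theorem bijective_pairs {p : ℕ} :
    Function.Bijective (fun (a : Fin (2 * p + 2) → ZMod k) (t : Fin (p + 1)) =>
      (a (posIdx t), a (negIdx t))) := by
  constructor
  · intro a b h
    funext i
    rcases posIdx_or_negIdx i with ⟨t, rfl⟩ | ⟨t, rfl⟩
    · exact congrArg Prod.fst (congrFun h t)
    · exact congrArg Prod.snd (congrFun h t)
  · intro c
    obtain ⟨a, ha⟩ := (bijective_histories (V := Unit) (k := k) (p := p)).2
      (fun t _ => (c t).1, fun t _ => (c t).2)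
    rw [Prod.mk.injEq] at ha
    refine ⟨a (), funext fun t => Prod.ext ?_ ?_⟩
    · exact congrFun (congrFun ha.1 t) ()
    · exact congrFun (congrFun ha.2 t) ()

variable {p : ℕ}

theorem sum_pathWeight (U : Fin p → Matrix (ZMod k) (ZMod k) ℂ)
    (hU : ∀ t, (U t)ᴴ * U t = 1) (ψ : ZMod k → ℂ) (hψ : ∑ a, ‖ψ a‖ ^ 2 = 1) :
    ∑ a, pathWeight U ψ a = 1 := by
  rw [← sum_pairWeight U hU ψ hψ, ← (bijective_pairs (k := k) (p := p)).sum_comp]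
  simp only [pathWeight_eq_pairWeight]

/-- The labels of two ditstrings agree in the layers up to `s`. -/
def AgreeUpTo (s : Fin (p + 1)) (a b : Fin (2 * p + 2) → ZMod k) : Prop :=
  ∀ t ≤ s, a (posIdx t) = b (posIdx t) ∧ a (negIdx t) = b (negIdx t)

theorem sum_pathWeight_diagonal (U : Fin p → Matrix (ZMod k) (ZMod k) ℂ)
    (hU : ∀ t, (U t)ᴴ * U t = 1) (ψ : ZMod k → ℂ) (s : Fin (p + 1))
    (g : (Fin (2 * p + 2) → ZMod k) → ℂ) (hg : ∀ a b, AgreeUpTo s a b → g a = g b) :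
    ∑ a, pathWeight U ψ a * g a =
      ∑ a, pathWeight U ψ a * (if a (posIdx s) = a (negIdx s) then g a else 0) := by
  let e := Equiv.ofBijective _ (bijective_pairs (k := k) (p := p))
  have he (a : Fin (2 * p + 2) → ZMod k) :
      e a = fun t : Fin (p + 1) => (a (posIdx t), a (negIdx t)) := rfl
  have h := sum_pairWeight_diagonal U hU ψ s (fun c => g (e.symm c)) ?_
  · rw [← e.sum_comp, ← e.sum_comp] at h
    simp only [Equiv.symm_apply_apply] at h
    simp only [he, ← pathWeight_eq_pairWeight] at h
    exact h
  · intro c c' hc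
    refine hg _ _ fun t ht => ?_
    obtain ⟨a, rfl⟩ := e.surjective c
    obtain ⟨b, rfl⟩ := e.surjective c'
    have := hc t ht
    simp only [he, Prod.mk.injEq] at this
    simpa using this

end Weight

/-! ## The light cone -/

section LightCone

variable {V : Type*} [Fintype V] [DecidableEq V] {k p : ℕ} [NeZero k]

/-- `F` depends on the label of `w` only through the layers up to `s`. -/
def DependsUpTo (s : Fin (p + 1)) (w : V) (F : (V → Fin (2 * p + 2) → ZMod k) → ℂ) : Prop :=
  ∀ a b b', AgreeUpTo s b b' → F (Function.update a w b) = F (Function.update a w b')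

/-- The indicator of equal bra and ket labels of `w` in layer `s`. -/
def diagIndicator (s : Fin (p + 1)) (w : V) (a : V → Fin (2 * p + 2) → ZMod k) : ℂ :=
  if a w (posIdx s) = a w (negIdx s) then 1 else 0

theorem dependsUpTo_diagIndicator (s : Fin (p + 1)) (w w' : V) :
    DependsUpTo s w (diagIndicator (k := k) s w') := by
  intro a b b' h
  by_cases hw : w' = w
  · subst hw
    simp [diagIndicator, (h s le_rfl).1, (h s le_rfl).2]
  · simp [diagIndicator, Function.update_of_ne hw]

theorem DependsUpTo.mul {s : Fin (p + 1)} {w : V} {F F' : (V → Fin (2 * p + 2) → ZMod k) → ℂ}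
    (h : DependsUpTo s w F) (h' : DependsUpTo s w F') :
    DependsUpTo s w (fun a => F a * F' a) := by
  intro a b b' hb
  simp only [h a b b' hb, h' a b b' hb]

theorem DependsUpTo.prod {ι : Type*} {S : Finset ι} {s : Fin (p + 1)} {w : V}
    {F : ι → (V → Fin (2 * p + 2) → ZMod k) → ℂ} (h : ∀ i ∈ S, DependsUpTo s w (F i)) :
    DependsUpTo s w (fun a => ∏ i ∈ S, F i a) := by
  intro a b b' hb
  exact Finset.prod_congr rfl fun i hi => h i hi a b b' hb

/-- The indicators are inserted one vertex at a time. Each reads only layer `s`, so the integrand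
still depends on the next vertex only through the layers up to `s`. -/
theorem labelMean_mul_diagIndicators {U : Fin p → Matrix (ZMod k) (ZMod k) ℂ}
    (hU : ∀ t, (U t)ᴴ * U t = 1) {ψ : ZMod k → ℂ} (hψ : ∑ a, ‖ψ a‖ ^ 2 = 1) (s : Fin (p + 1))
    (F : (V → Fin (2 * p + 2) → ZMod k) → ℂ) (W : Finset V)
    (hF : ∀ w ∈ W, DependsUpTo s w F) :
    labelMean (pathWeight U ψ) F =
      labelMean (pathWeight U ψ) (fun a => F a * ∏ w ∈ W, diagIndicator s w a) := by
  induction W using Finset.induction_on with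
  | empty => simp
  | insert w W hw ih =>
    rw [ih fun w' hw' => hF w' (Finset.mem_insert_of_mem hw')]
    refine labelMean_congr_of_sum_update (sum_pathWeight U hU ψ hψ) w fun a => ?_
    have hd : DependsUpTo s w (fun a => F a * ∏ w ∈ W, diagIndicator s w a) :=
      (hF w (Finset.mem_insert_self _ _)).mul
        (DependsUpTo.prod fun w' _ => dependsUpTo_diagIndicator s w w')
    rw [sum_pathWeight_diagonal U hU ψ s _ (fun b b' hb => hd a b b' hb)]
    refine Finset.sum_congr rfl fun b _ => ?_
    rw [Finset.prod_insert hw]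
    congr 1
    conv_rhs => rw [diagIndicator, Function.update_self]
    split_ifs <;> simp

theorem edgeDiff_update_congr (φ : ZMod k → ZMod k → ℝ) (hφ : ∀ x y, φ x y = φ y x)
    (a : V → Fin (2 * p + 2) → ZMod k) (w : V) (b b' : Fin (2 * p + 2) → ZMod k) (t : Fin p)
    (e : Sym2 V) (h : w ∈ e → b (posIdx t.castSucc) = b' (posIdx t.castSucc) ∧
      b (negIdx t.castSucc) = b' (negIdx t.castSucc)) :
    edgeDiff φ hφ (Function.update a w b) t e = edgeDiff φ hφ (Function.update a w b') t e := by
  induction e with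
  | h x y =>
    have hx (z : V) (hz : z ∈ s(x, y)) (i : Fin (2 * p + 2))
        (hi : i = posIdx t.castSucc ∨ i = negIdx t.castSucc) :
        Function.update a w b z i = Function.update a w b' z i := by
      by_cases hzw : z = w
      · subst hzw
        rw [Function.update_self, Function.update_self]
        rcases hi with rfl | rfl
        · exact (h hz).1
        · exact (h hz).2
      · rw [Function.update_of_ne hzw, Function.update_of_ne hzw]
    have h1 := hx x (Sym2.mem_mk_left x y)
    have h2 := hx y (Sym2.mem_mk_right x y)
    simp only [edgeDiff, Sym2.lift_mk]
    rw [h1 _ (Or.inl rfl), h1 _ (Or.inr rfl), h2 _ (Or.inl rfl), h2 _ (Or.inr rfl)]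

/-- The angles after removing the layers outside of the light cone, up to depth `j`. -/
def coneAngles (D : V → ℕ) (j : ℕ) (c : Sym2 V → Fin p → ℝ) (e : Sym2 V) (t : Fin p) : ℝ :=
  open Classical in if (∀ w ∈ e, p - t ≤ D w) ∧ p - t ≤ j then 0 else c e t

/-- A vertex at depth at least `j + 1` has all its neighbours at depth at least `j`, so its edges
have already lost their angles in the last `j` layers, and only the layers up to `s` see it.
Indicators for layer `s` can thus be inserted at all these vertices, and they make the phase of an
edge between two of them trivial in that layer. -/
theorem labelMean_coneAngles_succ {U : Fin p → Matrix (ZMod k) (ZMod k) ℂ}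
    (hU : ∀ t, (U t)ᴴ * U t = 1) {ψ : ZMod k → ℂ} (hψ : ∑ a, ‖ψ a‖ ^ 2 = 1)
    (φ ξ : ZMod k → ZMod k → ℝ) (hφ : ∀ x y, φ x y = φ y x) (E : Finset (Sym2 V)) (D : V → ℕ)
    (hD : ∀ e ∈ E, ∀ x ∈ e, ∀ y ∈ e, D x ≤ D y + 1) {u v : V} (hu : D u = 0) (hv : D v = 0)
    (c : Sym2 V → Fin p → ℝ) (j : ℕ) (hj : j < p) :
    labelMean (pathWeight U ψ) (fun a => edgePhases E φ hφ (coneAngles D j c) a *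
      (ξ (a u (posIdx (Fin.last p))) (a v (posIdx (Fin.last p))) : ℂ)) =
    labelMean (pathWeight U ψ) (fun a => edgePhases E φ hφ (coneAngles D (j + 1) c) a *
      (ξ (a u (posIdx (Fin.last p))) (a v (posIdx (Fin.last p))) : ℂ)) := by
  classical
  -- The layer `t` with `p - t = j + 1`, which is the one to be removed.
  let s : Fin (p + 1) := ⟨p - 1 - j, by omega⟩
  let W : Finset V := Finset.univ.filter fun w => j + 1 ≤ D w
  have hdep (i : ℕ) (hi : j ≤ i) (w : V) (hw : w ∈ W) : DependsUpTo s w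
      (fun a => edgePhases E φ hφ (coneAngles D i c) a *
        (ξ (a u (posIdx (Fin.last p))) (a v (posIdx (Fin.last p))) : ℂ)) := by
    have hw' : j + 1 ≤ D w := by simpa [W] using hw
    refine DependsUpTo.mul (DependsUpTo.prod fun e he a b b' hb => ?_) ?_
    · congr 3
      refine Finset.sum_congr rfl fun t _ => ?_
      by_cases hwe : w ∈ e
      · by_cases ht : p - t ≤ j
        · have h0 : coneAngles D i c e t = 0 := by
            refine if_pos ⟨fun x hx => ?_, by omega⟩
            have := hD e he w hwe x hx
            omega
          rw [h0, zero_mul, zero_mul]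
        · rw [edgeDiff_update_congr]
          intro _
          refine hb _ (Fin.le_def.mpr ?_)
          simp only [s, Fin.val_castSucc]
          omega
      · rw [edgeDiff_update_congr]
        exact fun h => absurd h hwe
    · intro a b b' _
      have h1 : u ≠ w := by rintro rfl; omega
      have h2 : v ≠ w := by rintro rfl; omega
      simp only [Function.update_of_ne h1, Function.update_of_ne h2]
  rw [labelMean_mul_diagIndicators hU hψ s _ W (hdep j le_rfl),
    labelMean_mul_diagIndicators hU hψ s _ W (hdep (j + 1) (Nat.le_succ j))]
  congr 1
  funext a
  -- Where some indicator vanishes, both sides are zero. Elsewhere they differ only in angles that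
  -- are multiplied by an `edgeDiff` equal to zero.
  by_cases hall : ∀ w ∈ W, a w (posIdx s) = a w (negIdx s)
  swap
  · push Not at hall
    obtain ⟨w, hw, h⟩ := hall
    rw [Finset.prod_eq_zero hw (by rw [diagIndicator, if_neg h]), mul_zero, mul_zero]
  congr 2
  refine Finset.prod_congr rfl fun e _ => ?_
  congr 3
  refine Finset.sum_congr rfl fun t _ => ?_
  by_cases ht : (∀ w ∈ e, p - t ≤ D w) ∧ p - t = j + 1
  · have hst : t.castSucc = s := Fin.ext (by simp only [s, Fin.val_castSucc]; omega)
    have h0 : edgeDiff φ hφ a t e = 0 := by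
      induction e with
      | h x y =>
        have hx : x ∈ W := by
          have := ht.1 x (Sym2.mem_mk_left x y)
          simp only [W, Finset.mem_filter, Finset.mem_univ, true_and]
          omega
        have hy : y ∈ W := by
          have := ht.1 y (Sym2.mem_mk_right x y)
          simp only [W, Finset.mem_filter, Finset.mem_univ, true_and]
          omega
        simp only [edgeDiff, Sym2.lift_mk, hst]
        rw [hall x hx, hall y hy, sub_self]
    rw [h0, mul_zero, mul_zero]
  · congr 1
    simp only [coneAngles]
    refine if_congr ?_ rfl rfl
    constructor
    · exact fun h => ⟨h.1, by omega⟩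
    · intro h
      refine ⟨h.1, ?_⟩
      by_contra hc
      exact ht ⟨h.1, by omega⟩

/-- At `j = p`, an edge without an end of depth less than `p` has lost its angle in every layer, for
`c` and for `c'` alike. So nothing beyond the light cone has to be known about the graph. -/
theorem labelMean_edgePhases_congr {U : Fin p → Matrix (ZMod k) (ZMod k) ℂ}
    (hU : ∀ t, (U t)ᴴ * U t = 1) {ψ : ZMod k → ℂ} (hψ : ∑ a, ‖ψ a‖ ^ 2 = 1)
    (φ ξ : ZMod k → ZMod k → ℝ) (hφ : ∀ x y, φ x y = φ y x) (E : Finset (Sym2 V)) (D : V → ℕ)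
    (hD : ∀ e ∈ E, ∀ x ∈ e, ∀ y ∈ e, D x ≤ D y + 1) {u v : V} (hu : D u = 0) (hv : D v = 0)
    (c c' : Sym2 V → Fin p → ℝ) (hc : ∀ e t, (∃ w ∈ e, D w < p) → c e t = c' e t) :
    labelMean (pathWeight U ψ) (fun a => edgePhases E φ hφ c a *
      (ξ (a u (posIdx (Fin.last p))) (a v (posIdx (Fin.last p))) : ℂ)) =
    labelMean (pathWeight U ψ) (fun a => edgePhases E φ hφ c' a *
      (ξ (a u (posIdx (Fin.last p))) (a v (posIdx (Fin.last p))) : ℂ)) := by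
  have key (c : Sym2 V → Fin p → ℝ) (j : ℕ) (hj : j ≤ p) :
      labelMean (pathWeight U ψ) (fun a => edgePhases E φ hφ c a *
        (ξ (a u (posIdx (Fin.last p))) (a v (posIdx (Fin.last p))) : ℂ)) =
      labelMean (pathWeight U ψ) (fun a => edgePhases E φ hφ (coneAngles D j c) a *
        (ξ (a u (posIdx (Fin.last p))) (a v (posIdx (Fin.last p))) : ℂ)) := by
    induction j with
    | zero =>
      have h : coneAngles D 0 c = c := by
        funext e t
        exact if_neg (by omega)
      rw [h]
    | succ j ih =>
      rw [ih (by omega), labelMean_coneAngles_succ hU hψ φ ξ hφ E D hD hu hv c j hj]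
  have h : coneAngles D p c = coneAngles D p c' := by
    funext e t
    by_cases h : ∃ w ∈ e, D w < p
    · simp only [coneAngles, hc e t h]
    · push Not at h
      simp only [coneAngles]
      rw [if_pos ⟨fun w hw => by have := h w hw; omega, by omega⟩,
        if_pos ⟨fun w hw => by have := h w hw; omega, by omega⟩]
  rw [key c p le_rfl, key c' p le_rfl, h]

end LightCone

/-! ## Neighbourhoods of an edge in a graph of large girth -/

section Girth

variable {V : Type*} {G : SimpleGraph V}

/-- The edges of the two paths form a subgraph with at most `q.length + q'.length` edges. A cycle in
it would be shorter than the girth, so it is acyclic and its paths are unique. -/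
theorem SimpleGraph.Walk.eq_of_isPath_of_length_lt_egirth {a b : V} {q q' : G.Walk a b}
    (hq : q.IsPath) (hq' : q'.IsPath) (h : ((q.length + q'.length : ℕ) : ℕ∞) < G.egirth) :
    q = q' := by
  classical
  let H : SimpleGraph V := SimpleGraph.fromEdgeSet {e | e ∈ q.edges ∨ e ∈ q'.edges}
  have hH : ∀ e, e ∈ H.edgeSet ↔ e ∈ q.edges ∨ e ∈ q'.edges := by
    intro e
    rw [SimpleGraph.edgeSet_fromEdgeSet]
    refine ⟨fun h => h.1, fun h => ⟨h, ?_⟩⟩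
    rcases h with h | h
    · exact G.not_isDiag_of_mem_edgeSet (q.edges_subset_edgeSet h)
    · exact G.not_isDiag_of_mem_edgeSet (q'.edges_subset_edgeSet h)
  have hHG : H ≤ G := by
    rw [← SimpleGraph.edgeSet_subset_edgeSet]
    intro e he
    rcases (hH e).1 he with h | h
    · exact q.edges_subset_edgeSet h
    · exact q'.edges_subset_edgeSet h
  have hac : H.IsAcyclic := by
    intro z w hw
    have h1 : w.length ≤ q.length + q'.length := by
      rw [← w.length_edges, ← q.length_edges, ← q'.length_edges, ← List.length_append]
      refine List.Subperm.length_le (List.subperm_of_subset hw.isCircuit.isTrail.edges_nodup ?_)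
      intro e he
      rw [List.mem_append]
      exact (hH e).1 (w.edges_subset_edgeSet he)
    have h2 := SimpleGraph.egirth_le_length (hw.mapLe hHG)
    rw [SimpleGraph.Walk.length_map] at h2
    exact absurd (lt_of_lt_of_le h (h2.trans (by exact_mod_cast h1))) (lt_irrefl _)
  have hqe : ∀ e ∈ q.edges, e ∈ H.edgeSet := fun e he => (hH e).2 (Or.inl he)
  have hqe' : ∀ e ∈ q'.edges, e ∈ H.edgeSet := fun e he => (hH e).2 (Or.inr he)
  have h3 := (hac.subsingleton_path a b).elim ⟨q.transfer H hqe, hq.transfer hqe⟩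
    ⟨q'.transfer H hqe', hq'.transfer hqe'⟩
  apply SimpleGraph.Walk.ext_support
  have h4 := congrArg (fun x : H.Path a b => x.1.support) h3
  simpa using h4

variable {p : ℕ} {u v : V}

/-- The distance of `w` from the edge `uv`, cut off at `p + 1`. -/
def edgeDepth (G : SimpleGraph V) (p : ℕ) (u v w : V) : ℕ :=
  sInf {r | p + 1 ≤ r ∨ ∃ z, (z = u ∨ z = v) ∧ ∃ q : G.Walk w z, q.length = r}

theorem edgeDepth_mem (w : V) :
    edgeDepth G p u v w ∈
      {r | p + 1 ≤ r ∨ ∃ z, (z = u ∨ z = v) ∧ ∃ q : G.Walk w z, q.length = r} :=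
  Nat.sInf_mem ⟨p + 1, Or.inl le_rfl⟩

theorem edgeDepth_le {w z : V} (hz : z = u ∨ z = v) (q : G.Walk w z) :
    edgeDepth G p u v w ≤ q.length :=
  Nat.sInf_le (Or.inr ⟨z, hz, q, rfl⟩)

theorem edgeDepth_le_succ {w x : V} (h : G.Adj w x) :
    edgeDepth G p u v w ≤ edgeDepth G p u v x + 1 := by
  rcases edgeDepth_mem (G := G) (p := p) (u := u) (v := v) x with hx | ⟨z, hz, q, hq⟩
  · exact Nat.sInf_le (Or.inl (by omega))
  · have := edgeDepth_le (p := p) hz (SimpleGraph.Walk.cons h q)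
    rw [SimpleGraph.Walk.length_cons, hq] at this
    exact this

theorem edgeDepth_eq_zero_iff {w : V} : edgeDepth G p u v w = 0 ↔ w = u ∨ w = v := by
  constructor
  · intro h
    rcases edgeDepth_mem (G := G) (p := p) (u := u) (v := v) w with hx | ⟨z, hz, q, hq⟩
    · omega
    · rw [h] at hq
      rw [SimpleGraph.Walk.eq_of_length_eq_zero hq]
      exact hz
  · intro h
    have := edgeDepth_le (p := p) h (SimpleGraph.Walk.nil : G.Walk w w)
    simpa using this

theorem exists_adj_edgeDepth {w : V} {r : ℕ} (hr : r + 1 ≤ p)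
    (hw : edgeDepth G p u v w = r + 1) : ∃ x, G.Adj w x ∧ edgeDepth G p u v x = r := by
  rcases edgeDepth_mem (G := G) (p := p) (u := u) (v := v) w with hx | ⟨z, hz, q, hq⟩
  · omega
  · cases q with
    | nil => rw [SimpleGraph.Walk.length_nil] at hq; omega
    | @cons _ x _ h q =>
      rw [SimpleGraph.Walk.length_cons] at hq
      refine ⟨x, h, ?_⟩
      have h1 := edgeDepth_le (p := p) hz q
      have h2 := edgeDepth_le_succ (p := p) (u := u) (v := v) h
      omega

/-- A shortest path to the edge `uv`. The two clauses on its support serve to prolong it to a longer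
path: at `w` by a vertex of no smaller depth, at `z` across the edge `uv`. -/
theorem exists_descending_path {r : ℕ} (hr : r ≤ p) {w : V} (hw : edgeDepth G p u v w = r) :
    ∃ z, (z = u ∨ z = v) ∧ ∃ q : G.Walk w z, q.IsPath ∧ q.length = r ∧
      (∀ x ∈ q.support, x = w ∨ edgeDepth G p u v x < r) ∧
      ∀ x ∈ q.support, edgeDepth G p u v x = 0 → x = z := by
  induction r generalizing w with
  | zero =>
    refine ⟨w, edgeDepth_eq_zero_iff.1 hw, SimpleGraph.Walk.nil, SimpleGraph.Walk.IsPath.nil,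
      rfl, ?_, ?_⟩
    · intro x hx
      left
      simpa using hx
    · intro x hx _
      simpa using hx
  | succ r ih =>
    obtain ⟨x, hwx, hx⟩ := exists_adj_edgeDepth hr hw
    obtain ⟨z, hz, q, hq, hl, hs, hs0⟩ := ih (by omega) hx
    have hs' : ∀ y ∈ q.support, edgeDepth G p u v y < r + 1 := by
      intro y hy
      rcases hs y hy with rfl | h
      · omega
      · omega
    refine ⟨z, hz, SimpleGraph.Walk.cons hwx q, ?_, ?_, ?_, ?_⟩
    · rw [SimpleGraph.Walk.cons_isPath_iff]
      refine ⟨hq, fun h => ?_⟩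
      have := hs' w h
      omega
    · rw [SimpleGraph.Walk.length_cons, hl]
    · intro y hy
      rw [SimpleGraph.Walk.support_cons, List.mem_cons] at hy
      rcases hy with rfl | hy
      · exact Or.inl rfl
      · exact Or.inr (hs' y hy)
    · intro y hy hy0
      rw [SimpleGraph.Walk.support_cons, List.mem_cons] at hy
      rcases hy with rfl | hy
      · omega
      · exact hs0 y hy hy0

/-- A path from `w` through its neighbour `x` to the edge `uv`. -/
theorem exists_path_cons {w x : V} (hwx : G.Adj w x) {r : ℕ} (hr : r ≤ p)
    (hx : edgeDepth G p u v x = r) (hw : r ≤ edgeDepth G p u v w) :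
    ∃ z, (z = u ∨ z = v) ∧ ∃ q : G.Walk w z, q.IsPath ∧ q.length = r + 1 ∧ q.snd = x ∧
      ∀ y ∈ q.support, edgeDepth G p u v y = 0 → y = w ∨ y = z := by
  obtain ⟨z, hz, q, hq, hl, hs, hs0⟩ := exists_descending_path hr hx
  refine ⟨z, hz, SimpleGraph.Walk.cons hwx q, ?_, ?_, ?_, ?_⟩
  · rw [SimpleGraph.Walk.cons_isPath_iff]
    refine ⟨hq, fun h => ?_⟩
    rcases hs w h with h | h
    · exact hwx.ne h
    · omega
  · rw [SimpleGraph.Walk.length_cons, hl]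
  · simp
  · intro y hy hy0
    rw [SimpleGraph.Walk.support_cons, List.mem_cons] at hy
    rcases hy with rfl | hy
    · exact Or.inl rfl
    · exact Or.inr (hs0 y hy hy0)

/-- Two paths from `w` to the edge `uv` leave `w` in the same direction. -/
theorem snd_eq_of_paths_to_edge (huv : G.Adj u v) {w z z' : V} (hz : z = u ∨ z = v)
    (hz' : z' = u ∨ z' = v) {q : G.Walk w z} {q' : G.Walk w z'} (hq : q.IsPath) (hq' : q'.IsPath)
    (hn : ¬ q.Nil) (hs : z ≠ z' → z' ∉ q.support)
    (h : ((q.length + q'.length + 1 : ℕ) : ℕ∞) < G.egirth) : q.snd = q'.snd := by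
  by_cases hzz : z = z'
  · subst hzz
    rw [SimpleGraph.Walk.eq_of_isPath_of_length_lt_egirth hq hq'
      (lt_of_le_of_lt (by exact_mod_cast Nat.le_succ _) h)]
  -- If the ends differ, `q` is prolonged across `uv` to a path from `w` to `z'`. This edge is the
  -- `+ 1` in the length bound.
  · have hadj : G.Adj z z' := by
      rcases hz with rfl | rfl <;> rcases hz' with rfl | rfl
      · exact absurd rfl hzz
      · exact huv
      · exact huv.symm
      · exact absurd rfl hzz
    have h1 : (q.concat hadj).IsPath := hq.concat (hs hzz) hadj
    have h2 := SimpleGraph.Walk.eq_of_isPath_of_length_lt_egirth h1 hq' (by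
      rw [SimpleGraph.Walk.length_concat]
      refine lt_of_le_of_lt ?_ h
      exact_mod_cast (by omega))
    rw [← h2]
    cases q with
    | nil => exact absurd SimpleGraph.Walk.Nil.nil hn
    | cons h q => simp [SimpleGraph.Walk.concat_cons]

/-- Two parents would start two paths of length `r + 1` from `w` to `uv`. Together with `uv` they
have at most `2p + 1` edges, fewer than the girth allows for a cycle. -/
theorem parent_unique (huv : G.Adj u v) (hg : ((2 * p + 2 : ℕ) : ℕ∞) ≤ G.egirth) {r : ℕ}
    (hr : r + 1 ≤ p) {w x y : V} (hw : edgeDepth G p u v w = r + 1) (hwx : G.Adj w x)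
    (hwy : G.Adj w y) (hx : edgeDepth G p u v x = r) (hy : edgeDepth G p u v y = r) : x = y := by
  obtain ⟨z, hz, q, hq, hl, hs, hsup⟩ := exists_path_cons hwx (by omega) hx (by omega)
  obtain ⟨z', hz', q', hq', hl', hs', -⟩ := exists_path_cons hwy (by omega) hy (by omega)
  rw [← hs, ← hs']
  refine snd_eq_of_paths_to_edge huv hz hz' hq hq' ?_ ?_ ?_
  · rw [← SimpleGraph.Walk.length_eq_zero_iff]
    omega
  · intro hne hmem
    have h0 := edgeDepth_eq_zero_iff (G := G) (p := p).2 hz'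
    rcases hsup z' hmem h0 with h | h
    · rw [h] at h0
      omega
    · exact hne h.symm
  · refine lt_of_lt_of_le (Nat.cast_lt.mpr ?_) hg
    omega

/-- For `r ≥ 1`, the path from `w` through a parent and the one through `x`, together with `uv`,
have at most `2r + 2 ≤ 2p` edges, so their first steps coincide. But the parent is less deep than
`x`. -/
theorem eq_edge_of_edgeDepth_eq (huv : G.Adj u v) (hg : ((2 * p + 2 : ℕ) : ℕ∞) ≤ G.egirth) {r : ℕ}
    (hr : r + 1 ≤ p) {w x : V} (hw : edgeDepth G p u v w = r) (hx : edgeDepth G p u v x = r)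
    (hwx : G.Adj w x) : s(w, x) = s(u, v) := by
  have h0 : r = 0 := by
    by_contra hr0
    obtain ⟨r, rfl⟩ := Nat.exists_eq_succ_of_ne_zero hr0
    obtain ⟨y, hwy, hy⟩ := exists_adj_edgeDepth (by omega) hw
    obtain ⟨z, hz, q, hq, hl, hs, hsup⟩ := exists_path_cons hwy (by omega) hy (by omega)
    obtain ⟨z', hz', q', hq', hl', hs', -⟩ := exists_path_cons hwx (by omega) hx (by omega)
    have h1 : q.snd = q'.snd := by
      refine snd_eq_of_paths_to_edge huv hz hz' hq hq' ?_ ?_ ?_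
      · rw [← SimpleGraph.Walk.length_eq_zero_iff]
        omega
      · intro hne hmem
        have h0 := edgeDepth_eq_zero_iff (G := G) (p := p).2 hz'
        rcases hsup z' hmem h0 with h | h
        · rw [h] at h0
          omega
        · exact hne h.symm
      · refine lt_of_lt_of_le (Nat.cast_lt.mpr ?_) hg
        omega
    rw [hs, hs'] at h1
    rw [h1] at hy
    omega
  subst h0
  rcases edgeDepth_eq_zero_iff.1 hw with rfl | rfl <;>
    rcases edgeDepth_eq_zero_iff.1 hx with rfl | rfl
  · exact absurd hwx (SimpleGraph.irrefl _)
  · rfl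
  · exact Sym2.eq_swap
  · exact absurd hwx (SimpleGraph.irrefl _)

end Girth

/-! ## Eliminating the vertices of a tree -/

section LabelMean

variable {V A : Type*} [Fintype V] [DecidableEq V] [Fintype A]

/-- The vertices of `S` behave like leaves: the factor `g w` reads labels of `S` only through its
last argument, so each vertex of `S` is averaged on its own. -/
theorem labelMean_mul_prod_eliminate {f : A → ℂ} (hf : ∑ b, f b = 1) (S : Finset V)
    (F : (V → A) → ℂ) (g : V → (V → A) → A → ℂ)
    (hF : ∀ w ∈ S, ∀ a b, F (Function.update a w b) = F a)
    (hg : ∀ w ∈ S, ∀ x ∈ S, ∀ a b, g x (Function.update a w b) = g x a) :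
    labelMean f (fun a => F a * ∏ w ∈ S, g w a (a w)) =
      labelMean f (fun a => F a * ∏ w ∈ S, ∑ b, f b * g w a b) := by
  induction S using Finset.induction_on generalizing F with
  | empty => simp
  | insert w S hw ih =>
    have h1 := ih (fun a => F a * g w a (a w)) ?_ ?_
    · simp only [Finset.prod_insert hw, ← mul_assoc]
      rw [h1]
      refine labelMean_congr_of_sum_update hf w fun a => ?_
      have h2 : ∀ b, ∏ x ∈ S, ∑ b', f b' * g x (Function.update a w b) b' =
          ∏ x ∈ S, ∑ b', f b' * g x a b' := fun b =>
        Finset.prod_congr rfl fun x hx => by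
          rw [hg w (Finset.mem_insert_self _ _) x (Finset.mem_insert_of_mem hx)]
      simp only [h2, hF w (Finset.mem_insert_self _ _),
        hg w (Finset.mem_insert_self _ _) w (Finset.mem_insert_self _ _), Function.update_self]
      simp only [← Finset.sum_mul, hf, one_mul, ← mul_assoc]
      rw [Finset.mul_sum]
      congr 1
      exact Finset.sum_congr rfl fun b _ => by ring
    · intro x hx a b
      have hxw : w ≠ x := fun h => hw (h ▸ hx)
      simp only [hF x (Finset.mem_insert_of_mem hx), Function.update_of_ne hxw,
        hg x (Finset.mem_insert_of_mem hx) w (Finset.mem_insert_self _ _)]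
    · intro x hx y hy
      exact hg x (Finset.mem_insert_of_mem hx) y (Finset.mem_insert_of_mem hy)

theorem labelMean_const {f : A → ℂ} (hf : ∑ b, f b = 1) (z : ℂ) :
    labelMean (V := V) f (fun _ => z) = z := by
  have h := Finset.sum_prod_piFinset (ι := V) (Finset.univ : Finset A) (fun _ => f)
  rw [Fintype.piFinset_univ] at h
  rw [labelMean, ← Finset.sum_mul, h]
  simp [hf]

theorem labelMean_two {f : A → ℂ} (hf : ∑ b, f b = 1) {u v : V} (huv : u ≠ v) (g : A → A → ℂ) :
    labelMean f (fun a : V → A => g (a u) (a v)) = ∑ x, ∑ y, f x * (f y * g x y) := by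
  rw [labelMean_resample f hf _ u]
  simp only [Function.update_self, Function.update_of_ne huv.symm]
  rw [labelMean_resample f hf _ v]
  simp only [Function.update_self]
  rw [labelMean_const hf, ]
  simp only [Finset.mul_sum]
  rw [Finset.sum_comm]
  exact Finset.sum_congr rfl fun x _ => Finset.sum_congr rfl fun y _ => by ring

end LabelMean

/-! ### Collapsing the tree around an edge onto the two ends -/

section Tree

variable {V : Type*} [Fintype V] [DecidableEq V] {k p d : ℕ} [NeZero k]
  {G : SimpleGraph V} [DecidableRel G.Adj] {u v : V}

/-- The neighbour of `w` towards the edge `uv`. -/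
def edgeParent (G : SimpleGraph V) (p : ℕ) (u v w : V) : V :=
  open Classical in
  if h : ∃ x, G.Adj w x ∧ edgeDepth G p u v x + 1 = edgeDepth G p u v w then h.choose else w

theorem edgeParent_spec {w : V} (h1 : 1 ≤ edgeDepth G p u v w) (h2 : edgeDepth G p u v w ≤ p) :
    G.Adj w (edgeParent G p u v w) ∧
      edgeDepth G p u v (edgeParent G p u v w) + 1 = edgeDepth G p u v w := by
  obtain ⟨x, hx, hd⟩ := exists_adj_edgeDepth (G := G) (p := p) (u := u) (v := v) (w := w)
    (r := edgeDepth G p u v w - 1) (by omega) (by omega)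
  have h : ∃ x, G.Adj w x ∧ edgeDepth G p u v x + 1 = edgeDepth G p u v w := ⟨x, hx, by omega⟩
  rw [edgeParent, dif_pos h]
  exact h.choose_spec

theorem eq_edgeParent (huv : G.Adj u v) (hg : ((2 * p + 2 : ℕ) : ℕ∞) ≤ G.egirth) {w x : V}
    (hwx : G.Adj w x) (hd : edgeDepth G p u v x + 1 = edgeDepth G p u v w)
    (hp : edgeDepth G p u v w ≤ p) : edgeParent G p u v w = x := by
  obtain ⟨h1, h2⟩ := edgeParent_spec (G := G) (p := p) (u := u) (v := v) (w := w) (by omega) hp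
  exact parent_unique huv hg (r := edgeDepth G p u v x) (by omega) hd.symm h1 hwx (by omega) rfl

/-- Exactly one neighbour of `x` is not deeper than `x`: its parent or, if `x` lies on the edge
`uv`, the other end of that edge. -/
theorem card_children (huv : G.Adj u v) (hg : ((2 * p + 2 : ℕ) : ℕ∞) ≤ G.egirth)
    (hreg : G.IsRegularOfDegree (d + 1)) {x : V} (hx : edgeDepth G p u v x < p) :
    (Finset.univ.filter fun w => edgeDepth G p u v w = edgeDepth G p u v x + 1 ∧
      edgeParent G p u v w = x).card = d := by
  set S := Finset.univ.filter fun w => edgeDepth G p u v w = edgeDepth G p u v x + 1 ∧ edgeParent G p u v w = x with hS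
  have hmem (w : V) : w ∈ S ↔ G.Adj x w ∧ edgeDepth G p u v w = edgeDepth G p u v x + 1 := by
    rw [hS, Finset.mem_filter]
    constructor
    · rintro ⟨-, h1, h2⟩
      have h3 := (edgeParent_spec (G := G) (p := p) (u := u) (v := v) (w := w)
        (by omega) (by omega)).1
      rw [h2] at h3
      exact ⟨h3.symm, h1⟩
    · rintro ⟨h1, h2⟩
      exact ⟨Finset.mem_univ _, h2, eq_edgeParent huv hg h1.symm (by omega) (by omega)⟩
  have hq : ∃ q, G.Adj x q ∧ edgeDepth G p u v q ≤ edgeDepth G p u v x ∧ ∀ w, G.Adj x w → edgeDepth G p u v w ≤ edgeDepth G p u v x → w = q := by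
    rcases Nat.eq_zero_or_pos (edgeDepth G p u v x) with h0 | h0
    · have huq : ∀ w, edgeDepth G p u v w = 0 ↔ w = u ∨ w = v := fun w => edgeDepth_eq_zero_iff
      rcases (huq x).1 h0 with h | h
      · refine ⟨v, h ▸ huv, by have := (huq v).2 (Or.inr rfl); omega, fun w hw hDw => ?_⟩
        rcases (huq w).1 (by omega) with h' | h'
        · rw [h, h'] at hw
          exact absurd hw (SimpleGraph.irrefl _)
        · exact h'
      · refine ⟨u, h ▸ huv.symm, by have := (huq u).2 (Or.inl rfl); omega, fun w hw hDw => ?_⟩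
        rcases (huq w).1 (by omega) with h' | h'
        · exact h'
        · rw [h, h'] at hw
          exact absurd hw (SimpleGraph.irrefl _)
    · obtain ⟨h1, h2⟩ := edgeParent_spec (G := G) (p := p) (u := u) (v := v) (w := x) h0 (by omega)
      refine ⟨edgeParent G p u v x, h1, by omega, fun w hw hDw => ?_⟩
      rcases Nat.lt_or_ge (edgeDepth G p u v w) (edgeDepth G p u v x) with h | h
      · have h3 : edgeDepth G p u v x ≤ edgeDepth G p u v w + 1 := edgeDepth_le_succ hw
        exact (eq_edgeParent huv hg hw (by omega) (by omega)).symm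
      · have h3 := eq_edge_of_edgeDepth_eq huv hg (r := edgeDepth G p u v x) (by omega) rfl
          (by omega : edgeDepth G p u v w = edgeDepth G p u v x) hw
        have h4 : x ∈ s(u, v) := h3 ▸ Sym2.mem_mk_left x w
        have h5 := edgeDepth_eq_zero_iff (G := G) (p := p).2 (Sym2.mem_iff.1 h4)
        omega
  obtain ⟨q, hq1, hq2, hq3⟩ := hq
  have hqS : q ∉ S := by
    rw [hmem]
    omega
  have hN : G.neighborFinset x = insert q S := by
    ext w
    rw [SimpleGraph.mem_neighborFinset, Finset.mem_insert, hmem]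
    constructor
    · intro hw
      by_cases h : edgeDepth G p u v w ≤ edgeDepth G p u v x
      · exact Or.inl (hq3 w hw h)
      · have h3 : edgeDepth G p u v w ≤ edgeDepth G p u v x + 1 := edgeDepth_le_succ hw.symm
        exact Or.inr ⟨hw, by omega⟩
    · rintro (rfl | h)
      · exact hq1
      · exact h.1
  have h1 := hreg x
  rw [← SimpleGraph.card_neighborFinset_eq_degree, hN, Finset.card_insert_of_notMem hqS] at h1
  omega

/-- Depths of adjacent vertices differ by at most one. Within the light cone equal depths occur only
on `uv`; on any other edge the shallower end is the parent of the deeper one. -/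
theorem filter_edges_near (huv : G.Adj u v) (hg : ((2 * p + 2 : ℕ) : ℕ∞) ≤ G.egirth)
    (hp : 1 ≤ p) [DecidablePred fun e : Sym2 V => ∃ w ∈ e, edgeDepth G p u v w < p] :
    G.edgeFinset.filter (fun e => ∃ w ∈ e, edgeDepth G p u v w < p) =
      insert s(u, v) ((Finset.univ.filter fun w => 1 ≤ edgeDepth G p u v w ∧
        edgeDepth G p u v w ≤ p).image fun w => s(edgeParent G p u v w, w)) := by
  ext e
  rw [Finset.mem_filter, Finset.mem_insert, Finset.mem_image]
  constructor
  · rintro ⟨he, w, hw, hDw⟩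
    obtain ⟨x, rfl⟩ := hw
    have hwx : G.Adj w x := by simpa using he
    have h1 : edgeDepth G p u v w ≤ edgeDepth G p u v x + 1 := edgeDepth_le_succ hwx
    have h2 : edgeDepth G p u v x ≤ edgeDepth G p u v w + 1 := edgeDepth_le_succ hwx.symm
    rcases lt_trichotomy (edgeDepth G p u v w) (edgeDepth G p u v x) with h | h | h
    · refine Or.inr ⟨x, ?_, ?_⟩
      · simp only [Finset.mem_filter, Finset.mem_univ, true_and]
        omega
      · rw [eq_edgeParent huv hg hwx.symm (by omega) (by omega)]
    · exact Or.inl (eq_edge_of_edgeDepth_eq huv hg (r := edgeDepth G p u v w) (by omega) rfl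
        h.symm hwx)
    · refine Or.inr ⟨w, ?_, ?_⟩
      · simp only [Finset.mem_filter, Finset.mem_univ, true_and]
        omega
      · rw [eq_edgeParent huv hg hwx (by omega) (by omega), Sym2.eq_swap]
  · rintro (rfl | ⟨w, hw, rfl⟩)
    · refine ⟨by simpa using huv, u, Sym2.mem_mk_left u v, ?_⟩
      have := edgeDepth_eq_zero_iff (G := G) (p := p) (u := u) (v := v).2 (Or.inl rfl)
      omega
    · simp only [Finset.mem_filter, Finset.mem_univ, true_and] at hw
      obtain ⟨h1, h2⟩ := edgeParent_spec hw.1 hw.2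
      exact ⟨by simpa using h1.symm, _, Sym2.mem_mk_left _ _, by omega⟩

/-- The deeper end determines a tree edge, so the product over edges becomes one over vertices. -/
theorem prod_edges_near (huv : G.Adj u v) (hg : ((2 * p + 2 : ℕ) : ℕ∞) ≤ G.egirth)
    (hp : 1 ≤ p) [DecidablePred fun e : Sym2 V => ∃ w ∈ e, edgeDepth G p u v w < p]
    (F : Sym2 V → ℂ) :
    ∏ e ∈ G.edgeFinset.filter (fun e => ∃ w ∈ e, edgeDepth G p u v w < p), F e =
      F s(u, v) * ∏ w ∈ Finset.univ.filter (fun w => 1 ≤ edgeDepth G p u v w ∧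
        edgeDepth G p u v w ≤ p), F s(edgeParent G p u v w, w) := by
  rw [filter_edges_near huv hg hp, Finset.prod_insert, Finset.prod_image]
  · intro w hw x hx h
    simp only [Finset.coe_filter, Finset.mem_univ, true_and, Set.mem_ofPred_eq] at hw hx
    rcases Sym2.eq_iff.1 h with ⟨-, h⟩ | ⟨h1, h2⟩
    · exact h
    · have h3 := (edgeParent_spec hw.1 hw.2).2
      have h4 := (edgeParent_spec hx.1 hx.2).2
      rw [h1] at h3
      rw [← h2] at h4
      omega
  · intro h
    obtain ⟨w, hw, h⟩ := Finset.mem_image.1 h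
    simp only [Finset.mem_filter, Finset.mem_univ, true_and] at hw
    have h1 : w ∈ s(u, v) := h ▸ Sym2.mem_mk_right _ _
    have h5 := edgeDepth_eq_zero_iff (G := G) (p := p).2 (Sym2.mem_iff.1 h1)
    omega

/-- Averaging over a vertex at depth `r + 1` leaves the factor M(f H^{(j)}) at the label of its
parent. A parent receives this factor once from each of its `d` children, which makes H^{(j+1)}. -/
theorem labelMean_branch_step (huv : G.Adj u v) (hg : ((2 * p + 2 : ℕ) : ℕ∞) ≤ G.egirth)
    (hreg : G.IsRegularOfDegree (d + 1)) {U : Fin p → Matrix (ZMod k) (ZMod k) ℂ}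
    (hU : ∀ t, (U t)ᴴ * U t = 1) {ψ : ZMod k → ℂ} (hψ : ∑ a, ‖ψ a‖ ^ 2 = 1)
    (γ : Fin p → ℝ) (φ : ZMod k → ZMod k → ℝ)
    (B : (Fin (2 * p + 2) → ZMod k) → (Fin (2 * p + 2) → ZMod k) → ℂ) (r j : ℕ) (hr : r < p) :
    labelMean (pathWeight U ψ) (fun a : V → Fin (2 * p + 2) → ZMod k => B (a u) (a v) *
      (∏ w ∈ Finset.univ.filter (fun w => 1 ≤ edgeDepth G p u v w ∧ edgeDepth G p u v w ≤ r + 1),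
        phaseMatrix γ φ (a (edgeParent G p u v w)) (a w)) *
      ∏ w ∈ Finset.univ.filter (fun w => edgeDepth G p u v w = r + 1),
        branchTensor d γ U ψ φ j (a w)) =
    labelMean (pathWeight U ψ) (fun a : V → Fin (2 * p + 2) → ZMod k => B (a u) (a v) *
      (∏ w ∈ Finset.univ.filter (fun w => 1 ≤ edgeDepth G p u v w ∧ edgeDepth G p u v w ≤ r),
        phaseMatrix γ φ (a (edgeParent G p u v w)) (a w)) *
      ∏ w ∈ Finset.univ.filter (fun w => edgeDepth G p u v w = r),
        branchTensor d γ U ψ φ (j + 1) (a w)) := by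
  set D := edgeDepth G p u v with hD
  have hsplit : Finset.univ.filter (fun w => 1 ≤ D w ∧ D w ≤ r + 1) =
      Finset.univ.filter (fun w => 1 ≤ D w ∧ D w ≤ r) ∪
        Finset.univ.filter (fun w => D w = r + 1) := by
    ext w
    simp only [Finset.mem_union, Finset.mem_filter, Finset.mem_univ, true_and]
    omega
  have hdisj : Disjoint (Finset.univ.filter (fun w => 1 ≤ D w ∧ D w ≤ r))
      (Finset.univ.filter (fun w => D w = r + 1)) := by
    rw [Finset.disjoint_filter]
    omega
  have hpar (w : V) (hw : 1 ≤ D w ∧ D w ≤ p) : D (edgeParent G p u v w) + 1 = D w :=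
    (edgeParent_spec hw.1 hw.2).2
  have hmem (w : V) : w ∈ Finset.univ.filter (fun w => D w = r + 1) ↔ D w = r + 1 := by simp
  have hne (w x : V) (hw : D w = r + 1) (hx : D x ≤ r) : x ≠ w := by
    rintro rfl
    omega
  have hu : D u ≤ r := by
    rw [hD, edgeDepth_eq_zero_iff.2 (Or.inl rfl)]
    exact Nat.zero_le _
  have hv : D v ≤ r := by
    rw [hD, edgeDepth_eq_zero_iff.2 (Or.inr rfl)]
    exact Nat.zero_le _
  have h1 := labelMean_mul_prod_eliminate (sum_pathWeight U hU ψ hψ)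
    (Finset.univ.filter (fun w => D w = r + 1))
    (fun a : V → Fin (2 * p + 2) → ZMod k => B (a u) (a v) *
      ∏ w ∈ Finset.univ.filter (fun w => 1 ≤ D w ∧ D w ≤ r),
        phaseMatrix γ φ (a (edgeParent G p u v w)) (a w))
    (fun w a b => phaseMatrix γ φ (a (edgeParent G p u v w)) b * branchTensor d γ U ψ φ j b)
    ?_ ?_
  · simp only [hsplit, Finset.prod_union hdisj, mul_assoc, ← Finset.prod_mul_distrib] at h1 ⊢
    rw [h1]
    congr 1
    funext a
    congr 2
    have h2 (w : V) : ∑ b, pathWeight U ψ b * (phaseMatrix γ φ (a (edgeParent G p u v w)) b *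
        branchTensor d γ U ψ φ j b) = (phaseMatrix γ φ *ᵥ fun b => pathWeight U ψ b *
          branchTensor d γ U ψ φ j b) (a (edgeParent G p u v w)) := by
      simp only [Matrix.mulVec, dotProduct]
      exact Finset.sum_congr rfl fun b _ => by ring
    simp only [h2, branchTensor_succ]
    -- The vertices are grouped by parent, and `card_children` counts each group.
    rw [← Finset.prod_fiberwise_of_maps_to
      (t := Finset.univ.filter (fun w => D w = r)) (g := edgeParent G p u v)]
    · refine Finset.prod_congr rfl fun x hx => ?_
      have hx' : D x = r := by simpa using hx
      rw [Finset.prod_congr rfl (g := fun _ => (phaseMatrix γ φ *ᵥ fun b => pathWeight U ψ b *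
          branchTensor d γ U ψ φ j b) (a x))]
      · rw [Finset.prod_const, Finset.filter_filter]
        have := card_children huv hg hreg (x := x) (by rw [← hD]; omega)
        rw [← hD, hx'] at this
        rw [this]
      · intro w hw
        rw [(Finset.mem_filter.1 hw).2]
    · intro w hw
      have hw' := (hmem w).1 hw
      have := hpar w (by omega)
      simp only [Finset.mem_filter, Finset.mem_univ, true_and]
      omega
  · intro w hw a b
    have hw' := (hmem w).1 hw
    refine congrArg₂ (· * ·) (by
      rw [Function.update_of_ne (hne w u hw' hu), Function.update_of_ne (hne w v hw' hv)])
      (Finset.prod_congr rfl fun x hx => ?_)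
    simp only [Finset.mem_filter, Finset.mem_univ, true_and] at hx
    have := hpar x (by omega)
    rw [Function.update_of_ne (hne w x hw' hx.2),
      Function.update_of_ne (hne w _ hw' (by omega))]
  · intro w hw x hx a b
    have hw' := (hmem w).1 hw
    have hx' := (hmem x).1 hx
    have := hpar x (by omega)
    funext c
    rw [Function.update_of_ne (hne w _ hw' (by omega))]

/-- The elimination starts at depth `p`, where the factors H^{(0)} = 1 are invisible, and ends at
depth `0`, where only `u` and `v` are left. The function `B` stands for whatever couples these two.
-/
theorem labelMean_branch (huv : G.Adj u v) (hg : ((2 * p + 2 : ℕ) : ℕ∞) ≤ G.egirth)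
    (hreg : G.IsRegularOfDegree (d + 1)) {U : Fin p → Matrix (ZMod k) (ZMod k) ℂ}
    (hU : ∀ t, (U t)ᴴ * U t = 1) {ψ : ZMod k → ℂ} (hψ : ∑ a, ‖ψ a‖ ^ 2 = 1)
    (γ : Fin p → ℝ) (φ : ZMod k → ZMod k → ℝ)
    (B : (Fin (2 * p + 2) → ZMod k) → (Fin (2 * p + 2) → ZMod k) → ℂ) :
    labelMean (pathWeight U ψ) (fun a : V → Fin (2 * p + 2) → ZMod k => B (a u) (a v) *
      (∏ w ∈ Finset.univ.filter (fun w => 1 ≤ edgeDepth G p u v w ∧ edgeDepth G p u v w ≤ p),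
        phaseMatrix γ φ (a (edgeParent G p u v w)) (a w))) =
    ∑ x, ∑ y, pathWeight U ψ x * (pathWeight U ψ y * (B x y *
      (branchTensor d γ U ψ φ p x * branchTensor d γ U ψ φ p y))) := by
  have key (j r : ℕ) (h : r + j = p) :
      labelMean (pathWeight U ψ) (fun a : V → Fin (2 * p + 2) → ZMod k => B (a u) (a v) *
        (∏ w ∈ Finset.univ.filter (fun w => 1 ≤ edgeDepth G p u v w ∧ edgeDepth G p u v w ≤ p),
          phaseMatrix γ φ (a (edgeParent G p u v w)) (a w))) =
      labelMean (pathWeight U ψ) (fun a : V → Fin (2 * p + 2) → ZMod k => B (a u) (a v) *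
        (∏ w ∈ Finset.univ.filter (fun w => 1 ≤ edgeDepth G p u v w ∧ edgeDepth G p u v w ≤ r),
          phaseMatrix γ φ (a (edgeParent G p u v w)) (a w)) *
        ∏ w ∈ Finset.univ.filter (fun w => edgeDepth G p u v w = r),
          branchTensor d γ U ψ φ j (a w)) := by
    induction j generalizing r with
    | zero =>
      obtain rfl : r = p := h
      simp [branchTensor]
    | succ j ih => rw [ih (r + 1) (by omega), labelMean_branch_step huv hg hreg hU hψ γ φ B r j
        (by omega)]
  rw [key p 0 (by omega), ← labelMean_two (sum_pathWeight U hU ψ hψ) huv.ne]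
  congr 1
  funext a
  have h1 : Finset.univ.filter (fun w => 1 ≤ edgeDepth G p u v w ∧ edgeDepth G p u v w ≤ 0) = ∅ :=
    Finset.filter_false_of_mem fun w _ => by omega
  have h2 : Finset.univ.filter (fun w => edgeDepth G p u v w = 0) = {u, v} := by
    ext w
    simp [edgeDepth_eq_zero_iff]
  rw [h1, h2, Finset.prod_empty, mul_one, Finset.prod_pair huv.ne]

theorem edgeExpectation_eq_iteration (hp : 1 ≤ p) (huv : G.Adj u v)
    (hg : ((2 * p + 2 : ℕ) : ℕ∞) ≤ G.egirth)
    (hreg : G.IsRegularOfDegree (d + 1)) {U : Fin p → Matrix (ZMod k) (ZMod k) ℂ}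
    (hU : ∀ t, (U t)ᴴ * U t = 1) {ψ : ZMod k → ℂ} (hψ : ∑ a, ‖ψ a‖ ^ 2 = 1)
    (γ : Fin p → ℝ) (φ ξ : ZMod k → ZMod k → ℝ) (hφ : ∀ x y, φ x y = φ y x) :
    edgeExpectation ξ u v (qaoaState (qaoaCost G φ hφ) γ U ψ) =
      ∑ a, pathWeight U ψ a * branchTensor d γ U ψ φ p a *
        (lossMatrix γ φ ξ *ᵥ fun b => pathWeight U ψ b * branchTensor d γ U ψ φ p b) a := by
  classical
  have h1 := edgeExpectation_eq_sum_paths G φ ξ hφ γ U ψ u v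
  -- Angle zero makes the phases of all edges outside of the light cone equal to one.
  let c : Sym2 V → Fin p → ℝ := fun e t => if ∃ w ∈ e, edgeDepth G p u v w < p then γ t else 0
  have h2 := labelMean_edgePhases_congr hU hψ φ ξ hφ G.edgeFinset (edgeDepth G p u v)
    (by
      intro e he x hx y hy
      by_cases hxy : x = y
      · rw [hxy]
        exact Nat.le_succ _
      · rw [(Sym2.mem_and_mem_iff hxy).1 ⟨hx, hy⟩, SimpleGraph.mem_edgeFinset,
          SimpleGraph.mem_edgeSet] at he
        exact edgeDepth_le_succ he)
    (edgeDepth_eq_zero_iff.2 (Or.inl rfl)) (edgeDepth_eq_zero_iff.2 (Or.inr rfl))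
    (fun _ t => γ t) c (fun e t h => (if_pos h).symm)
  rw [h1]
  refine h2.trans ?_
  have h3 (a : V → Fin (2 * p + 2) → ZMod k) : edgePhases G.edgeFinset φ hφ c a =
      phaseMatrix γ φ (a u) (a v) *
      ∏ w ∈ Finset.univ.filter (fun w => 1 ≤ edgeDepth G p u v w ∧ edgeDepth G p u v w ≤ p),
        phaseMatrix γ φ (a (edgeParent G p u v w)) (a w) := by
    have h4 := prod_edges_near huv hg hp
      (fun e => Complex.exp (Complex.I * ((∑ t, γ t * edgeDiff φ hφ a t e : ℝ) : ℂ)))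
    simp only [edgePhases]
    refine Eq.trans ?_ h4
    rw [Finset.prod_filter]
    refine Finset.prod_congr rfl fun e _ => ?_
    split_ifs with h
    · simp only [c, if_pos h]
    · simp only [c, if_neg h]
      simp
  simp only [h3]
  have h5 := labelMean_branch huv hg hreg hU hψ γ φ
    (fun x y => phaseMatrix γ φ x y * (ξ (x (posIdx (Fin.last p))) (y (posIdx (Fin.last p))) : ℂ))
  simp only [mul_right_comm _ _ ((ξ _ _ : ℝ) : ℂ)]
  refine h5.trans ?_
  simp only [Matrix.mulVec, dotProduct, Finset.mul_sum]
  refine Finset.sum_congr rfl fun x _ => Finset.sum_congr rfl fun y _ => ?_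
  rw [lossMatrix, phaseMatrix, Matrix.of_apply, Matrix.of_apply]
  ring

end Tree

/-! ## A program logic for the machine -/

/-- Assertions about the elapsed time, the registers and the memory. -/
abbrev Assertion := ℕ → (ℕ → ℕ) → (ℕ → ℕ → ℂ) → Prop

/-- The weakest precondition of a loop with `n` iterations. -/
def wpLoop (F : ℕ → Assertion → Assertion) : ℕ → Assertion → Assertion
  | 0, Q => Q
  | n + 1, Q => wpLoop F n (F n Q)

/-- Writing `z` into a cell of the memory. -/
def writeCell (M : ℕ → ℕ → ℂ) (A x : ℕ) (z : ℂ) : ℕ → ℕ → ℂ :=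
  Function.update M A (Function.update (M A) x z)

/-- The weakest precondition for a run that establishes `Q` and writes no integer above `B`. -/
def wp (B : ℕ) : Prog → Assertion → Assertion
  | .skip, Q => fun τ R M => Q (τ + 1) R M
  | .seq P P', Q => wp B P (wp B P' Q)
  | .ifLt x y P P', Q => fun τ R M =>
      (R x < R y → wp B P Q (τ + 1) R M) ∧ (¬ R x < R y → wp B P' Q (τ + 1) R M)
  | .forLt i x P, Q => fun τ R M =>
      wpLoop (fun j Q' τ' R' M' => j ≤ B ∧ wp B P Q' (τ' + 1) (Function.update R' i j) M')
        (R x) Q (τ + 1) R M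
  | .intConst i c, Q => fun τ R M => c ≤ B ∧ Q (τ + 1) (Function.update R i c) M
  | .intOp o i x y, Q => fun τ R M => o.eval (R x) (R y) ≤ B ∧
      Q (τ + 1) (Function.update R i (o.eval (R x) (R y))) M
  | .cpxRat A x y, Q => fun τ R M =>
      Q (τ + 1) R (writeCell M A.arr (R A.idx) ((R x : ℂ) / (R y : ℂ)))
  | .cpxConst A c, Q => fun τ R M => Q (τ + 1) R (writeCell M A.arr (R A.idx) c.eval)
  | .cpxFun g A D, Q => fun τ R M =>
      Q (τ + 1) R (writeCell M A.arr (R A.idx) (g.eval (M D.arr (R D.idx))))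
  | .cpxOp o A D D', Q => fun τ R M =>
      Q (τ + 1) R (writeCell M A.arr (R A.idx) (o.eval (M D.arr (R D.idx)) (M D'.arr (R D'.idx))))
  | .cpxPow A D x, Q => fun τ R M =>
      Q (τ + 1) R (writeCell M A.arr (R A.idx) (M D.arr (R D.idx) ^ R x))

/-- Time, registers and memory suffice to describe the further course of a run; the touched cells do
not influence it and are treated separately. -/
theorem wp_sound (B : ℕ) (P : Prog) (Q : Assertion) (s : Config) (hs : s.word ≤ B)
    (h : wp B P Q s.time s.reg s.mem) :
    Q (P.run s).time (P.run s).reg (P.run s).mem ∧ (P.run s).word ≤ B := by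
  induction P generalizing Q s with
  | skip => exact ⟨h, hs⟩
  | seq P P' ih ih' =>
    obtain ⟨h1, h2⟩ := ih _ s hs h
    exact ih' _ _ h2 h1
  | ifLt x y P P' ih ih' =>
    simp only [Prog.run]
    split_ifs with hc
    · exact ih _ s.tick hs (h.1 hc)
    · exact ih' _ s.tick hs (h.2 hc)
  | forLt i x P ih =>
    -- `wpLoop` peels off the last iteration, so the induction needs all postconditions.
    have key (n : ℕ) : ∀ (Q : Assertion) (s : Config), s.word ≤ B →
        wpLoop (fun j Q' τ' R' M' => j ≤ B ∧ wp B P Q' (τ' + 1) (Function.update R' i j) M')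
          n Q s.time s.reg s.mem →
        Q (Config.loop (fun j s' => P.run (s'.setReg i j)) n s).time
          (Config.loop (fun j s' => P.run (s'.setReg i j)) n s).reg
          (Config.loop (fun j s' => P.run (s'.setReg i j)) n s).mem ∧
        (Config.loop (fun j s' => P.run (s'.setReg i j)) n s).word ≤ B := by
      induction n with
      | zero => exact fun Q s hs h => ⟨h, hs⟩
      | succ n ihn =>
        intro Q s hs h
        obtain ⟨⟨h0, h1⟩, h2⟩ := ihn _ s hs h
        exact ih Q _ (max_le h2 h0) h1
    exact key (s.reg x) Q s.tick hs h
  | intConst i c => exact ⟨h.2, max_le hs h.1⟩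
  | intOp o i x y => exact ⟨h.2, max_le hs h.1⟩
  | cpxRat A x y => exact ⟨h, hs⟩
  | cpxConst A c => exact ⟨h, hs⟩
  | cpxFun g A D => exact ⟨h, hs⟩
  | cpxOp o A D D' => exact ⟨h, hs⟩
  | cpxPow A D x => exact ⟨h, hs⟩

theorem wpLoop_mono {F : ℕ → Assertion → Assertion}
    (hF : ∀ (j : ℕ) (Q Q' : Assertion), (∀ τ R M, Q τ R M → Q' τ R M) →
      ∀ τ R M, F j Q τ R M → F j Q' τ R M) (n : ℕ) {Q Q' : Assertion}
    (hQ : ∀ τ R M, Q τ R M → Q' τ R M) {τ : ℕ} {R : ℕ → ℕ} {M : ℕ → ℕ → ℂ}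
    (h : wpLoop F n Q τ R M) : wpLoop F n Q' τ R M := by
  induction n generalizing Q Q' with
  | zero => exact hQ _ _ _ h
  | succ n ih => exact ih (hF n Q Q' hQ) h

theorem wp_mono {B : ℕ} {P : Prog} {Q Q' : Assertion} {τ : ℕ} {R : ℕ → ℕ} {M : ℕ → ℕ → ℂ}
    (h : wp B P Q τ R M) (hQ : ∀ τ R M, Q τ R M → Q' τ R M) : wp B P Q' τ R M := by
  induction P generalizing Q Q' τ R M with
  | seq P P' ih ih' => exact ih h fun τ R M h => ih' h hQ
  | ifLt x y P P' ih ih' => exact ⟨fun hc => ih (h.1 hc) hQ, fun hc => ih' (h.2 hc) hQ⟩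
  | forLt i x P ih =>
    exact wpLoop_mono (fun j Q Q' hQ τ R M h => ⟨h.1, ih h.2 hQ⟩) _ hQ h
  | intConst i c => exact ⟨h.1, hQ _ _ _ h.2⟩
  | intOp o i x y => exact ⟨h.1, hQ _ _ _ h.2⟩
  | _ => exact hQ _ _ _ h

/-- The program writes only registers from `r` on and arrays from `a` on. -/
def Prog.WritesFrom (r a : ℕ) : Prog → Prop
  | .skip => True
  | .seq P Q => P.WritesFrom r a ∧ Q.WritesFrom r a
  | .ifLt _ _ P Q => P.WritesFrom r a ∧ Q.WritesFrom r a
  | .forLt i _ P => r ≤ i ∧ P.WritesFrom r a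
  | .intConst i _ => r ≤ i
  | .intOp _ i _ _ => r ≤ i
  | .cpxRat A _ _ => a ≤ A.arr
  | .cpxConst A _ => a ≤ A.arr
  | .cpxFun _ A _ => a ≤ A.arr
  | .cpxOp _ A _ _ => a ≤ A.arr
  | .cpxPow A _ _ => a ≤ A.arr

/-- The registers below `r` and the arrays below `a` agree. -/
structure Frame (r a : ℕ) (R R' : ℕ → ℕ) (M M' : ℕ → ℕ → ℂ) : Prop where
  reg : ∀ x < r, R' x = R x
  mem : ∀ A < a, M' A = M A

theorem Frame.refl (r a : ℕ) (R : ℕ → ℕ) (M : ℕ → ℕ → ℂ) : Frame r a R R M M :=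
  ⟨fun _ _ => rfl, fun _ _ => rfl⟩

theorem Frame.trans {r a : ℕ} {R R' R'' : ℕ → ℕ} {M M' M'' : ℕ → ℕ → ℂ} (h : Frame r a R R' M M')
    (h' : Frame r a R' R'' M' M'') : Frame r a R R'' M M'' :=
  ⟨fun x hx => (h'.reg x hx).trans (h.reg x hx), fun A hA => (h'.mem A hA).trans (h.mem A hA)⟩

theorem Frame.mono {r a r' a' : ℕ} {R R' : ℕ → ℕ} {M M' : ℕ → ℕ → ℂ} (h : Frame r a R R' M M')
    (hr : r' ≤ r) (ha : a' ≤ a) : Frame r' a' R R' M M' :=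
  ⟨fun x hx => h.reg x (by omega), fun A hA => h.mem A (by omega)⟩

theorem Frame.update {r a : ℕ} {R R' : ℕ → ℕ} {M M' : ℕ → ℕ → ℂ} (h : Frame r a R R' M M')
    {i : ℕ} (hi : r ≤ i) (j : ℕ) : Frame r a R (Function.update R' i j) M M' :=
  ⟨fun x hx => by rw [Function.update_of_ne (by omega), h.reg x hx], h.mem⟩

theorem Frame.writeCell {r a : ℕ} {R R' : ℕ → ℕ} {M M' : ℕ → ℕ → ℂ} (h : Frame r a R R' M M')
    {A : ℕ} (hA : a ≤ A) (x : ℕ) (z : ℂ) : Frame r a R R' M (writeCell M' A x z) :=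
  ⟨h.reg, fun D hD => by rw [_root_.writeCell, Function.update_of_ne (by omega), h.mem D hD]⟩

theorem wpLoop_frame {r a : ℕ} {F : ℕ → Assertion → Assertion}
    (hF : ∀ (j : ℕ) (Q : Assertion) (τ : ℕ) (R : ℕ → ℕ) (M : ℕ → ℕ → ℂ), F j Q τ R M →
      F j (fun τ' R' M' => Q τ' R' M' ∧ Frame r a R R' M M') τ R M)
    (hF' : ∀ (j : ℕ) (Q Q' : Assertion), (∀ τ R M, Q τ R M → Q' τ R M) →
      ∀ τ R M, F j Q τ R M → F j Q' τ R M) (n : ℕ) {Q : Assertion}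
    {τ : ℕ} {R : ℕ → ℕ} {M : ℕ → ℕ → ℂ} (h : wpLoop F n Q τ R M) :
    wpLoop F n (fun τ' R' M' => Q τ' R' M' ∧ Frame r a R R' M M') τ R M := by
  induction n generalizing Q with
  | zero => exact ⟨h, Frame.refl r a R M⟩
  | succ n ih =>
    refine wpLoop_mono hF' n ?_ (ih h)
    rintro τ' R' M' ⟨h1, h2⟩
    refine hF' n _ _ ?_ _ _ _ (hF n Q τ' R' M' h1)
    rintro τ'' R'' M'' ⟨h3, h4⟩
    exact ⟨h3, h2.trans h4⟩

/-- What a program leaves alone can be read off its syntax, so the specifications only have to say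
what it changes. -/
theorem wp_frame {B r a : ℕ} {P : Prog} (hP : P.WritesFrom r a) {Q : Assertion} {τ : ℕ}
    {R : ℕ → ℕ} {M : ℕ → ℕ → ℂ} (h : wp B P Q τ R M) :
    wp B P (fun τ' R' M' => Q τ' R' M' ∧ Frame r a R R' M M') τ R M := by
  induction P generalizing Q τ R M with
  | skip => exact ⟨h, Frame.refl r a R M⟩
  | seq P P' ih ih' =>
    change wp B P (wp B P' _) τ R M
    refine wp_mono (ih hP.1 h) ?_
    rintro τ' R' M' ⟨h1, h2⟩
    refine wp_mono (ih' hP.2 h1) ?_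
    rintro τ'' R'' M'' ⟨h3, h4⟩
    exact ⟨h3, h2.trans h4⟩
  | ifLt x y P P' ih ih' => exact ⟨fun hc => ih hP.1 (h.1 hc), fun hc => ih' hP.2 (h.2 hc)⟩
  | forLt i x P ih =>
    refine wpLoop_frame ?_ (fun j Q Q' hQ τ R M h => ⟨h.1, wp_mono h.2 hQ⟩) _ h
    rintro j Q τ R M ⟨h1, h2⟩
    refine ⟨h1, wp_mono (ih hP.2 h2) ?_⟩
    rintro τ' R' M' ⟨h3, h4⟩
    exact ⟨h3, ((Frame.refl r a R M).update hP.1 j).trans h4⟩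
  | intConst i c => exact ⟨h.1, h.2, (Frame.refl r a R M).update hP c⟩
  | intOp o i x y => exact ⟨h.1, h.2, (Frame.refl r a R M).update hP _⟩
  | _ => exact ⟨h, (Frame.refl r a R M).writeCell hP _ _⟩

/-- The rule for loops, with an invariant and a frame. -/
theorem wp_for {B r a T : ℕ} {P : Prog} {i x : ℕ} (hP : (Prog.forLt i x P).WritesFrom r a)
    (Inv : ℕ → (ℕ → ℕ) → (ℕ → ℕ → ℂ) → Prop) {Q : Assertion} {τ n : ℕ} {R : ℕ → ℕ}
    {M : ℕ → ℕ → ℂ} (hn : R x = n) (hB : n ≤ B) (h0 : Inv 0 R M)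
    (hstep : ∀ j < n, ∀ τ' R' M', Inv j R' M' → Frame r a R R' M M' →
      wp B P (fun τ'' R'' M'' => τ'' ≤ τ' + T ∧ Inv (j + 1) R'' M'') τ' (Function.update R' i j) M')
    (hQ : ∀ τ' R' M', τ' ≤ τ + (1 + n * (T + 1)) → Frame r a R R' M M' → Inv n R' M' →
      Q τ' R' M') :
    wp B (.forLt i x P) Q τ R M := by
  subst hn
  -- Each iteration costs one step beyond its body, and one more step starts the loop.
  have key (n : ℕ) (hn : n ≤ R x) : ∀ Q : Assertion,
      (∀ τ' R' M', τ' ≤ τ + 1 + n * (T + 1) → Frame r a R R' M M' → Inv n R' M' → Q τ' R' M') →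
      wpLoop (fun j Q' τ' R' M' => j ≤ B ∧ wp B P Q' (τ' + 1) (Function.update R' i j) M')
        n Q (τ + 1) R M := by
    induction n with
    | zero => exact fun Q hQ => hQ _ _ _ (by omega) (Frame.refl r a R M) h0
    | succ n ih =>
      intro Q hQ
      refine ih (by omega) _ fun τ' R' M' h1 h2 h3 => ⟨by omega, ?_⟩
      refine wp_mono (wp_frame hP.2 (hstep n (by omega) (τ' + 1) R' M' h3 h2)) ?_
      rintro τ'' R'' M'' ⟨⟨h4, h5⟩, h6⟩
      refine hQ _ _ _ ?_ ((h2.update hP.1 n).trans h6) h5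
      rw [Nat.succ_mul]
      omega
  exact key (R x) le_rfl Q fun τ' R' M' h => hQ τ' R' M' (by omega)

/-! ### Memory usage -/

/-- All addresses use registers from `r` on and arrays below `a`, and no register below `r` is
written. -/
def Prog.AddressesIn (r a : ℕ) : Prog → Prop
  | .skip => True
  | .seq P Q => P.AddressesIn r a ∧ Q.AddressesIn r a
  | .ifLt _ _ P Q => P.AddressesIn r a ∧ Q.AddressesIn r a
  | .forLt i _ P => r ≤ i ∧ P.AddressesIn r a
  | .intConst i _ => r ≤ i
  | .intOp _ i _ _ => r ≤ i
  | .cpxRat A _ _ => r ≤ A.idx ∧ A.arr < a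
  | .cpxConst A _ => r ≤ A.idx ∧ A.arr < a
  | .cpxFun _ A D => (r ≤ A.idx ∧ A.arr < a) ∧ (r ≤ D.idx ∧ D.arr < a)
  | .cpxOp _ A D D' => (r ≤ A.idx ∧ A.arr < a) ∧ (r ≤ D.idx ∧ D.arr < a) ∧
      (r ≤ D'.idx ∧ D'.arr < a)
  | .cpxPow A D _ => (r ≤ A.idx ∧ A.arr < a) ∧ (r ≤ D.idx ∧ D.arr < a)

/-- The registers from `r` on and the touched cells are bounded by the largest integer written. -/
def Config.Bounded (r a : ℕ) (s : Config) : Prop :=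
  (∀ x, r ≤ x → s.reg x ≤ s.word) ∧
    s.touched ⊆ Finset.range a ×ˢ Finset.range (s.word + 1)

theorem Config.Bounded.setReg {r a : ℕ} {s : Config} (h : s.Bounded r a) (i n : ℕ) :
    (s.setReg i n).Bounded r a := by
  refine ⟨fun x hx => ?_, h.2.trans ?_⟩
  · simp only [Config.setReg, Function.update_apply]
    split_ifs
    · exact le_max_right _ _
    · exact (h.1 x hx).trans (le_max_left _ _)
  · refine Finset.product_subset_product le_rfl (Finset.range_subset_range.2 ?_)
    exact Nat.succ_le_succ (le_max_left _ _)

theorem Config.Bounded.setCell {r a : ℕ} {s : Config} (h : s.Bounded r a) {A : Addr} (z : ℂ)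
    {S : Finset (ℕ × ℕ)} (hA : r ≤ A.idx ∧ A.arr < a)
    (hS : S ⊆ Finset.range a ×ˢ Finset.range (s.word + 1)) :
    (s.setCell A z S).Bounded r a := by
  refine ⟨h.1, Finset.union_subset h.2 (Finset.insert_subset ?_ hS)⟩
  rw [Finset.mem_product, Finset.mem_range, Finset.mem_range]
  exact ⟨hA.2, Nat.lt_succ_of_le (h.1 _ hA.1)⟩

theorem Config.Bounded.cell_mem {r a : ℕ} {s : Config} (h : s.Bounded r a) {A : Addr}
    (hA : r ≤ A.idx ∧ A.arr < a) : s.cell A ∈ Finset.range a ×ˢ Finset.range (s.word + 1) := by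
  rw [Finset.mem_product, Finset.mem_range, Finset.mem_range]
  exact ⟨hA.2, Nat.lt_succ_of_le (h.1 _ hA.1)⟩

/-- Every index comes from a register that is bounded by `word`, a property that each write
preserves. The low registers have to be excluded: they hold the input, and the degree is bounded by
nothing. -/
theorem Prog.AddressesIn.bounded_run {r a : ℕ} {P : Prog} (hP : P.AddressesIn r a) {s : Config}
    (hs : s.Bounded r a) : (P.run s).Bounded r a := by
  induction P generalizing s with
  | skip => exact hs
  | seq P P' ih ih' => exact ih' hP.2 (ih hP.1 hs)
  | ifLt x y P P' ih ih' =>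
    simp only [Prog.run]
    split_ifs
    · exact ih hP.1 (s := s.tick) hs
    · exact ih' hP.2 (s := s.tick) hs
  | forLt i x P ih =>
    simp only [Prog.run]
    have key (n : ℕ) :
        (Config.loop (fun j s' => P.run (s'.setReg i j)) n s.tick).Bounded r a := by
      induction n with
      | zero => exact hs
      | succ n ihn => exact ih hP.2 (ihn.setReg i n)
    exact key _
  | intConst i c => exact hs.setReg i _
  | intOp o i x y => exact hs.setReg i _
  | cpxRat A x y => exact hs.setCell _ hP (Finset.empty_subset _)
  | cpxConst A c => exact hs.setCell _ hP (Finset.empty_subset _)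
  | cpxFun g A D =>
    exact hs.setCell _ hP.1 (Finset.singleton_subset_iff.2 (hs.cell_mem hP.2))
  | cpxOp o A D D' =>
    exact hs.setCell _ hP.1 (Finset.insert_subset (hs.cell_mem hP.2.1)
      (Finset.singleton_subset_iff.2 (hs.cell_mem hP.2.2)))
  | cpxPow A D x =>
    exact hs.setCell _ hP.1 (Finset.singleton_subset_iff.2 (hs.cell_mem hP.2))

theorem Config.Bounded.card_touched_le {r a : ℕ} {s : Config} (h : s.Bounded r a) :
    s.touched.card ≤ a * (s.word + 1) := by
  refine (Finset.card_le_card h.2).trans ?_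
  rw [Finset.card_product, Finset.card_range, Finset.card_range]

/-! ## Discrete Fourier transforms of power-of-two length -/

/-- The `t`-th power of the primitive root of unity `exp(2πi/N)`. -/
def rootPow (N t : ℕ) : ℂ := Complex.exp (2 * Real.pi * Complex.I * t / N)

theorem rootPow_add (N s t : ℕ) : rootPow N (s + t) = rootPow N s * rootPow N t := by
  rw [rootPow, rootPow, rootPow, ← Complex.exp_add]
  congr 1
  push_cast
  ring

theorem rootPow_zero (N : ℕ) : rootPow N 0 = 1 := by simp [rootPow]

theorem rootPow_self (N : ℕ) (hN : N ≠ 0) : rootPow N N = 1 := by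
  have h : (N : ℂ) ≠ 0 := Nat.cast_ne_zero.2 hN
  rw [rootPow, mul_div_assoc, div_self h, mul_one, Complex.exp_two_pi_mul_I]

theorem rootPow_mul (N s t : ℕ) : rootPow N (s * t) = rootPow N s ^ t := by
  induction t with
  | zero => rw [mul_zero, rootPow_zero, pow_zero]
  | succ t ih => rw [Nat.mul_succ, rootPow_add, ih, pow_succ]

theorem rootPow_add_mul_self (N s t : ℕ) (hN : N ≠ 0) : rootPow N (s + N * t) = rootPow N s := by
  rw [rootPow_add, rootPow_mul, rootPow_self N hN, one_pow, mul_one]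

theorem rootPow_eq_one_iff (N t : ℕ) (hN : N ≠ 0) : rootPow N t = 1 ↔ N ∣ t := by
  have h1 : rootPow N t = rootPow N 1 ^ t := by rw [← rootPow_mul, one_mul]
  have h2 : IsPrimitiveRoot (rootPow N 1) N := by
    have := Complex.isPrimitiveRoot_exp N hN
    rw [rootPow]
    simpa using this
  rw [h1, h2.pow_eq_one_iff_dvd]

theorem sum_rootPow (N t : ℕ) (hN : N ≠ 0) :
    ∑ q ∈ Finset.range N, rootPow N (q * t) = if N ∣ t then (N : ℂ) else 0 := by
  have h (q : ℕ) : rootPow N (q * t) = rootPow N t ^ q := by rw [mul_comm, rootPow_mul]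
  simp only [h]
  split_ifs with hd
  · rw [(rootPow_eq_one_iff N t hN).2 hd]
    simp
  · have h1 : rootPow N t ≠ 1 := fun h => hd ((rootPow_eq_one_iff N t hN).1 h)
    rw [geom_sum_eq h1, ← rootPow_mul, mul_comm, rootPow_mul, rootPow_self N hN, one_pow, sub_self,
      zero_div]

/-- The discrete Fourier transform of length `N`. -/
def fourierSum (N : ℕ) (x : ℕ → ℂ) (q : ℕ) : ℂ := ∑ l ∈ Finset.range N, x l * rootPow N (q * l)

theorem fourierSum_congr {N : ℕ} {x y : ℕ → ℂ} (h : ∀ l < N, x l = y l) (q : ℕ) :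
    fourierSum N x q = fourierSum N y q :=
  Finset.sum_congr rfl fun l hl => by rw [h l (Finset.mem_range.1 hl)]

/-- The convolution theorem, for an input padded with zeros. -/
theorem fourierSum_mul_fourierSum {N k : ℕ} (hN : 2 * k ≤ N) (x h : ℕ → ℂ)
    (hx : ∀ b < N, k ≤ b → x b = 0) {c : ℕ} (hc : c < k) :
    fourierSum N (fun q => fourierSum N x q * (fourierSum N h q * (1 / N))) (N - (c + k)) =
      ∑ b ∈ Finset.range k, x b * h (c + k - b) := by
  have hN0 : N ≠ 0 := by omega
  have hNC : (N : ℂ) ≠ 0 := Nat.cast_ne_zero.2 hN0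
  -- The index `N - (c + k)` is the negative of `c + k` modulo `N`, so the outer forward transform
  -- acts as an inverse one.
  have h1 (q : ℕ) : fourierSum N x q * (fourierSum N h q * (1 / N)) * rootPow N ((N - (c + k)) * q) =
      ∑ b ∈ Finset.range N, ∑ e ∈ Finset.range N,
        x b * h e * (1 / N) * rootPow N (q * (b + e + (N - (c + k)))) := by
    rw [fourierSum, fourierSum, mul_assoc, Finset.sum_mul]
    refine Finset.sum_congr rfl fun b _ => ?_
    rw [Finset.sum_mul, Finset.sum_mul, Finset.mul_sum]
    refine Finset.sum_congr rfl fun e _ => ?_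
    rw [mul_add, mul_add, rootPow_add, rootPow_add, mul_comm q (N - (c + k))]
    ring
  rw [fourierSum]
  simp only [h1]
  rw [Finset.sum_comm]
  have h2 (b : ℕ) : ∑ q ∈ Finset.range N, ∑ e ∈ Finset.range N,
        x b * h e * (1 / N) * rootPow N (q * (b + e + (N - (c + k)))) =
      ∑ e ∈ Finset.range N, x b * h e * (if N ∣ b + e + (N - (c + k)) then 1 else 0) := by
    rw [Finset.sum_comm]
    refine Finset.sum_congr rfl fun e _ => ?_
    rw [← Finset.mul_sum, sum_rootPow N _ hN0]
    split_ifs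
    · field_simp
    · simp
  simp only [h2]
  rw [← Finset.sum_subset (Finset.range_subset_range.2 (by omega : k ≤ N))]
  · refine Finset.sum_congr rfl fun b hb => ?_
    rw [Finset.mem_range] at hb
    -- The number `b + e + (N - (c + k))` lies strictly between `0` and `2 * N`, so it is divisible
    -- by `N` only if it equals `N`. The padding thus rules out any wrap-around.
    rw [Finset.sum_eq_single (c + k - b)]
    · rw [if_pos, mul_one]
      rw [show b + (c + k - b) + (N - (c + k)) = N by omega]
    · intro e he hne
      rw [Finset.mem_range] at he
      rw [if_neg, mul_zero]
      rintro ⟨t, ht⟩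
      rcases Nat.lt_or_ge t 1 with h | h
      · obtain rfl : t = 0 := by omega
        omega
      · rcases Nat.lt_or_ge t 2 with h' | h'
        · obtain rfl : t = 1 := by omega
          omega
        · have : N * 2 ≤ N * t := Nat.mul_le_mul_left N h'
          omega
    · intro h
      exact absurd (Finset.mem_range.2 (by omega)) h
  · intro b hb hb'
    rw [Finset.mem_range] at hb hb'
    rw [hx b hb (by omega)]
    simp

/-- The intermediate results of the fast Fourier transform of length `2 ^ m`. -/
def fftStage (m : ℕ) (x : ℕ → ℂ) (s i : ℕ) : ℂ :=
  ∑ l ∈ Finset.range (2 ^ s), x (i % 2 ^ (m - s) + 2 ^ (m - s) * l) *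
    rootPow (2 ^ m) (i / 2 ^ (m - s) * (2 ^ (m - s) * l))

theorem fftStage_zero (m : ℕ) (x : ℕ → ℂ) {i : ℕ} (hi : i < 2 ^ m) : fftStage m x 0 i = x i := by
  simp [fftStage, Nat.mod_eq_of_lt hi, rootPow_zero]

theorem fftStage_self (m : ℕ) (x : ℕ → ℂ) (i : ℕ) : fftStage m x m i = fourierSum (2 ^ m) x i := by
  simp [fftStage, fourierSum, Nat.mod_one]

theorem sum_range_two_mul (F : ℕ → ℂ) (n : ℕ) :
    ∑ l ∈ Finset.range (2 * n), F l = ∑ l ∈ Finset.range n, (F (2 * l) + F (2 * l + 1)) := by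
  induction n with
  | zero => simp
  | succ n ih =>
    rw [Nat.mul_succ, Finset.sum_range_succ, Finset.sum_range_succ, ih, Finset.sum_range_succ]
    ring

/-- After `s` stages, entry `i` is the transform of length `2 ^ s` of the subsequence with indices
congruent to `i` modulo `2 ^ (m - s)`, at frequency `i / 2 ^ (m - s)`. Splitting it into even and
odd terms gives the butterfly. The shorter transforms are periodic in the frequency, hence the
reduction modulo `2 ^ s`. In this arrangement no bit reversal is needed. -/
theorem fftStage_succ (m : ℕ) (x : ℕ → ℂ) {s : ℕ} (hs : s < m) (i : ℕ) :
    fftStage m x (s + 1) i =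
      fftStage m x s (i / 2 ^ (m - (s + 1)) % 2 ^ s * 2 ^ (m - s) + i % 2 ^ (m - (s + 1))) +
      rootPow (2 ^ m) (i - i % 2 ^ (m - (s + 1))) *
        fftStage m x s (i / 2 ^ (m - (s + 1)) % 2 ^ s * 2 ^ (m - s) + i % 2 ^ (m - (s + 1)) +
          2 ^ (m - (s + 1))) := by
  have hM : 2 ^ (m - s) = 2 ^ (m - (s + 1)) * 2 := by
    rw [← pow_succ]
    congr 1
    omega
  have hN : 2 ^ m = 2 ^ (m - (s + 1)) * 2 * 2 ^ s := by
    rw [← hM, ← pow_add]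
    congr 1
    omega
  rw [fftStage, fftStage, fftStage, hM]
  generalize 2 ^ m = N at *
  have hM0 : 0 < 2 ^ (m - (s + 1)) := by positivity
  have hL0 : 0 < 2 ^ s := by positivity
  rw [pow_succ' 2 s]
  generalize 2 ^ (m - (s + 1)) = M at *
  generalize 2 ^ s = L at *
  have hr := Nat.mod_lt i hM0
  have hN0 : N ≠ 0 := by rw [hN]; positivity
  have hi : i - i % M = i / M * M := by
    have := Nat.div_add_mod' i M
    omega
  rw [hi]
  generalize i % M = r at *
  generalize i / M = q at *
  have e1 : (q % L * (M * 2) + r) % (M * 2) = r := by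
    rw [Nat.mul_add_mod_of_lt (by omega)]
  have e2 : (q % L * (M * 2) + r) / (M * 2) = q % L := by
    rw [mul_comm, Nat.mul_add_div (by omega), Nat.div_eq_of_lt (by omega), add_zero]
  have e3 : (q % L * (M * 2) + r + M) % (M * 2) = r + M := by
    rw [add_assoc, Nat.mul_add_mod_of_lt (by omega)]
  have e4 : (q % L * (M * 2) + r + M) / (M * 2) = q % L := by
    rw [add_assoc, mul_comm, Nat.mul_add_div (by omega), Nat.div_eq_of_lt (by omega), add_zero]
  rw [e1, e2, e3, e4, sum_range_two_mul, Finset.sum_add_distrib, Finset.mul_sum]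
  have hq (l : ℕ) : rootPow N (q * (M * 2 * l)) = rootPow N (q % L * (M * 2 * l)) := by
    have : q * (M * 2 * l) = q % L * (M * 2 * l) + N * (q / L * l) := by
      conv_lhs => rw [← Nat.mod_add_div q L]
      rw [hN]
      ring
    rw [this, rootPow_add_mul_self _ _ _ hN0]
  congr 1
  · refine Finset.sum_congr rfl fun l _ => ?_
    rw [← hq, mul_assoc M 2 l]
  · refine Finset.sum_congr rfl fun l _ => ?_
    rw [← hq, show q * (M * (2 * l + 1)) = q * M + q * (M * 2 * l) by ring, rootPow_add,
      show r + M * (2 * l + 1) = r + M + M * 2 * l by ring]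
    ring

/-! ## Tensor products of circulants, one axis at a time -/

/-- Convolve along the axis of the lowest digit and rotate the digits. -/
def axisStep (k K : ℕ) (h T : ℕ → ℂ) (X : ℕ) : ℂ :=
  ∑ b ∈ Finset.range k, T (X % K * k + b) * h (X / K + k - b)

/-- The first `j` axis steps. -/
def axisIter (k K : ℕ) (h : ℕ → ℕ → ℂ) (T : ℕ → ℂ) : ℕ → ℕ → ℂ
  | 0 => T
  | j + 1 => axisStep k K (h j) (axisIter k K h T j)

theorem sum_range_mul_digits (a b : ℕ) (F : ℕ → ℂ) :
    ∑ Z ∈ Finset.range (a * b), F Z =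
      ∑ y ∈ Finset.range b, ∑ x ∈ Finset.range a, F (x + a * y) := by
  induction b with
  | zero => simp
  | succ b ih =>
    rw [Nat.mul_succ, Finset.sum_range_add, ih, Finset.sum_range_succ]
    simp only [add_comm]

theorem mod_pow_digit (k C : ℕ) {i j : ℕ} (h : i < j) :
    C % k ^ j / k ^ i % k = C / k ^ i % k := by
  obtain ⟨e, rfl⟩ := Nat.exists_eq_add_of_lt h
  rw [show i + e + 1 = i + (e + 1) by ring, pow_add, Nat.mod_mul_right_div_self,
    Nat.mod_mod_of_dvd _ (dvd_pow_self k (Nat.succ_ne_zero e))]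

/-- Each step consumes the lowest digit and returns its result as the highest. After `j` steps the
top `j` digits of `X` therefore belong to the convolved axes, in order, and the others to the
untouched ones. -/
theorem axisIter_apply_of_le {k n : ℕ} (hk : 0 < k) (h : ℕ → ℕ → ℂ) (T : ℕ → ℂ) {j : ℕ}
    (hj : j ≤ n + 1) {X : ℕ} (hX : X < k ^ (n + 1)) :
    axisIter k (k ^ n) h T j X = ∑ Y ∈ Finset.range (k ^ j),
      (∏ i ∈ Finset.range j, h i (X / k ^ (n + 1 - j) / k ^ i % k + k - Y / k ^ i % k)) *
        T (Y + k ^ j * (X % k ^ (n + 1 - j))) := by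
  induction j generalizing X with
  | zero => simp [axisIter, Nat.mod_eq_of_lt hX]
  | succ j ih =>
    obtain ⟨i, rfl⟩ : ∃ i, n = i + j := ⟨n - j, by omega⟩
    have hd1 : i + j + 1 - j = i + 1 := by omega
    have hd2 : i + j + 1 - (j + 1) = i := by omega
    rw [hd1] at ih
    rw [hd2, axisIter, axisStep, pow_succ k j, sum_range_mul_digits]
    refine Finset.sum_congr rfl fun b hb => ?_
    rw [Finset.mem_range] at hb
    have hL : X % k ^ (i + j) * k + b < k ^ (i + j + 1) := by
      have : X % k ^ (i + j) + 1 ≤ k ^ (i + j) := Nat.mod_lt _ (by positivity)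
      have := Nat.mul_le_mul_right k this
      rw [pow_succ]
      linarith [this, Nat.add_mul (X % k ^ (i + j)) 1 k]
    rw [ih (by omega) hL, Finset.sum_mul]
    have e1 : (X % k ^ (i + j) * k + b) / k ^ (i + 1) = X / k ^ i % k ^ j := by
      rw [pow_succ', ← Nat.div_div_eq_div_mul, mul_comm _ k, Nat.mul_add_div hk,
        Nat.div_eq_of_lt hb, add_zero, pow_add, Nat.mod_mul_right_div_self]
    have e2 : (X % k ^ (i + j) * k + b) % k ^ (i + 1) = X % k ^ i * k + b := by
      rw [pow_succ', Nat.mod_mul, Nat.mul_add_mod_of_lt hb, mul_comm _ k, Nat.mul_add_div hk,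
        Nat.div_eq_of_lt hb, add_zero, pow_add, Nat.mod_mul_right_mod]
      ring
    rw [e1, e2]
    refine Finset.sum_congr rfl fun Y hY => ?_
    rw [Finset.mem_range] at hY
    have hkj : 0 < k ^ j := by positivity
    rw [Finset.prod_range_succ]
    have e3 : X / k ^ i / k ^ j % k = X / k ^ (i + j) := by
      rw [Nat.div_div_eq_div_mul, ← pow_add, Nat.mod_eq_of_lt]
      rw [Nat.div_lt_iff_lt_mul (by positivity), ← pow_succ']
      exact hX
    have e4 : (Y + k ^ j * b) / k ^ j % k = b := by
      rw [Nat.add_mul_div_left _ _ hkj, Nat.div_eq_of_lt hY, zero_add, Nat.mod_eq_of_lt hb]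
    have e5 : ∏ l ∈ Finset.range j, h l (X / k ^ i % k ^ j / k ^ l % k + k - Y / k ^ l % k) =
        ∏ l ∈ Finset.range j, h l (X / k ^ i / k ^ l % k + k - (Y + k ^ j * b) / k ^ l % k) := by
      refine Finset.prod_congr rfl fun l hl => ?_
      rw [Finset.mem_range] at hl
      rw [mod_pow_digit k _ hl]
      congr 2
      rw [← mod_pow_digit k (Y + k ^ j * b) hl, Nat.add_mul_mod_self_left, Nat.mod_eq_of_lt hY]
    rw [e3, e4, e5, show Y + k ^ j * (X % k ^ i * k + b) =
      Y + k ^ j * b + k ^ j * k * (X % k ^ i) by ring]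
    ring

/-- After `n + 1` rotations every digit is back in its place. -/
theorem axisIter_apply {k n : ℕ} (hk : 0 < k) (h : ℕ → ℕ → ℂ) (T : ℕ → ℂ) {X : ℕ}
    (hX : X < k ^ (n + 1)) :
    axisIter k (k ^ n) h T (n + 1) X = ∑ Y ∈ Finset.range (k ^ (n + 1)),
      (∏ i ∈ Finset.range (n + 1), h i (X / k ^ i % k + k - Y / k ^ i % k)) * T Y := by
  rw [axisIter_apply_of_le hk h T le_rfl hX]
  simp [Nat.mod_one]

/-! ## Ditstrings and their indices -/

/-- The ditstring whose base-`k` digits are those of `X`, the lowest first. -/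
def digitString (k n X : ℕ) (i : Fin n) : ZMod k := ((X / k ^ (i : ℕ) % k : ℕ) : ZMod k)

theorem sum_digitString {k n : ℕ} [NeZero k] (F : (Fin n → ZMod k) → ℂ) :
    ∑ X ∈ Finset.range (k ^ n), F (digitString k n X) = ∑ a, F a := by
  rw [← Fin.sum_univ_eq_sum_range (fun X => F (digitString k n X)) (k ^ n)]
  refine Function.Bijective.sum_comp (e := fun X : Fin (k ^ n) => digitString k n X) ?_ F
  rw [Fintype.bijective_iff_injective_and_card]
  refine ⟨fun X Y h => ?_, by simp⟩
  refine (finFunctionFinEquiv (m := k) (n := n)).symm.injective (funext fun i => Fin.ext ?_)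
  have h1 := congrArg ZMod.val (congrFun h i)
  simp only [digitString, ZMod.val_natCast, Nat.mod_mod] at h1
  exact h1

section Kernel

variable {k p : ℕ} [NeZero k]

/-- The angle that belongs to position `j` of a ditstring, with its sign. -/
def positionAngle (γ : Fin p → ℝ) (j : ℕ) : ℝ :=
  if h : j < p then γ ⟨j, h⟩
  else if h : p + 1 < j ∧ j ≤ 2 * p + 1 then -γ ⟨2 * p + 1 - j, by omega⟩ else 0

/-- Position `2p + 1 - t` belongs to the index `-(t + 1)`, so the reflected upper half of the sum
runs parallel to the lower half. The two middle positions have angle zero. -/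
theorem sum_positionAngle (γ : Fin p → ℝ) (g : ℕ → ℝ) :
    ∑ j ∈ Finset.range (2 * p + 2), positionAngle γ j * g j =
      ∑ t : Fin p, γ t * (g t - g (2 * p + 1 - t)) := by
  rw [show 2 * p + 2 = (p + 1) + (p + 1) by ring, Finset.sum_range_add,
    ← Finset.sum_range_reflect (fun j => positionAngle γ (p + 1 + j) * g (p + 1 + j)),
    Finset.sum_range_succ, Finset.sum_range_succ,
    ← Fin.sum_univ_eq_sum_range (fun j => positionAngle γ j * g j),
    ← Fin.sum_univ_eq_sum_range
      (fun j => positionAngle γ (p + 1 + (p + 1 - 1 - j)) * g (p + 1 + (p + 1 - 1 - j)))]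
  have h1 : positionAngle γ p = 0 := by
    rw [positionAngle, dif_neg (by omega), dif_neg (by omega)]
  have h2 : positionAngle γ (p + 1 + (p + 1 - 1 - p)) = 0 := by
    rw [positionAngle, dif_neg (by omega), dif_neg (by omega)]
  rw [h1, h2, zero_mul, zero_mul, add_zero, add_zero, ← Finset.sum_add_distrib]
  refine Finset.sum_congr rfl fun t _ => ?_
  have h3 : p + 1 + (p + 1 - 1 - (t : ℕ)) = 2 * p + 1 - t := by omega
  have h4 : positionAngle γ (2 * p + 1 - t) = -γ t := by
    rw [positionAngle, dif_neg (by omega), dif_pos (by omega)]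
    congr 2
    exact Fin.ext (by simp only; omega)
  rw [h3, h4, positionAngle, dif_pos t.isLt]
  ring

/-- The convolution kernel of position `j`. At position `z` the factor `ξ` is included. -/
def axisKernel (γ : Fin p → ℝ) (φ ξ : ZMod k → ℝ) (z j t : ℕ) : ℂ :=
  Complex.exp (Complex.I * ((positionAngle γ j : ℂ) * (φ (t : ZMod k) : ℂ))) *
    if j = z then (ξ (t : ZMod k) : ℂ) else 1

/-- The summand `k` prevents truncation of the subtraction and vanishes in `ZMod k`. -/
theorem digitString_sub (n X Y : ℕ) (i : Fin n) :
    ((X / k ^ (i : ℕ) % k + k - Y / k ^ (i : ℕ) % k : ℕ) : ZMod k) =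
      digitString k n X i - digitString k n Y i := by
  have : Y / k ^ (i : ℕ) % k < k := Nat.mod_lt _ (NeZero.pos k)
  rw [Nat.cast_sub (by omega), Nat.cast_add, ZMod.natCast_self, add_zero]
  rfl

theorem phaseMatrix_digitString (γ : Fin p → ℝ) (φ : ZMod k → ℝ) (X Y : ℕ) :
    phaseMatrix γ (onDiff φ) (digitString k (2 * p + 2) X) (digitString k (2 * p + 2) Y) =
      ∏ j ∈ Finset.range (2 * p + 2), Complex.exp (Complex.I * ((positionAngle γ j : ℂ) *
        (φ ((X / k ^ j % k + k - Y / k ^ j % k : ℕ) : ZMod k) : ℂ))) := by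
  rw [← Complex.exp_sum, ← Finset.mul_sum, phaseMatrix, Matrix.of_apply, phaseFun]
  congr 2
  have h := sum_positionAngle γ
    (fun j => φ ((X / k ^ j % k + k - Y / k ^ j % k : ℕ) : ZMod k))
  have h' := congrArg (fun x : ℝ => (x : ℂ)) h
  simp only [Complex.ofReal_sum, Complex.ofReal_mul] at h'
  rw [h']
  push_cast
  refine Finset.sum_congr rfl fun t _ => ?_
  rw [onDiff, onDiff, ← digitString_sub, ← digitString_sub]
  rfl

/-- No position equals `2 * p + 2`, so this value of `z` leaves `ξ` out. -/
theorem prod_axisKernel_outside (γ : Fin p → ℝ) (φ ξ : ZMod k → ℝ) (X Y : ℕ) :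
    ∏ j ∈ Finset.range (2 * p + 2), axisKernel γ φ ξ (2 * p + 2) j
      (X / k ^ j % k + k - Y / k ^ j % k) =
    phaseMatrix γ (onDiff φ) (digitString k (2 * p + 2) X) (digitString k (2 * p + 2) Y) := by
  rw [phaseMatrix_digitString]
  refine Finset.prod_congr rfl fun j hj => ?_
  rw [Finset.mem_range] at hj
  rw [axisKernel, if_neg (by omega), mul_one]

/-- Position `p` is that of the index `p + 1`, on which the observable acts. -/
theorem prod_axisKernel_inside (γ : Fin p → ℝ) (φ ξ : ZMod k → ℝ) (X Y : ℕ) :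
    ∏ j ∈ Finset.range (2 * p + 2), axisKernel γ φ ξ p j (X / k ^ j % k + k - Y / k ^ j % k) =
    lossMatrix γ (onDiff φ) (onDiff ξ) (digitString k (2 * p + 2) X)
      (digitString k (2 * p + 2) Y) := by
  have h : lossMatrix γ (onDiff φ) (onDiff ξ) (digitString k (2 * p + 2) X)
      (digitString k (2 * p + 2) Y) =
      phaseMatrix γ (onDiff φ) (digitString k (2 * p + 2) X) (digitString k (2 * p + 2) Y) *
        (ξ ((X / k ^ p % k + k - Y / k ^ p % k : ℕ) : ZMod k) : ℂ) := by
    rw [lossMatrix, phaseMatrix, Matrix.of_apply, Matrix.of_apply, onDiff, ← digitString_sub]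
    rfl
  rw [h, phaseMatrix_digitString]
  simp only [axisKernel]
  rw [Finset.prod_mul_distrib, Finset.prod_ite_eq', if_pos (Finset.mem_range.2 (by omega))]

theorem axisIter_eq_mulVec {M : Matrix (Fin (2 * p + 2) → ZMod k) (Fin (2 * p + 2) → ZMod k) ℂ}
    {h : ℕ → ℕ → ℂ}
    (hM : ∀ X Y, ∏ j ∈ Finset.range (2 * p + 2), h j (X / k ^ j % k + k - Y / k ^ j % k) =
      M (digitString k (2 * p + 2) X) (digitString k (2 * p + 2) Y))
    (g : (Fin (2 * p + 2) → ZMod k) → ℂ) {X : ℕ} (hX : X < k ^ (2 * p + 2)) :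
    axisIter k (k ^ (2 * p + 1)) h (fun Y => g (digitString k (2 * p + 2) Y)) (2 * p + 2) X =
      (M *ᵥ g) (digitString k (2 * p + 2) X) := by
  rw [axisIter_apply (NeZero.pos k) h _ hX]
  simp only [hM]
  exact sum_digitString (fun a => M (digitString k (2 * p + 2) X) a * g a)

end Kernel

/-! ## The program -/

/-- A sequence of programs. -/
def Prog.block : List Prog → Prog
  | [] => .skip
  | P :: L => .seq P (Prog.block L)

theorem writeCell_apply (M : ℕ → ℕ → ℂ) (A x : ℕ) (z : ℂ) (D y : ℕ) :
    writeCell M A x z D y = if D = A then (if y = x then z else M D y) else M D y := by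
  by_cases h : D = A
  · subst h
    simp [writeCell, Function.update_apply]
  · simp [writeCell, h]

/-- The butterflies of one stage of the Fourier transform, from array `16` to array `17`. -/
def fftButterflies : Prog :=
  .forLt 34 11 (.block [
    .intOp .div 35 34 33,
    .intOp .mod 36 34 33,
    .intOp .mod 35 35 31,
    .intOp .mul 35 35 30,
    .intOp .add 35 35 36,
    .intOp .sub 36 34 36,
    .intOp .add 37 35 33,
    .cpxOp .mul ⟨18, 3⟩ ⟨9, 36⟩ ⟨16, 37⟩,
    .cpxOp .add ⟨17, 34⟩ ⟨16, 35⟩ ⟨18, 3⟩])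

/-- Copying array `17` to array `16`. -/
def fftCopy : Prog := .forLt 34 11 (.cpxFun .copy ⟨16, 34⟩ ⟨17, 34⟩)

/-- The stages of the Fourier transform. -/
def fftStages : Prog :=
  .forLt 32 12 (.block [
    .intOp .div 33 30 5,
    fftButterflies,
    fftCopy,
    .intOp .add 30 33 3,
    .intOp .mul 31 31 5])

/-- The Fourier transform of array `16`, in place. -/
def fftProg : Prog :=
  .block [
    .intOp .add 30 11 3,
    .intConst 31 1,
    fftStages]

/-- Registers `35` and `37` end up with the two source indices of `fftStage_succ`, register `36`
with the exponent of the root of unity. An iteration takes nine instructions, the `skip` at the end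
of the block and the loop step. -/
theorem wp_fftButterflies {B m s τ : ℕ} {R : ℕ → ℕ} {M : ℕ → ℕ → ℂ} {x : ℕ → ℂ}
    (hB : 2 ^ m ≤ B) (hs : s < m) (h11 : R 11 = 2 ^ m)
    (h30 : R 30 = 2 ^ (m - s)) (h31 : R 31 = 2 ^ s) (h33 : R 33 = 2 ^ (m - (s + 1)))
    (hw : ∀ i < 2 ^ m, M 9 i = rootPow (2 ^ m) i)
    (hx : ∀ i < 2 ^ m, M 16 i = fftStage m x s i) {Q : Assertion}
    (hQ : ∀ τ' R' M', τ' ≤ τ + (1 + 2 ^ m * 11) → Frame 34 17 R R' M M' →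
      (∀ i < 2 ^ m, M' 17 i = fftStage m x (s + 1) i) → Q τ' R' M') :
    wp B fftButterflies Q τ R M := by
  refine wp_for (r := 34) (a := 17) (T := 10) (by simp [Prog.WritesFrom, Prog.block])
    (fun j R' M' => ∀ i < j, M' 17 i = fftStage m x (s + 1) i) h11 hB (by simp) ?_ hQ
  intro j hj τ' R' M' hInv hF
  have f11 := hF.reg 11 (by norm_num)
  have f30 := hF.reg 30 (by norm_num)
  have f31 := hF.reg 31 (by norm_num)
  have f33 := hF.reg 33 (by norm_num)
  have f9 := hF.mem 9 (by norm_num)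
  have f16 := hF.mem 16 (by norm_num)
  have hM : 2 ^ (m - s) = 2 ^ (m - (s + 1)) * 2 := by
    rw [← pow_succ]
    congr 1
    omega
  have hN : 2 ^ m = 2 ^ s * 2 ^ (m - s) := by
    rw [← pow_add]
    congr 1
    omega
  have hM0 : 0 < 2 ^ (m - (s + 1)) := by positivity
  have hL0 : 0 < 2 ^ s := by positivity
  have hr := Nat.mod_lt j hM0
  have hq := Nat.mod_lt (j / 2 ^ (m - (s + 1))) hL0
  have hrj := Nat.mod_le j (2 ^ (m - (s + 1)))
  have hqj := Nat.div_le_self j (2 ^ (m - (s + 1)))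
  have hqq := Nat.mod_le (j / 2 ^ (m - (s + 1))) (2 ^ s)
  have hmul : (j / 2 ^ (m - (s + 1)) % 2 ^ s + 1) * 2 ^ (m - s) ≤ 2 ^ m := by
    rw [hN]
    exact Nat.mul_le_mul_right _ hq
  rw [Nat.add_mul] at hmul
  have hst := fftStage_succ m x hs j
  simp only [Prog.block, wp, IntOp.eval, CpxOp.eval, Function.update_apply, f30, f31, f33, f9, f16,
    h30, h31, h33, writeCell_apply]
  norm_num
  rw [hx _ (by omega), hx _ (by omega), hw _ (by omega), ← hst]
  refine ⟨by omega, by omega, by omega, by omega, by omega, by omega, by omega, ?_⟩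
  intro i hi
  split_ifs with h
  · rw [h]
  · exact hInv i (by omega)

theorem wp_fftCopy {B N τ : ℕ} {R : ℕ → ℕ} {M : ℕ → ℕ → ℂ} (hB : N ≤ B) (h11 : R 11 = N)
    {Q : Assertion}
    (hQ : ∀ τ' R' M', τ' ≤ τ + (1 + N * 2) → Frame 34 16 R R' M M' →
      (∀ i < N, M' 16 i = M 17 i) → Q τ' R' M') :
    wp B fftCopy Q τ R M := by
  refine wp_for (r := 34) (a := 16) (T := 1) (by simp [Prog.WritesFrom])
    (fun j R' M' => (∀ i < j, M' 16 i = M 17 i) ∧ M' 17 = M 17) h11 hB (by simp) ?_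
    (fun τ' R' M' h1 h2 h3 => hQ τ' R' M' h1 h2 h3.1)
  rintro j hj τ' R' M' ⟨hInv, h17⟩ hF
  simp only [wp, CpxFun.eval, Function.update_self, h17]
  refine ⟨le_rfl, fun i hi => ?_, ?_⟩
  · rw [writeCell_apply, if_pos rfl]
    split_ifs with h
    · rw [h]
    · exact hInv i (by omega)
  · funext i
    rw [writeCell_apply, if_neg (by norm_num), h17]

theorem wp_fftProg {B m τ : ℕ} {R : ℕ → ℕ} {M : ℕ → ℕ → ℂ} (hB : 2 * 2 ^ m ≤ B)
    (h3 : R 3 = 0) (h5 : R 5 = 2) (h11 : R 11 = 2 ^ m) (h12 : R 12 = m)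
    (hw : ∀ i < 2 ^ m, M 9 i = rootPow (2 ^ m) i) {Q : Assertion}
    (hQ : ∀ τ' R' M', τ' ≤ τ + (10 + m * (10 + 2 ^ m * 13)) → Frame 30 16 R R' M M' →
      (∀ i < 2 ^ m, M' 16 i = fourierSum (2 ^ m) (M 16) i) → Q τ' R' M') :
    wp B fftProg Q τ R M := by
  have hm : m < 2 ^ m := Nat.lt_two_pow_self
  have hN0 : 0 < 2 ^ m := by positivity
  refine wp_mono (wp_frame (r := 30) (a := 16)
    (Q := fun τ' R' M' => τ' ≤ τ + (10 + m * (10 + 2 ^ m * 13)) ∧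
      ∀ i < 2 ^ m, M' 16 i = fourierSum (2 ^ m) (M 16) i)
    (by simp [Prog.WritesFrom, Prog.block, fftProg, fftStages, fftButterflies,
      fftCopy]) ?_)
    fun τ' R' M' h => hQ τ' R' M' h.1.1 h.2 h.1.2
  simp only [fftProg, Prog.block, wp, IntOp.eval, h11, h3]
  refine ⟨by omega, by omega, ?_⟩
  unfold fftStages
  refine wp_for (r := 30) (a := 16) (T := 9 + 2 ^ m * 13) (n := m)
    (by simp [Prog.WritesFrom, Prog.block, fftButterflies, fftCopy])
    (fun s R' M' => R' 30 = 2 ^ (m - s) ∧ R' 31 = 2 ^ s ∧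
      ∀ i < 2 ^ m, M' 16 i = fftStage m (M 16) s i) (by simp [h12]) (by omega) ?_ ?_ ?_
  · refine ⟨by simp, by simp, fun i hi => (fftStage_zero m _ hi).symm⟩
  · rintro s hs τ' R' M' ⟨i30, i31, i16⟩ hF
    have f3 := hF.reg 3 (by norm_num)
    have f5 := hF.reg 5 (by norm_num)
    have f11 := hF.reg 11 (by norm_num)
    have f9 := hF.mem 9 (by norm_num)
    simp [h3, h5, h11] at f3 f5 f11
    have hM : 2 ^ (m - s) = 2 ^ (m - (s + 1)) * 2 := by
      rw [← pow_succ]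
      congr 1
      omega
    have hle : 2 ^ (m - s) ≤ 2 ^ m := Nat.pow_le_pow_right (by norm_num) (by omega)
    have hle' : 2 ^ (s + 1) ≤ 2 ^ m := Nat.pow_le_pow_right (by norm_num) (by omega)
    have hdiv : 2 ^ (m - s) / 2 = 2 ^ (m - (s + 1)) := by omega
    simp only [Prog.block, wp, IntOp.eval, Function.update_apply]
    simp only [f5, i30]
    norm_num [hdiv]
    refine ⟨by omega, ?_⟩
    refine wp_fftButterflies (x := M 16) (by omega : 2 ^ m ≤ B) hs (by simp [f11]) (by simp [i30])
      (by simp [i31]) (by simp) (fun i hi => by rw [f9, hw i hi]) i16 ?_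
    intro τ1 R1 M1 ht1 hF1 h17
    refine wp_fftCopy (N := 2 ^ m) (by omega) (by rw [hF1.reg 11 (by norm_num)]; simp [f11]) ?_
    intro τ2 R2 M2 ht2 hF2 h16
    have g := hF1.mono (r' := 34) (a' := 16) (by norm_num) (by norm_num) |>.trans hF2
    have g3 := g.reg 3 (by norm_num)
    have g5 := g.reg 5 (by norm_num)
    have g31 := g.reg 31 (by norm_num)
    have g33 := g.reg 33 (by norm_num)
    simp [f3, f5, i31] at g3 g5 g31 g33
    simp only [g3, g5, g31, g33, add_zero, ← pow_succ]
    refine ⟨by omega, by omega, by omega, by simp, by simp, ?_⟩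
    intro i hi
    rw [h16 i hi, h17 i hi]
  · rintro τ' R' M' ht hF ⟨-, -, h16⟩
    refine ⟨?_, ?_⟩
    · have : m * (9 + 2 ^ m * 13 + 1) = m * (10 + 2 ^ m * 13) := by ring
      omega
    · intro i hi
      rw [h16 i hi, fftStage_self]

/-! ### Convolving a single line -/

/-- Copying a line of the tensor in array `13` to array `16`, padded with zeros. -/
def lineLoad : Prog :=
  .forLt 40 11 (.ifLt 40 0
    (.block [.intOp .mul 41 21 0, .intOp .add 41 41 40, .cpxFun .copy ⟨16, 40⟩ ⟨13, 41⟩])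
    (.cpxFun .copy ⟨16, 40⟩ ⟨6, 3⟩))

/-- Multiplying array `16` by array `14`. -/
def lineScale : Prog := .forLt 40 11 (.cpxOp .mul ⟨16, 40⟩ ⟨16, 40⟩ ⟨14, 40⟩)

/-- Storing the convolved line in array `15`, with rotated digits. -/
def lineStore : Prog :=
  .forLt 40 0 (.block [
    .intOp .add 41 40 0,
    .intOp .sub 41 11 41,
    .intOp .mul 42 40 9,
    .intOp .add 42 42 21,
    .cpxFun .copy ⟨15, 42⟩ ⟨16, 41⟩])

/-- Convolving the line with number `21` with the kernel. -/
def lineProg : Prog := .block [lineLoad, fftProg, lineScale, fftProg, lineStore]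

theorem wp_lineLoad {B N k L τ : ℕ} {R : ℕ → ℕ} {M : ℕ → ℕ → ℂ} (hN : N ≤ B)
    (hB : (L + 1) * k ≤ B) (h0 : R 0 = k) (h3 : R 3 = 0) (h11 : R 11 = N) (h21 : R 21 = L)
    (m6 : M 6 0 = 0) {Q : Assertion}
    (hQ : ∀ τ' R' M', τ' ≤ τ + (1 + N * 6) → Frame 40 16 R R' M M' →
      (∀ c < N, M' 16 c = if c < k then M 13 (L * k + c) else 0) → Q τ' R' M') :
    wp B lineLoad Q τ R M := by
  refine wp_for (r := 40) (a := 16) (T := 5) (by simp [Prog.WritesFrom, Prog.block])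
    (fun j R' M' => ∀ c < j, M' 16 c = if c < k then M 13 (L * k + c) else 0) h11 hN (by simp) ?_ hQ
  intro j hj τ' R' M' hInv hF
  have f0 := hF.reg 0 (by norm_num)
  have f3 := hF.reg 3 (by norm_num)
  have f21 := hF.reg 21 (by norm_num)
  have f6 := hF.mem 6 (by norm_num)
  have f13 := hF.mem 13 (by norm_num)
  simp only [Prog.block, wp, IntOp.eval, CpxFun.eval, Function.update_apply, f0, f3, f21,
    f6, f13, h0, h3, h21, writeCell_apply]
  norm_num
  rw [Nat.add_mul] at hB
  refine ⟨fun hjk => ⟨by omega, by omega, fun c hc => ?_⟩, fun hjk c hc => ?_⟩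
  · split_ifs with h1 h2 h2
    · rw [h1]
    · omega
    · rw [hInv c (by omega), if_pos h2]
    · rw [hInv c (by omega), if_neg h2]
  · split_ifs with h1 h2 h2
    · omega
    · exact m6
    · rw [hInv c (by omega), if_pos h2]
    · rw [hInv c (by omega), if_neg h2]

theorem wp_lineScale {B N τ : ℕ} {R : ℕ → ℕ} {M : ℕ → ℕ → ℂ} (hN : N ≤ B) (h11 : R 11 = N)
    {Q : Assertion}
    (hQ : ∀ τ' R' M', τ' ≤ τ + (1 + N * 2) → Frame 40 16 R R' M M' →
      (∀ c < N, M' 16 c = M 16 c * M 14 c) → Q τ' R' M') :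
    wp B lineScale Q τ R M := by
  refine wp_for (r := 40) (a := 16) (T := 1) (by simp [Prog.WritesFrom])
    (fun j R' M' => (∀ c < j, M' 16 c = M 16 c * M 14 c) ∧ ∀ c, j ≤ c → M' 16 c = M 16 c) h11 hN
    (by simp) ?_ (fun τ' R' M' h1 h2 h3 => hQ τ' R' M' h1 h2 h3.1)
  rintro j hj τ' R' M' ⟨hInv, hInv'⟩ hF
  have f14 := hF.mem 14 (by norm_num)
  simp only [wp, CpxOp.eval, Function.update_self, f14, writeCell_apply, if_true]
  refine ⟨le_rfl, fun c hc => ?_, fun c hc => ?_⟩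
  · split_ifs with h
    · rw [h, hInv' j le_rfl]
    · exact hInv c (by omega)
  · rw [if_neg (by omega), hInv' c (by omega)]

/-- Reading at `N - (c + k)` completes the inverse transform, and writing to `c * K + L` rotates the
digits. The other lines occupy the other residue classes modulo `K`. -/
theorem wp_lineStore {B N K k L τ : ℕ} {R : ℕ → ℕ} {M : ℕ → ℕ → ℂ} (hB : k * K ≤ B)
    (hN : 2 * k ≤ N) (hNB : N ≤ B) (hL : L < K) (h0 : R 0 = k) (h9 : R 9 = K) (h11 : R 11 = N)
    (h21 : R 21 = L) {Q : Assertion}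
    (hQ : ∀ τ' R' M', τ' ≤ τ + (1 + k * 7) → Frame 40 15 R R' M M' →
      (∀ c < k, M' 15 (c * K + L) = M 16 (N - (c + k))) →
      (∀ X, X % K ≠ L → M' 15 X = M 15 X) → Q τ' R' M') :
    wp B lineStore Q τ R M := by
  refine wp_for (r := 40) (a := 15) (T := 6) (by simp [Prog.WritesFrom, Prog.block])
    (fun j R' M' => (∀ c < j, M' 15 (c * K + L) = M 16 (N - (c + k))) ∧
      (∀ X, X % K ≠ L → M' 15 X = M 15 X) ∧ M' 16 = M 16) h0 (by omega)
    (by simp) ?_ (fun τ' R' M' h1 h2 h3 => hQ τ' R' M' h1 h2 h3.1 h3.2.1)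
  rintro j hj τ' R' M' ⟨hInv, hInv', h16⟩ hF
  have f0 := hF.reg 0 (by norm_num)
  have f9 := hF.reg 9 (by norm_num)
  have f11 := hF.reg 11 (by norm_num)
  have f21 := hF.reg 21 (by norm_num)
  have hjK : (j + 1) * K ≤ k * K := Nat.mul_le_mul_right _ hj
  rw [Nat.add_mul] at hjK
  simp only [Prog.block, wp, IntOp.eval, CpxFun.eval, Function.update_apply, f0, f9, f11, f21,
    h0, h9, h11, h21, h16]
  norm_num
  refine ⟨by omega, by omega, by omega, by omega, fun c hc => ?_, fun X hX => ?_, ?_⟩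
  · rw [writeCell_apply, if_pos rfl]
    split_ifs with h
    · have : c = j := by
        have hK : 0 < K := by omega
        have := Nat.add_right_cancel h
        exact Nat.eq_of_mul_eq_mul_right hK this
      rw [this]
    · refine hInv c ?_
      rcases Nat.lt_or_ge c j with h' | h'
      · exact h'
      · obtain rfl : c = j := by omega
        exact absurd rfl h
  · rw [writeCell_apply, if_pos rfl, if_neg]
    · exact hInv' X hX
    · rintro rfl
      exact hX (by rw [Nat.mul_add_mod_of_lt hL])
  · funext X
    rw [writeCell_apply, if_neg (by norm_num), h16]

/-- The convolution theorem `fourierSum_mul_fourierSum`, with the normalized transform of the kernel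
prepared in array `14`. -/
theorem wp_lineProg {B m K k L τ : ℕ} {R : ℕ → ℕ} {M : ℕ → ℕ → ℂ} {h : ℕ → ℂ}
    (hB : k * K ≤ B) (hN : 2 * k ≤ 2 ^ m) (hNB : 2 * 2 ^ m ≤ B) (hL : L < K) (h0 : R 0 = k)
    (h3 : R 3 = 0) (h5 : R 5 = 2) (h9 : R 9 = K) (h11 : R 11 = 2 ^ m) (h12 : R 12 = m)
    (h21 : R 21 = L) (hw : ∀ i < 2 ^ m, M 9 i = rootPow (2 ^ m) i) (m6 : M 6 0 = 0)
    (m14 : ∀ i < 2 ^ m, M 14 i = fourierSum (2 ^ m) h i * (1 / (2 ^ m : ℕ))) {Q : Assertion}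
    (hQ : ∀ τ' R' M', τ' ≤ τ + (30 + 2 * (m * (10 + 2 ^ m * 13)) + 12 * 2 ^ m) →
      Frame 30 15 R R' M M' →
      (∀ c < k, M' 15 (c * K + L) = axisStep k K h (M 13) (c * K + L)) →
      (∀ X, X % K ≠ L → M' 15 X = M 15 X) → Q τ' R' M') :
    wp B lineProg Q τ R M := by
  have hLk : (L + 1) * k ≤ B := by
    have := Nat.mul_le_mul_right k hL
    rw [mul_comm k K] at hB
    exact this.trans hB
  refine wp_mono (wp_frame (r := 30) (a := 15)
    (Q := fun τ' R' M' => τ' ≤ τ + (30 + 2 * (m * (10 + 2 ^ m * 13)) + 12 * 2 ^ m) ∧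
      (∀ c < k, M' 15 (c * K + L) = axisStep k K h (M 13) (c * K + L)) ∧
      (∀ X, X % K ≠ L → M' 15 X = M 15 X))
    (by simp [Prog.WritesFrom, Prog.block, lineProg, lineLoad, lineScale, lineStore, fftProg,
      fftStages, fftButterflies, fftCopy]) ?_)
    fun τ' R' M' h => hQ τ' R' M' h.1.1 h.2 h.1.2.1 h.1.2.2
  simp only [lineProg, Prog.block, wp]
  refine wp_lineLoad (by omega) hLk h0 h3 h11 h21 m6 fun τ1 R1 M1 t1 F1 l1 => ?_
  refine wp_fftProg hNB (by rw [F1.reg 3 (by norm_num), h3]) (by rw [F1.reg 5 (by norm_num), h5])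
    (by rw [F1.reg 11 (by norm_num), h11]) (by rw [F1.reg 12 (by norm_num), h12])
    (by rw [F1.mem 9 (by norm_num)]; exact hw) fun τ2 R2 M2 t2 F2 l2 => ?_
  have G2 := (F1.mono (r' := 30) (a' := 16) (by norm_num) (by norm_num)).trans F2
  refine wp_lineScale (N := 2 ^ m) (by omega) (by rw [G2.reg 11 (by norm_num), h11])
    fun τ3 R3 M3 t3 F3 l3 => ?_
  have G3 := G2.trans (F3.mono (r' := 30) (a' := 16) (by norm_num) (by norm_num))
  refine wp_fftProg hNB (by rw [G3.reg 3 (by norm_num), h3]) (by rw [G3.reg 5 (by norm_num), h5])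
    (by rw [G3.reg 11 (by norm_num), h11]) (by rw [G3.reg 12 (by norm_num), h12])
    (by rw [G3.mem 9 (by norm_num)]; exact hw) fun τ4 R4 M4 t4 F4 l4 => ?_
  have G4 := G3.trans F4
  refine wp_lineStore hB hN (by omega) hL (by rw [G4.reg 0 (by norm_num), h0])
    (by rw [G4.reg 9 (by norm_num), h9]) (by rw [G4.reg 11 (by norm_num), h11])
    (by rw [G4.reg 21 (by norm_num), h21]) fun τ5 R5 M5 t5 F5 l5 l6 => ?_
  refine ⟨by omega, fun c hc => ?_, fun X hX => ?_⟩
  · have hK : 0 < K := by omega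
    have e1 : (c * K + L) % K = L := Nat.mul_add_mod_of_lt hL
    have e2 : (c * K + L) / K = c := by
      rw [mul_comm, Nat.mul_add_div hK, Nat.div_eq_of_lt hL, add_zero]
    have e3 (i : ℕ) (hi : i < 2 ^ m) : M3 16 i = fourierSum (2 ^ m) (M1 16) i *
        (fourierSum (2 ^ m) h i * (1 / (2 ^ m : ℕ))) := by
      rw [l3 i hi, l2 i hi, G2.mem 14 (by norm_num), m14 i hi]
    rw [l5 c hc, l4 _ (by omega), fourierSum_congr e3, fourierSum_mul_fourierSum hN, axisStep,
      e1, e2]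
    · refine Finset.sum_congr rfl fun b hb => ?_
      rw [Finset.mem_range] at hb
      rw [l1 b (by omega), if_pos hb]
    · intro b hb hkb
      rw [l1 b hb, if_neg (by omega)]
    · exact hc
  · rw [l6 X hX, G4.mem 15 (by norm_num)]

/-! ### Convolving along one axis and along all axes -/

/-- The kernel of axis `20` is written to array `16`. -/
def kernelLoad : Prog :=
  .forLt 21 11 (.block [
    .intOp .mod 41 21 0,
    .cpxOp .mul ⟨16, 21⟩ ⟨8, 20⟩ ⟨1, 41⟩,
    .cpxOp .mul ⟨16, 21⟩ ⟨7, 3⟩ ⟨16, 21⟩,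
    .cpxFun .exp ⟨16, 21⟩ ⟨16, 21⟩,
    .ifLt 20 15 .skip (.ifLt 15 20 .skip (.cpxOp .mul ⟨16, 21⟩ ⟨16, 21⟩ ⟨2, 41⟩))])

/-- The normalized transform of the kernel is stored in array `14`. -/
def kernelStore : Prog := .forLt 40 11 (.cpxOp .mul ⟨14, 40⟩ ⟨16, 40⟩ ⟨7, 5⟩)

/-- Convolving all lines along the current axis. -/
def lineLoop : Prog := .forLt 21 9 lineProg

/-- Copying array `15` to array `13`. -/
def tensorCopy : Prog := .forLt 40 10 (.cpxFun .copy ⟨13, 40⟩ ⟨15, 40⟩)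

/-- Convolution along one axis. -/
def axisProg : Prog := .block [kernelLoad, fftProg, kernelStore, lineLoop, tensorCopy]

/-- Convolution along all axes. -/
def convProg : Prog := .forLt 20 8 axisProg

/-- The number of steps of `lineProg`. -/
def lineTime (m : ℕ) : ℕ := 30 + 2 * (m * (10 + 2 ^ m * 13)) + 12 * 2 ^ m

/-- The number of steps of `axisProg`. -/
def axisTime (k K m : ℕ) : ℕ :=
  20 + 2 ^ m * 12 + m * (10 + 2 ^ m * 13) + K * (lineTime m + 1) + k * K * 2

section

variable {k p : ℕ} [NeZero k]

/-- The registers and arrays that are set up before the iteration starts. -/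
structure Loaded (γ : Fin p → ℝ) (φ ξ : ZMod k → ℝ) (d m : ℕ) (R : ℕ → ℕ) (M : ℕ → ℕ → ℂ) :
    Prop where
  r0 : R 0 = k
  r1 : R 1 = p
  r2 : R 2 = d
  r3 : R 3 = 0
  r4 : R 4 = 1
  r5 : R 5 = 2
  r8 : R 8 = 2 * p + 2
  r9 : R 9 = k ^ (2 * p + 1)
  r10 : R 10 = k * k ^ (2 * p + 1)
  r11 : R 11 = 2 ^ m
  r12 : R 12 = m
  r13 : R 13 = p + 1
  m1 : ∀ x < k, M 1 x = (φ (x : ZMod k) : ℂ)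
  m2 : ∀ x < k, M 2 x = (ξ (x : ZMod k) : ℂ)
  m6 : M 6 0 = 0
  m7 : M 7 0 = Complex.I
  m7' : M 7 2 = 1 / (2 ^ m : ℕ)
  m8 : ∀ j < 2 * p + 2, M 8 j = (positionAngle γ j : ℂ)
  m9 : ∀ i < 2 ^ m, M 9 i = rootPow (2 ^ m) i

variable {γ : Fin p → ℝ} {φ ξ : ZMod k → ℝ} {d m : ℕ}

theorem Loaded.frame {R R' : ℕ → ℕ} {M M' : ℕ → ℕ → ℂ} {r a : ℕ} (h : Loaded γ φ ξ d m R M)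
    (hF : Frame r a R R' M M') (hr : 14 ≤ r) (ha : 10 ≤ a) : Loaded γ φ ξ d m R' M' where
  r0 := by rw [hF.reg 0 (by omega), h.r0]
  r1 := by rw [hF.reg 1 (by omega), h.r1]
  r2 := by rw [hF.reg 2 (by omega), h.r2]
  r3 := by rw [hF.reg 3 (by omega), h.r3]
  r4 := by rw [hF.reg 4 (by omega), h.r4]
  r5 := by rw [hF.reg 5 (by omega), h.r5]
  r8 := by rw [hF.reg 8 (by omega), h.r8]
  r9 := by rw [hF.reg 9 (by omega), h.r9]
  r10 := by rw [hF.reg 10 (by omega), h.r10]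
  r11 := by rw [hF.reg 11 (by omega), h.r11]
  r12 := by rw [hF.reg 12 (by omega), h.r12]
  r13 := by rw [hF.reg 13 (by omega), h.r13]
  m1 := by rw [hF.mem 1 (by omega)]; exact h.m1
  m2 := by rw [hF.mem 2 (by omega)]; exact h.m2
  m6 := by rw [hF.mem 6 (by omega)]; exact h.m6
  m7 := by rw [hF.mem 7 (by omega)]; exact h.m7
  m7' := by rw [hF.mem 7 (by omega)]; exact h.m7'
  m8 := by rw [hF.mem 8 (by omega)]; exact h.m8
  m9 := by rw [hF.mem 9 (by omega)]; exact h.m9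

/-- The kernel is continued periodically over the buffer, because lines read it at `c + k - b`,
between `1` and `2k - 1`. The machine can only test `<`, so two comparisons decide `j = z`. -/
theorem wp_kernelLoad {B j z τ : ℕ} {R : ℕ → ℕ} {M : ℕ → ℕ → ℂ} (hL : Loaded γ φ ξ d m R M)
    (hNB : 2 * 2 ^ m ≤ B) (hj : j < 2 * p + 2) (h15 : R 15 = z) (h20 : R 20 = j) {Q : Assertion}
    (hQ : ∀ τ' R' M', τ' ≤ τ + (1 + 2 ^ m * 9) → Frame 21 16 R R' M M' →
      (∀ c < 2 ^ m, M' 16 c = axisKernel γ φ ξ z j c) → Q τ' R' M') :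
    wp B kernelLoad Q τ R M := by
  refine wp_for (r := 21) (a := 16) (T := 8) (by simp [Prog.WritesFrom, Prog.block])
    (fun i R' M' => ∀ c < i, M' 16 c = axisKernel γ φ ξ z j c) hL.r11 (by omega) (by simp) ?_ hQ
  intro i hi τ' R' M' hInv hF
  have f0 := hF.reg 0 (by norm_num)
  have f3 := hF.reg 3 (by norm_num)
  have f15 := hF.reg 15 (by norm_num)
  have f20 := hF.reg 20 (by norm_num)
  have f1 := hF.mem 1 (by norm_num)
  have f2 := hF.mem 2 (by norm_num)
  have f7 := hF.mem 7 (by norm_num)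
  have f8 := hF.mem 8 (by norm_num)
  have hik : i % k < k := Nat.mod_lt _ (NeZero.pos k)
  have hii := Nat.mod_le i k
  have hexp : Complex.exp (Complex.I * ((positionAngle γ j : ℂ) * (φ ((i % k : ℕ) : ZMod k) : ℂ))) *
      (if j = z then (ξ ((i % k : ℕ) : ZMod k) : ℂ) else 1) = axisKernel γ φ ξ z j i := by
    rw [axisKernel, ZMod.natCast_mod]
  simp only [Prog.block, wp, IntOp.eval, CpxOp.eval, CpxFun.eval, Function.update_apply, f0, f3,
    f15, f20, f1, f2, f7, f8, hL.r0, hL.r3, h15, h20, writeCell_apply]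
  norm_num
  rw [hL.m1 _ hik, hL.m2 _ hik, hL.m7, hL.m8 j hj]
  refine ⟨by omega, fun hjz => ?_, fun hjz => ⟨fun hzj => ?_, fun hzj => ?_⟩⟩
  · intro c hc
    rw [if_neg (by omega), mul_one] at hexp
    split_ifs with h
    · rw [h, hexp]
    · exact hInv c (by omega)
  · intro c hc
    rw [if_neg (by omega), mul_one] at hexp
    split_ifs with h
    · rw [h, hexp]
    · exact hInv c (by omega)
  · intro c hc
    rw [if_pos (by omega)] at hexp
    split_ifs with h
    · rw [h, hexp]
    · exact hInv c (by omega)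

theorem wp_kernelStore {B τ : ℕ} {R : ℕ → ℕ} {M : ℕ → ℕ → ℂ} (hL : Loaded γ φ ξ d m R M)
    (hNB : 2 * 2 ^ m ≤ B) {Q : Assertion}
    (hQ : ∀ τ' R' M', τ' ≤ τ + (1 + 2 ^ m * 2) → Frame 40 14 R R' M M' →
      (∀ c < 2 ^ m, M' 14 c = M 16 c * (1 / (2 ^ m : ℕ))) → Q τ' R' M') :
    wp B kernelStore Q τ R M := by
  refine wp_for (r := 40) (a := 14) (T := 1) (by simp [Prog.WritesFrom])
    (fun i R' M' => (∀ c < i, M' 14 c = M 16 c * (1 / (2 ^ m : ℕ))) ∧ M' 16 = M 16) hL.r11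
    (by omega) (by simp) ?_ (fun τ' R' M' h1 h2 h3 => hQ τ' R' M' h1 h2 h3.1)
  rintro i hi τ' R' M' ⟨hInv, h16⟩ hF
  have f5 := hF.reg 5 (by norm_num)
  have f7 := hF.mem 7 (by norm_num)
  simp only [wp, CpxOp.eval, Function.update_apply, f5, f7, h16, hL.r5]
  norm_num
  rw [hL.m7']
  refine ⟨fun c hc => ?_, ?_⟩
  · rw [writeCell_apply, if_pos rfl]
    split_ifs with h
    · rw [h]
      simp
    · rw [hInv c (by omega)]
      simp
  · funext X
    rw [writeCell_apply, if_neg (by norm_num), h16]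

theorem wp_lineLoop {B τ : ℕ} {R : ℕ → ℕ} {M : ℕ → ℕ → ℂ} {h : ℕ → ℂ}
    (hL : Loaded γ φ ξ d m R M) (hB : k * k ^ (2 * p + 1) ≤ B) (hN : 2 * k ≤ 2 ^ m)
    (hNB : 2 * 2 ^ m ≤ B)
    (m14 : ∀ i < 2 ^ m, M 14 i = fourierSum (2 ^ m) h i * (1 / (2 ^ m : ℕ))) {Q : Assertion}
    (hQ : ∀ τ' R' M', τ' ≤ τ + (1 + k ^ (2 * p + 1) * (lineTime m + 1)) → Frame 21 15 R R' M M' →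
      (∀ X < k * k ^ (2 * p + 1), M' 15 X = axisStep k (k ^ (2 * p + 1)) h (M 13) X) →
      Q τ' R' M') :
    wp B lineLoop Q τ R M := by
  have hk : 0 < k := NeZero.pos k
  have hK : 0 < k ^ (2 * p + 1) := by positivity
  have hKB : k ^ (2 * p + 1) ≤ B := le_trans (Nat.le_mul_of_pos_left _ hk) hB
  refine wp_for (r := 21) (a := 15) (T := lineTime m)
    (by simp [Prog.WritesFrom, Prog.block, lineProg, lineLoad, lineScale, lineStore, fftProg,
      fftStages, fftButterflies, fftCopy])
    (fun L R' M' => ∀ X < k * k ^ (2 * p + 1), X % k ^ (2 * p + 1) < L →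
      M' 15 X = axisStep k (k ^ (2 * p + 1)) h (M 13) X) hL.r9 hKB (by simp) ?_
    (fun τ' R' M' h1 h2 h3 => hQ τ' R' M' h1 h2 fun X hX => h3 X hX (Nat.mod_lt _ hK))
  intro L hLK τ' R' M' hInv hF
  have hL' := hL.frame (hF.update le_rfl L) (by norm_num) (by norm_num)
  refine wp_lineProg (h := h) hB hN hNB hLK hL'.r0 hL'.r3 hL'.r5 hL'.r9 hL'.r11 hL'.r12 (by simp)
    hL'.m9 hL'.m6 (by rw [hF.mem 14 (by norm_num)]; exact m14) ?_
  intro τ1 R1 M1 t1 F1 h1 h2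
  refine ⟨t1, fun X hX hXL => ?_⟩
  by_cases hXe : X % k ^ (2 * p + 1) = L
  · have hdec : X / k ^ (2 * p + 1) * k ^ (2 * p + 1) + L = X := by
      rw [← hXe]
      exact Nat.div_add_mod' X _
    have hd : X / k ^ (2 * p + 1) < k := Nat.div_lt_of_lt_mul (by rwa [mul_comm] at hX)
    rw [← hdec, h1 _ hd, hF.mem 13 (by norm_num)]
  · rw [h2 X hXe]
    exact hInv X hX (by omega)

theorem wp_tensorCopy {B n τ : ℕ} {R : ℕ → ℕ} {M : ℕ → ℕ → ℂ} (hB : n ≤ B) (h10 : R 10 = n)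
    {Q : Assertion}
    (hQ : ∀ τ' R' M', τ' ≤ τ + (1 + n * 2) → Frame 40 13 R R' M M' →
      (∀ i < n, M' 13 i = M 15 i) → Q τ' R' M') :
    wp B tensorCopy Q τ R M := by
  refine wp_for (r := 40) (a := 13) (T := 1) (by simp [Prog.WritesFrom])
    (fun j R' M' => (∀ i < j, M' 13 i = M 15 i) ∧ M' 15 = M 15) h10 hB (by simp) ?_
    (fun τ' R' M' h1 h2 h3 => hQ τ' R' M' h1 h2 h3.1)
  rintro j hj τ' R' M' ⟨hInv, h15⟩ hF
  simp only [wp, CpxFun.eval, Function.update_self, h15]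
  refine ⟨le_rfl, fun i hi => ?_, ?_⟩
  · rw [writeCell_apply, if_pos rfl]
    split_ifs with h
    · rw [h]
    · exact hInv i (by omega)
  · funext i
    rw [writeCell_apply, if_neg (by norm_num), h15]

theorem writesFrom_axisProg : axisProg.WritesFrom 21 13 := by
  simp [Prog.WritesFrom, Prog.block, axisProg, kernelLoad, kernelStore, lineLoop, tensorCopy,
    lineProg, lineLoad, lineScale, lineStore, fftProg, fftStages, fftButterflies, fftCopy]

theorem wp_axisProg {B j z τ : ℕ} {R : ℕ → ℕ} {M : ℕ → ℕ → ℂ} (hL : Loaded γ φ ξ d m R M)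
    (hB : k * k ^ (2 * p + 1) ≤ B) (hN : 2 * k ≤ 2 ^ m)
    (hNB : 2 * 2 ^ m ≤ B) (hj : j < 2 * p + 2) (h15 : R 15 = z) (h20 : R 20 = j) {Q : Assertion}
    (hQ : ∀ τ' R' M', τ' ≤ τ + axisTime k (k ^ (2 * p + 1)) m → Frame 21 13 R R' M M' →
      (∀ X < k * k ^ (2 * p + 1), M' 13 X =
        axisStep k (k ^ (2 * p + 1)) (axisKernel γ φ ξ z j) (M 13) X) → Q τ' R' M') :
    wp B axisProg Q τ R M := by
  refine wp_mono (wp_frame (r := 21) (a := 13)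
    (Q := fun τ' R' M' => τ' ≤ τ + axisTime k (k ^ (2 * p + 1)) m ∧
      (∀ X < k * k ^ (2 * p + 1), M' 13 X =
        axisStep k (k ^ (2 * p + 1)) (axisKernel γ φ ξ z j) (M 13) X))
    writesFrom_axisProg ?_) fun τ' R' M' h => hQ τ' R' M' h.1.1 h.2 h.1.2
  simp only [axisProg, Prog.block, wp]
  refine wp_kernelLoad hL hNB hj h15 h20 fun τ1 R1 M1 t1 F1 l1 => ?_
  have L1 := hL.frame F1 (by norm_num) (by norm_num)
  refine wp_fftProg hNB L1.r3 L1.r5 L1.r11 L1.r12 L1.m9 fun τ2 R2 M2 t2 F2 l2 => ?_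
  have L2 := L1.frame F2 (by norm_num) (by norm_num)
  refine wp_kernelStore L2 hNB fun τ3 R3 M3 t3 F3 l3 => ?_
  have L3 := L2.frame F3 (by norm_num) (by norm_num)
  refine wp_lineLoop (h := axisKernel γ φ ξ z j) L3 hB hN hNB ?_
    fun τ4 R4 M4 t4 F4 l4 => ?_
  · intro i hi
    rw [l3 i hi, l2 i hi, fourierSum_congr l1]
  have L4 := L3.frame F4 (by norm_num) (by norm_num)
  refine wp_tensorCopy hB L4.r10 fun τ5 R5 M5 t5 F5 l5 => ?_
  refine ⟨?_, fun X hX => ?_⟩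
  · simp only [axisTime]
    omega
  · rw [l5 X hX, l4 X hX, F3.mem 13 (by norm_num), F2.mem 13 (by norm_num),
      F1.mem 13 (by norm_num)]

/-- A step reads only the first `k * K` cells, so the content of the memory beyond them is
irrelevant. -/
theorem axisStep_congr {K : ℕ} (hK : 0 < K) {h T T' : ℕ → ℂ} (hT : ∀ X < k * K, T X = T' X) (X : ℕ) :
    axisStep k K h T X = axisStep k K h T' X := by
  refine Finset.sum_congr rfl fun b hb => ?_
  rw [Finset.mem_range] at hb
  rw [hT]
  have h1 : X % K + 1 ≤ K := Nat.mod_lt _ hK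
  have h2 := Nat.mul_le_mul_right k h1
  rw [Nat.add_mul, mul_comm K k] at h2
  omega

theorem wp_convProg {B z τ : ℕ} {R : ℕ → ℕ} {M : ℕ → ℕ → ℂ} (hL : Loaded γ φ ξ d m R M)
    (hB : k * k ^ (2 * p + 1) ≤ B) (hN : 2 * k ≤ 2 ^ m)
    (hNB : 2 * 2 ^ m ≤ B) (hp : 2 * p + 2 ≤ B) (h15 : R 15 = z) {Q : Assertion}
    (hQ : ∀ τ' R' M', τ' ≤ τ + (1 + (2 * p + 2) * (axisTime k (k ^ (2 * p + 1)) m + 1)) →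
      Frame 20 13 R R' M M' →
      (∀ X < k * k ^ (2 * p + 1), M' 13 X =
        axisIter k (k ^ (2 * p + 1)) (axisKernel γ φ ξ z) (M 13) (2 * p + 2) X) → Q τ' R' M') :
    wp B convProg Q τ R M := by
  have hk : 0 < k := NeZero.pos k
  refine wp_for (r := 20) (a := 13) (T := axisTime k (k ^ (2 * p + 1)) m)
    (by simp [Prog.WritesFrom, Prog.block, axisProg, kernelLoad, kernelStore, lineLoop, tensorCopy,
      lineProg, lineLoad, lineScale, lineStore, fftProg, fftStages, fftButterflies, fftCopy])
    (fun j R' M' => ∀ X < k * k ^ (2 * p + 1), M' 13 X =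
        axisIter k (k ^ (2 * p + 1)) (axisKernel γ φ ξ z) (M 13) j X) hL.r8 hp
    (fun X _ => rfl) ?_ hQ
  intro j hj τ' R' M' hInv hF
  have hL' := hL.frame (hF.update le_rfl j) (by norm_num) (by norm_num)
  refine wp_axisProg (z := z) hL' hB hN hNB hj ?_ (by simp) fun τ1 R1 M1 t1 F1 l1 => ⟨t1, ?_⟩
  · rw [(hF.update le_rfl j).reg 15 (by norm_num), h15]
  · intro X hX
    rw [l1 X hX, axisIter, axisStep_congr (by positivity) hInv]

end

/-! ### The rounds of the iteration -/

/-- Array `13` becomes the product of the arrays `10` and `11`. -/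
def tensorLoad : Prog := .forLt 40 10 (.cpxOp .mul ⟨13, 40⟩ ⟨10, 40⟩ ⟨11, 40⟩)

/-- Array `11` becomes the power of array `13` with the degree. -/
def branchPower : Prog := .forLt 40 10 (.cpxPow ⟨11, 40⟩ ⟨13, 40⟩ 2)

/-- The sum of the products of the arrays `10`, `11`, `13` is added to array `12`. -/
def accumulate : Prog :=
  .forLt 40 10 (.block [
    .cpxOp .mul ⟨18, 3⟩ ⟨10, 40⟩ ⟨11, 40⟩,
    .cpxOp .mul ⟨18, 3⟩ ⟨18, 3⟩ ⟨13, 40⟩,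
    .cpxOp .add ⟨12, 3⟩ ⟨12, 3⟩ ⟨18, 3⟩])

/-- The iteration and the final sum. -/
def mainLoop : Prog :=
  .forLt 14 13 (.block [
    .ifLt 14 1 (.intOp .add 15 8 3) (.intOp .add 15 1 3),
    tensorLoad,
    convProg,
    .ifLt 14 1 branchPower accumulate])

/-- The number of steps of one round of `mainLoop`. -/
def roundTime (k p m : ℕ) : ℕ :=
  20 + k * k ^ (2 * p + 1) * 7 + (2 * p + 2) * (axisTime k (k ^ (2 * p + 1)) m + 1)

theorem wp_tensorLoad {B n τ : ℕ} {R : ℕ → ℕ} {M : ℕ → ℕ → ℂ} (hB : n ≤ B) (h10 : R 10 = n)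
    {Q : Assertion}
    (hQ : ∀ τ' R' M', τ' ≤ τ + (1 + n * 2) → Frame 40 13 R R' M M' →
      (∀ i < n, M' 13 i = M 10 i * M 11 i) → Q τ' R' M') :
    wp B tensorLoad Q τ R M := by
  refine wp_for (r := 40) (a := 13) (T := 1) (by simp [Prog.WritesFrom])
    (fun j R' M' => ∀ i < j, M' 13 i = M 10 i * M 11 i) h10 hB (by simp) ?_ hQ
  intro j hj τ' R' M' hInv hF
  have f10 := hF.mem 10 (by norm_num)
  have f11 := hF.mem 11 (by norm_num)
  simp only [wp, CpxOp.eval, Function.update_self, f10, f11, writeCell_apply, if_true]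
  refine ⟨le_rfl, fun i hi => ?_⟩
  split_ifs with h
  · rw [h]
  · exact hInv i (by omega)

theorem wp_branchPower {B n τ : ℕ} {R : ℕ → ℕ} {M : ℕ → ℕ → ℂ} (hB : n ≤ B) (h10 : R 10 = n)
    {Q : Assertion}
    (hQ : ∀ τ' R' M', τ' ≤ τ + (1 + n * 2) → Frame 40 11 R R' M M' →
      (∀ i < n, M' 11 i = M 13 i ^ R 2) → M' 12 = M 12 → Q τ' R' M') :
    wp B branchPower Q τ R M := by
  refine wp_for (r := 40) (a := 11) (T := 1) (by simp [Prog.WritesFrom])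
    (fun j R' M' => (∀ i < j, M' 11 i = M 13 i ^ R 2) ∧ M' 12 = M 12 ∧ M' 13 = M 13) h10 hB
    (by simp) ?_ (fun τ' R' M' h1 h2 h3 => hQ τ' R' M' h1 h2 h3.1 h3.2.1)
  rintro j hj τ' R' M' ⟨hInv, h12, h13⟩ hF
  have f2 := hF.reg 2 (by norm_num)
  simp only [wp, Function.update_apply, f2, h13]
  norm_num
  refine ⟨fun i hi => ?_, ?_, ?_⟩
  · rw [writeCell_apply, if_pos rfl]
    split_ifs with h
    · rw [h]
    · exact hInv i (by omega)
  · funext i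
    rw [writeCell_apply, if_neg (by norm_num), h12]
  · funext i
    rw [writeCell_apply, if_neg (by norm_num), h13]

theorem wp_accumulate {B n τ : ℕ} {R : ℕ → ℕ} {M : ℕ → ℕ → ℂ} (hB : n ≤ B) (h3 : R 3 = 0)
    (h10 : R 10 = n) {Q : Assertion}
    (hQ : ∀ τ' R' M', τ' ≤ τ + (1 + n * 5) → Frame 40 12 R R' M M' →
      (M' 12 0 = M 12 0 + ∑ i ∈ Finset.range n, M 10 i * M 11 i * M 13 i) → Q τ' R' M') :
    wp B accumulate Q τ R M := by
  refine wp_for (r := 40) (a := 12) (T := 4) (by simp [Prog.WritesFrom, Prog.block])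
    (fun j R' M' => (M' 12 0 = M 12 0 + ∑ i ∈ Finset.range j, M 10 i * M 11 i * M 13 i) ∧
      M' 13 = M 13) h10 hB
    (by simp) ?_ (fun τ' R' M' h1 h2 h3 => hQ τ' R' M' h1 h2 h3.1)
  rintro j hj τ' R' M' ⟨hInv, h13⟩ hF
  have f3 := hF.reg 3 (by norm_num)
  have f10 := hF.mem 10 (by norm_num)
  have f11 := hF.mem 11 (by norm_num)
  simp only [Prog.block, wp, CpxOp.eval, Function.update_apply, f3, f10, f11, h3, h13,
    writeCell_apply]
  norm_num
  refine ⟨?_, ?_⟩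
  · rw [hInv, Finset.sum_range_succ, add_assoc]
  · funext i
    simp [writeCell_apply, h13]

section

variable {k p : ℕ} [NeZero k] {γ : Fin p → ℝ} {φ ξ : ZMod k → ℝ} {d m : ℕ}

/-- Arrays `10`, `11`, `12` hold the weight, the current H^{(r)} and the final sum. Rounds `0, …, p
- 1` compute the next H; round `p` performs the same convolution with `ξ` included and adds up the
result. -/
theorem wp_mainLoop {B τ : ℕ} {R : ℕ → ℕ} {M : ℕ → ℕ → ℂ} {U : Fin p → Matrix (ZMod k) (ZMod k) ℂ}
    {ψ : ZMod k → ℂ} (hL : Loaded γ φ ξ d m R M)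
    (hB : k * k ^ (2 * p + 1) ≤ B) (hN : 2 * k ≤ 2 ^ m)
    (hNB : 2 * 2 ^ m ≤ B) (hp : 2 * p + 2 ≤ B)
    (m10 : ∀ X < k * k ^ (2 * p + 1), M 10 X = pathWeight U ψ (digitString k (2 * p + 2) X))
    (m11 : ∀ X < k * k ^ (2 * p + 1), M 11 X = 1) (m12 : M 12 0 = 0) {Q : Assertion}
    (hQ : ∀ τ' R' M', τ' ≤ τ + (1 + (p + 1) * (roundTime k p m + 1)) →
      Frame 14 11 R R' M M' →
      (M' 12 0 = ∑ a, pathWeight U ψ a * branchTensor d γ U ψ (onDiff φ) p a *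
        (lossMatrix γ (onDiff φ) (onDiff ξ) *ᵥ
          fun b => pathWeight U ψ b * branchTensor d γ U ψ (onDiff φ) p b) a) → Q τ' R' M') :
    wp B mainLoop Q τ R M := by
  have hkK : k ^ (2 * p + 2) = k * k ^ (2 * p + 1) := pow_succ' k (2 * p + 1)
  have hK : 0 < k ^ (2 * p + 1) := pow_pos (NeZero.pos k) _
  refine wp_for (r := 14) (a := 11) (T := roundTime k p m)
    (by simp [Prog.WritesFrom, Prog.block, tensorLoad, branchPower, accumulate, convProg, axisProg,
      kernelLoad, kernelStore, lineLoop, tensorCopy, lineProg, lineLoad, lineScale, lineStore,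
      fftProg, fftStages, fftButterflies, fftCopy])
    (fun r R' M' =>
      (r ≤ p → (∀ X < k * k ^ (2 * p + 1), M' 11 X =
        branchTensor d γ U ψ (onDiff φ) r (digitString k (2 * p + 2) X)) ∧ M' 12 0 = 0) ∧
      (r = p + 1 → M' 12 0 = ∑ a, pathWeight U ψ a * branchTensor d γ U ψ (onDiff φ) p a *
        (lossMatrix γ (onDiff φ) (onDiff ξ) *ᵥ
          fun b => pathWeight U ψ b * branchTensor d γ U ψ (onDiff φ) p b) a)) hL.r13 (by omega)
    ⟨fun _ => ⟨m11, m12⟩, by omega⟩ ?_ (fun τ' R' M' h1 h2 h3 => hQ τ' R' M' h1 h2 (h3.2 rfl))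
  rintro r hr τ' R' M' ⟨hInv, -⟩ hF
  obtain ⟨i11, i12⟩ := hInv (by omega)
  have L0 := hL.frame (hF.update le_rfl r) (by norm_num) (by norm_num)
  -- the part of a round that does not depend on the branch
  have common (z : ℕ) (h : ℕ → ℕ → ℂ) (hz : h = axisKernel γ φ ξ z)
      {A : Matrix (Fin (2 * p + 2) → ZMod k) (Fin (2 * p + 2) → ZMod k) ℂ}
      (hA : ∀ X Y, ∏ j ∈ Finset.range (2 * p + 2), h j (X / k ^ j % k + k - Y / k ^ j % k) =
        A (digitString k (2 * p + 2) X) (digitString k (2 * p + 2) Y))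
      {R1 : ℕ → ℕ} {τ1 : ℕ} (hF1 : Frame 15 13 (Function.update R' 14 r) R1 M' M')
      (h15 : R1 15 = z) {Q' : Assertion}
      (hQ' : ∀ τ2 R2 M2, τ2 ≤ τ1 + (2 + k * k ^ (2 * p + 1) * 2 +
          (2 * p + 2) * (axisTime k (k ^ (2 * p + 1)) m + 1)) →
        Frame 15 13 (Function.update R' 14 r) R2 M' M2 →
        (∀ X < k * k ^ (2 * p + 1), M2 13 X = (A *ᵥ
          fun b => pathWeight U ψ b * branchTensor d γ U ψ (onDiff φ) r b)
            (digitString k (2 * p + 2) X)) → Q' τ2 R2 M2) :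
      wp B tensorLoad (wp B convProg Q') τ1 R1 M' := by
    have L1 := L0.frame hF1 (by norm_num) (by norm_num)
    refine wp_tensorLoad hB L1.r10 fun τ2 R2 M2 t2 F2 l2 => ?_
    have L2 := L1.frame F2 (by norm_num) (by norm_num)
    have h15' : R2 15 = z := by rw [F2.reg 15 (by norm_num), h15]
    refine wp_convProg L2 hB hN hNB hp h15' fun τ3 R3 M3 t3 F3 l3 => ?_
    refine hQ' _ _ _ (by omega) (hF1.trans ((F2.mono (by norm_num) (by norm_num)).trans
      (F3.mono (by norm_num) (by norm_num)))) fun X hX => ?_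
    rw [l3 X hX, ← axisIter_eq_mulVec hA _ (by rw [hkK]; exact hX), ← hz]
    have hc : ∀ Y < k * k ^ (2 * p + 1), M2 13 Y =
        pathWeight U ψ (digitString k (2 * p + 2) Y) *
          branchTensor d γ U ψ (onDiff φ) r (digitString k (2 * p + 2) Y) := by
      intro Y hY
      rw [l2 Y hY, hF.mem 10 (by norm_num), m10 Y hY, i11 Y hY]
    have key (j : ℕ) : ∀ Y < k * k ^ (2 * p + 1), axisIter k (k ^ (2 * p + 1)) h (M2 13) j Y =
        axisIter k (k ^ (2 * p + 1)) h (fun Y => pathWeight U ψ (digitString k (2 * p + 2) Y) *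
          branchTensor d γ U ψ (onDiff φ) r (digitString k (2 * p + 2) Y)) j Y := by
      induction j with
      | zero => exact hc
      | succ j ih => exact fun Y _ => axisStep_congr hK ih Y
    exact key _ X hX
  simp only [Prog.block, wp, IntOp.eval]
  have u14 : Function.update R' 14 r 14 = r := Function.update_self ..
  rw [u14, L0.r1, L0.r3, L0.r8]
  refine ⟨fun hrp => ⟨by omega, ?_⟩, fun hrp => ⟨by omega, ?_⟩⟩
  -- Register `15` holds `2 * p + 2`, which is no position: the kernel is that of `M`.
  · refine common (2 * p + 2) _ rfl (prod_axisKernel_outside γ φ ξ)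
      ((Frame.refl _ _ _ _).update le_rfl _) (by simp) fun τ2 R2 M2 t2 F2 l2 => ?_
    have L2 := L0.frame F2 (by norm_num) (by norm_num)
    rw [F2.reg 14 (by norm_num), u14, L2.r1]
    refine ⟨fun _ => ?_, fun h => absurd hrp h⟩
    refine wp_branchPower hB L2.r10 fun τ3 R3 M3 t3 F3 l3 l4 => ?_
    refine ⟨?_, fun _ => ⟨fun X hX => ?_, ?_⟩, by omega⟩
    · simp only [roundTime]
      omega
    · rw [l3 X hX, l2 X hX, L2.r2, branchTensor_succ]
    · rw [l4, F2.mem 12 (by norm_num), i12]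
  · obtain rfl : r = p := by omega
    -- In the last round register `15` holds `p`: the kernel is that of `M'`.
    refine common r _ rfl (prod_axisKernel_inside γ φ ξ)
      ((Frame.refl _ _ _ _).update le_rfl _) (by simp) fun τ2 R2 M2 t2 F2 l2 => ?_
    have L2 := L0.frame F2 (by norm_num) (by norm_num)
    rw [F2.reg 14 (by norm_num), u14, L2.r1]
    refine ⟨fun h => absurd h hrp, fun _ => ?_⟩
    refine wp_accumulate hB L2.r3 L2.r10 fun τ3 R3 M3 t3 F3 l3 => ?_
    refine ⟨?_, by omega, fun _ => ?_⟩
    · simp only [roundTime]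
      omega
    · rw [l3, F2.mem 12 (by norm_num), i12, zero_add, ← sum_digitString, hkK]
      refine Finset.sum_congr rfl fun X hX => ?_
      rw [Finset.mem_range] at hX
      rw [l2 X hX, F2.mem 10 (by norm_num), F2.mem 11 (by norm_num), hF.mem 10 (by norm_num),
        m10 X hX, i11 X hX]

end

/-! ### Set-up: integers, constants, angles and roots of unity -/

/-- Register `9` becomes `k ^ (2 * p + 1)`. -/
def powerLoop : Prog := .forLt 40 7 (.intOp .mul 9 9 0)

/-- Register `11` becomes a power of two that is at least `2 * k`, and register `12` its
exponent. -/
def sizeLoop : Prog :=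
  .forLt 40 0 (.ifLt 11 6 (.block [.intOp .mul 11 11 5, .intOp .add 12 12 4]) .skip)

/-- The integers that are used as constants. -/
def setupRegisters : Prog :=
  .block [
    .intConst 3 0,
    .intConst 4 1,
    .intConst 5 2,
    .intOp .mul 6 5 0,
    .intOp .mul 7 5 1,
    .intOp .add 8 7 5,
    .intOp .add 7 7 4,
    .intConst 9 1,
    powerLoop,
    .intOp .mul 10 0 9,
    .intConst 11 1,
    .intConst 12 0,
    sizeLoop,
    .intOp .add 13 1 4]

/-- The complex constants `i`, `iπ` and `1 / N` in array `7`. -/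
def setupConstants : Prog :=
  .block [
    .cpxConst ⟨7, 3⟩ .imag,
    .cpxConst ⟨7, 4⟩ .pi,
    .cpxOp .mul ⟨7, 4⟩ ⟨7, 3⟩ ⟨7, 4⟩,
    .cpxRat ⟨7, 5⟩ 4 11]

/-- The angles of all positions. -/
def angleLoop : Prog :=
  .forLt 40 1 (.block [
    .cpxFun .copy ⟨8, 40⟩ ⟨0, 40⟩,
    .intOp .sub 41 7 40,
    .cpxOp .sub ⟨8, 41⟩ ⟨6, 3⟩ ⟨0, 40⟩])

/-- The roots of unity. -/
def twiddleLoop : Prog :=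
  .forLt 40 11 (.block [
    .intOp .mul 41 5 40,
    .cpxRat ⟨9, 40⟩ 41 11,
    .cpxOp .mul ⟨9, 40⟩ ⟨9, 40⟩ ⟨7, 4⟩,
    .cpxFun .exp ⟨9, 40⟩ ⟨9, 40⟩])

/-- The digits `s` and `s + 1` of a ditstring. -/
def lowDigits : Prog :=
  .block [
    .intOp .div 44 40 41,
    .intOp .mod 44 44 0,
    .intOp .mul 41 41 0,
    .intOp .div 45 40 41,
    .intOp .mod 45 45 0]

/-- The digits `2 * p + 1 - s` and `2 * p - s` of a ditstring. -/
def highDigits : Prog :=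
  .block [
    .intOp .div 46 40 42,
    .intOp .mod 46 46 0,
    .intOp .div 42 42 0,
    .intOp .div 47 40 42,
    .intOp .mod 47 47 0]

/-- The entry of the adjoint of a mixer. -/
def adjointEntry : Prog :=
  .block [
    .intOp .mul 48 43 0,
    .intOp .add 49 48 45,
    .intOp .mul 49 49 0,
    .intOp .add 49 49 44,
    .cpxFun .conj ⟨18, 3⟩ ⟨4, 49⟩]

/-- The entry of a mixer, and the multiplication of the weight by both entries. -/
def multiplyEntries : Prog :=
  .block [
    .intOp .add 49 48 47,
    .intOp .mul 49 49 0,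
    .intOp .add 49 49 46,
    .cpxOp .mul ⟨18, 3⟩ ⟨18, 3⟩ ⟨4, 49⟩,
    .cpxOp .mul ⟨10, 40⟩ ⟨10, 40⟩ ⟨18, 3⟩]

/-- The factors of the weight of a ditstring that come from the mixers. -/
def weightFactors : Prog :=
  .forLt 43 1 (.block [lowDigits, highDigits, adjointEntry, multiplyEntries])

/-- The weight becomes zero unless the two middle digits agree. -/
def weightDiagonal : Prog :=
  .block [
    .intOp .div 44 40 41,
    .intOp .mod 44 44 0,
    .intOp .div 45 40 42,
    .intOp .mod 45 45 0,
    .ifLt 44 45 (.cpxFun .copy ⟨10, 40⟩ ⟨6, 3⟩)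
      (.ifLt 45 44 (.cpxFun .copy ⟨10, 40⟩ ⟨6, 3⟩) .skip)]

/-- The factors of the weight that come from the initial state. -/
def weightEnds : Prog :=
  .block [
    .intOp .mod 44 40 0,
    .cpxFun .conj ⟨18, 3⟩ ⟨3, 44⟩,
    .cpxOp .mul ⟨10, 40⟩ ⟨10, 40⟩ ⟨18, 3⟩,
    .intOp .div 45 40 9,
    .intOp .mod 45 45 0,
    .cpxOp .mul ⟨10, 40⟩ ⟨10, 40⟩ ⟨3, 45⟩]

/-- The weights of all ditstrings. -/
def weightLoop : Prog :=
  .forLt 40 10 (.block [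
    .cpxRat ⟨10, 40⟩ 4 4,
    .intConst 41 1,
    .intOp .add 42 9 3,
    weightFactors,
    weightDiagonal,
    weightEnds])

/-- Array `11` is filled with ones. -/
def onesLoop : Prog := .forLt 40 10 (.cpxRat ⟨11, 40⟩ 4 4)

/-- The whole program. -/
def qaoaProg : Prog :=
  .block [
    setupRegisters,
    setupConstants,
    angleLoop,
    twiddleLoop,
    weightLoop,
    onesLoop,
    .cpxFun .copy ⟨12, 3⟩ ⟨6, 3⟩,
    mainLoop,
    .cpxFun .copy ⟨5, 3⟩ ⟨12, 3⟩]

/-- The integers that are set up at the start. -/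
structure RegistersReady (k p d m : ℕ) (R : ℕ → ℕ) : Prop where
  r0 : R 0 = k
  r1 : R 1 = p
  r2 : R 2 = d
  r3 : R 3 = 0
  r4 : R 4 = 1
  r5 : R 5 = 2
  r7 : R 7 = 2 * p + 1
  r8 : R 8 = 2 * p + 2
  r9 : R 9 = k ^ (2 * p + 1)
  r10 : R 10 = k * k ^ (2 * p + 1)
  r11 : R 11 = 2 ^ m
  r12 : R 12 = m
  r13 : R 13 = p + 1

theorem RegistersReady.frame {k p d m : ℕ} {R R' : ℕ → ℕ} {M M' : ℕ → ℕ → ℂ} {r a : ℕ}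
    (h : RegistersReady k p d m R) (hF : Frame r a R R' M M') (hr : 14 ≤ r) :
    RegistersReady k p d m R' where
  r0 := by rw [hF.reg 0 (by omega), h.r0]
  r1 := by rw [hF.reg 1 (by omega), h.r1]
  r2 := by rw [hF.reg 2 (by omega), h.r2]
  r3 := by rw [hF.reg 3 (by omega), h.r3]
  r4 := by rw [hF.reg 4 (by omega), h.r4]
  r5 := by rw [hF.reg 5 (by omega), h.r5]
  r7 := by rw [hF.reg 7 (by omega), h.r7]
  r8 := by rw [hF.reg 8 (by omega), h.r8]
  r9 := by rw [hF.reg 9 (by omega), h.r9]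
  r10 := by rw [hF.reg 10 (by omega), h.r10]
  r11 := by rw [hF.reg 11 (by omega), h.r11]
  r12 := by rw [hF.reg 12 (by omega), h.r12]
  r13 := by rw [hF.reg 13 (by omega), h.r13]

theorem wp_powerLoop {B k n τ : ℕ} {R : ℕ → ℕ} {M : ℕ → ℕ → ℂ} (hk : 1 ≤ k) (hB : k ^ n ≤ B)
    (hn : n ≤ B) (h0 : R 0 = k) (h7 : R 7 = n) (h9 : R 9 = 1) {Q : Assertion}
    (hQ : ∀ τ' R' M', τ' ≤ τ + (1 + n * 2) → Frame 9 100 R R' M M' → R' 9 = k ^ n → Q τ' R' M') :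
    wp B powerLoop Q τ R M := by
  -- No array is written; `100` exceeds the name of every array in use.
  refine wp_for (r := 9) (a := 100) (T := 1) (by simp [Prog.WritesFrom])
    (fun j R' M' => R' 9 = k ^ j) h7 hn (by simp [h9]) ?_ hQ
  intro j hj τ' R' M' hInv hF
  have f0 := hF.reg 0 (by norm_num)
  have hle : k ^ (j + 1) ≤ k ^ n := Nat.pow_le_pow_right hk hj
  simp only [wp, IntOp.eval, Function.update_apply, f0, h0, hInv]
  norm_num
  rw [← pow_succ]
  exact ⟨by omega, rfl⟩

/-- Doubling happens only below `2 * k`, so the result is at most `4 * k`. The `k` iterations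
suffice because `2 * k ≤ 2 ^ k` for `k ≥ 2`. -/
theorem wp_sizeLoop {B k τ : ℕ} {R : ℕ → ℕ} {M : ℕ → ℕ → ℂ} (hk : 2 ≤ k) (hB : 4 * k ≤ B)
    (h0 : R 0 = k) (h4 : R 4 = 1) (h5 : R 5 = 2) (h6 : R 6 = 2 * k) (h11 : R 11 = 1)
    (h12 : R 12 = 0) {Q : Assertion}
    (hQ : ∀ τ' R' M', τ' ≤ τ + (1 + k * 5) → Frame 11 100 R R' M M' →
      (∃ m, R' 12 = m ∧ R' 11 = 2 ^ m ∧ 2 * k ≤ 2 ^ m ∧ 2 ^ m ≤ 4 * k) → Q τ' R' M') :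
    wp B sizeLoop Q τ R M := by
  refine wp_for (r := 11) (a := 100) (T := 4) (by simp [Prog.WritesFrom, Prog.block])
    (fun j R' M' => R' 11 = 2 ^ R' 12 ∧ R' 11 ≤ 4 * k ∧ (2 * k ≤ R' 11 ∨ R' 12 = j)) h0
    (by omega) ⟨by simp [h11, h12], by omega, Or.inr h12⟩ ?_ ?_
  · rintro j hj τ' R' M' ⟨i1, i2, i3⟩ hF
    have f4 := hF.reg 4 (by norm_num)
    have f5 := hF.reg 5 (by norm_num)
    have f6 := hF.reg 6 (by norm_num)
    have hlt : R' 12 < 2 ^ R' 12 := Nat.lt_two_pow_self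
    simp only [Prog.block, wp, IntOp.eval, Function.update_apply, f4, f5, f6, h4, h5, h6]
    norm_num
    refine ⟨fun h => ⟨by omega, by omega, ?_, by omega, ?_⟩, fun h => ⟨i1, i2, Or.inl h⟩⟩
    · rw [i1, ← pow_succ]
    · omega
  · rintro τ' R' M' ht hF ⟨i1, i2, i3⟩
    refine hQ τ' R' M' ht hF ⟨R' 12, rfl, i1, ?_, by omega⟩
    rcases i3 with h | h
    · omega
    · rw [h]
      clear * - hk
      induction k, hk using Nat.le_induction with
      | base => norm_num
      | succ k hk ih =>
        rw [pow_succ]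
        omega

theorem wp_setupRegisters {B k p d τ : ℕ} {R : ℕ → ℕ} {M : ℕ → ℕ → ℂ} (hk : 2 ≤ k)
    (hB : 4 * (k * k ^ (2 * p + 1)) ≤ B) (hp : 2 * p + 2 ≤ B)
    (h0 : R 0 = k) (h1 : R 1 = p) (h2 : R 2 = d) {Q : Assertion}
    (hQ : ∀ m τ' R' M', 2 * k ≤ 2 ^ m → 2 ^ m ≤ 4 * k → τ' ≤ τ + (20 + 4 * p + 5 * k) →
      Frame 3 100 R R' M M' → RegistersReady k p d m R' → Q τ' R' M') :
    wp B setupRegisters Q τ R M := by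
  have hK : 0 < k ^ (2 * p + 1) := by positivity
  have hkK : k ≤ k * k ^ (2 * p + 1) := Nat.le_mul_of_pos_right k hK
  have hKk : k ^ (2 * p + 1) ≤ k * k ^ (2 * p + 1) := Nat.le_mul_of_pos_left _ (by omega)
  refine wp_mono (wp_frame (r := 3) (a := 100)
    (Q := fun τ' R' M' => ∃ m, 2 * k ≤ 2 ^ m ∧ 2 ^ m ≤ 4 * k ∧ τ' ≤ τ + (20 + 4 * p + 5 * k) ∧
      RegistersReady k p d m R')
    (by simp [Prog.WritesFrom, Prog.block, setupRegisters, powerLoop, sizeLoop]) ?_) ?_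
  · simp only [Prog.block, setupRegisters, wp, IntOp.eval, Function.update_apply]
    norm_num [h0, h1]
    refine ⟨by omega, by omega, by omega, by omega, by omega, by omega, by omega, ?_⟩
    refine wp_powerLoop (k := k) (n := 2 * p + 1) (by omega) (by omega) (by omega)
      (by simp [h0]) (by simp)
      (by simp) fun τ1 R1 M1 t1 F1 l1 => ?_
    have f0 := F1.reg 0 (by norm_num)
    have f1 := F1.reg 1 (by norm_num)
    have f2 := F1.reg 2 (by norm_num)
    have f3 := F1.reg 3 (by norm_num)
    have f4 := F1.reg 4 (by norm_num)
    have f5 := F1.reg 5 (by norm_num)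
    have f6 := F1.reg 6 (by norm_num)
    have f7 := F1.reg 7 (by norm_num)
    have f8 := F1.reg 8 (by norm_num)
    simp [h0, h1, h2] at f0 f1 f2 f3 f4 f5 f6 f7 f8
    rw [f0, l1]
    refine ⟨by omega, by omega, ?_⟩
    refine wp_sizeLoop hk (by omega)
      (by simp [f0]) (by simp [f4])
      (by simp [f5]) (by simp [f6])
      (by simp)
      (by simp) fun τ2 R2 M2 t2 F2 l2 => ?_
    obtain ⟨m, e12, e11, e1, e2⟩ := l2
    have g0 := F2.reg 0 (by norm_num)
    have g1 := F2.reg 1 (by norm_num)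
    have g2 := F2.reg 2 (by norm_num)
    have g3 := F2.reg 3 (by norm_num)
    have g4 := F2.reg 4 (by norm_num)
    have g5 := F2.reg 5 (by norm_num)
    have g7 := F2.reg 7 (by norm_num)
    have g8 := F2.reg 8 (by norm_num)
    have g9 := F2.reg 9 (by norm_num)
    have g10 := F2.reg 10 (by norm_num)
    simp [f0, f1, f2, f3, f4, f5, f7, f8, l1]
      at g0 g1 g2 g3 g4 g5 g7 g8 g9 g10
    rw [g1, g4]
    refine ⟨by omega, m, e1, e2, by omega, ?_⟩
    constructor <;> simp [*]
  · rintro τ' R' M' ⟨⟨m, e1, e2, ht, hR⟩, hF⟩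
    exact hQ m τ' R' M' e1 e2 ht hF hR

theorem wp_setupConstants {B k p d m τ : ℕ} {R : ℕ → ℕ} {M : ℕ → ℕ → ℂ}
    (hR : RegistersReady k p d m R) {Q : Assertion}
    (hQ : ∀ τ' R' M', τ' ≤ τ + 5 → Frame 100 7 R R' M M' → M' 7 0 = Complex.I →
      M' 7 1 = Complex.I * Real.pi → M' 7 2 = 1 / (2 ^ m : ℕ) → (∀ A, A ≠ 7 → M' A = M A) →
      Q τ' R' M') :
    wp B setupConstants Q τ R M := by
  simp only [setupConstants, Prog.block, wp, CpxOp.eval, CpxConst.eval, hR.r3, hR.r4, hR.r5,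
    hR.r11]
  refine hQ _ _ _ (by omega) ?_ ?_ ?_ ?_ ?_
  · exact ((((Frame.refl _ _ _ _).writeCell le_rfl _ _).writeCell le_rfl _ _).writeCell
      le_rfl _ _).writeCell le_rfl _ _
  · simp [writeCell_apply]
  · simp [writeCell_apply]
  · simp [writeCell_apply]
  · intro A hA
    funext x
    simp [writeCell_apply, hA]

theorem wp_onesLoop {B n τ : ℕ} {R : ℕ → ℕ} {M : ℕ → ℕ → ℂ} (hB : n ≤ B) (h4 : R 4 = 1)
    (h10 : R 10 = n) {Q : Assertion}
    (hQ : ∀ τ' R' M', τ' ≤ τ + (1 + n * 2) → Frame 40 11 R R' M M' →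
      (∀ i < n, M' 11 i = 1) → Q τ' R' M') :
    wp B onesLoop Q τ R M := by
  refine wp_for (r := 40) (a := 11) (T := 1) (by simp [Prog.WritesFrom])
    (fun j R' M' => ∀ i < j, M' 11 i = 1) h10 hB (by simp) ?_ hQ
  rintro j hj τ' R' M' hInv hF
  have f4 := hF.reg 4 (by norm_num)
  simp only [wp, Function.update_apply, f4, h4]
  norm_num
  intro i hi
  rw [writeCell_apply, if_pos rfl]
  split_ifs with h
  · rfl
  · exact hInv i (by omega)

theorem wp_twiddleLoop {B m τ : ℕ} {R : ℕ → ℕ} {M : ℕ → ℕ → ℂ} (hB : 2 * 2 ^ m ≤ B) (h4 : R 4 = 1)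
    (h5 : R 5 = 2) (h11 : R 11 = 2 ^ m) (m7 : M 7 1 = Complex.I * Real.pi) {Q : Assertion}
    (hQ : ∀ τ' R' M', τ' ≤ τ + (1 + 2 ^ m * 6) → Frame 40 9 R R' M M' →
      (∀ i < 2 ^ m, M' 9 i = rootPow (2 ^ m) i) → (∀ A, A ≠ 9 → M' A = M A) → Q τ' R' M') :
    wp B twiddleLoop Q τ R M := by
  refine wp_for (r := 40) (a := 9) (T := 5) (by simp [Prog.WritesFrom, Prog.block])
    (fun j R' M' => (∀ i < j, M' 9 i = rootPow (2 ^ m) i) ∧ (∀ A, A ≠ 9 → M' A = M A)) h11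
    (by omega) (by simp) ?_
    (fun τ' R' M' h1 h2 h3 => hQ τ' R' M' h1 h2 h3.1 h3.2)
  rintro j hj τ' R' M' ⟨hInv, hA⟩ hF
  have f4 := hF.reg 4 (by norm_num)
  have f5 := hF.reg 5 (by norm_num)
  have f11 := hF.reg 11 (by norm_num)
  have hexp : Complex.exp (((2 * j : ℕ) : ℂ) / ((2 ^ m : ℕ) : ℂ) * (Complex.I * Real.pi)) =
      rootPow (2 ^ m) j := by
    rw [rootPow]
    congr 1
    push_cast
    ring
  simp only [Prog.block, wp, IntOp.eval, CpxOp.eval, CpxFun.eval, Function.update_apply, f4, f5,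
    f11, h4, h5, h11, writeCell_apply, hA 7 (by norm_num)]
  simp only [if_true, if_neg (by norm_num : ¬ (40 : ℕ) = 41), if_neg (by norm_num : ¬ (11 : ℕ) = 41),
    if_neg (by norm_num : ¬ (11 : ℕ) = 40), if_neg (by norm_num : ¬ (4 : ℕ) = 41),
    if_neg (by norm_num : ¬ (4 : ℕ) = 40), if_neg (by norm_num : ¬ (5 : ℕ) = 40),
    if_neg (by norm_num : ¬ (7 : ℕ) = 9)]
  refine ⟨by omega, by omega, fun i hi => ?_, fun A h => ?_⟩
  · split_ifs with h
    · rw [h, m7, hexp]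
    · exact hInv i (by omega)
  · funext x
    simp [writeCell_apply, h, hA A h]

section

variable {k p : ℕ} [NeZero k] {γ : Fin p → ℝ}

/-- Iteration `t` writes the positions `t` and `2p + 1 - t`. The two middle positions are never
written and keep their initial zero, the correct angle there. -/
theorem wp_angleLoop {B d m τ : ℕ} {R : ℕ → ℕ} {M : ℕ → ℕ → ℂ} (hB : 2 * p + 2 ≤ B)
    (hR : RegistersReady k p d m R) (m0 : ∀ t : Fin p, M 0 t = (γ t : ℂ)) (m6 : M 6 0 = 0)
    (m8 : ∀ x, M 8 x = 0) {Q : Assertion}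
    (hQ : ∀ τ' R' M', τ' ≤ τ + (1 + p * 5) → Frame 40 8 R R' M M' →
      (∀ j < 2 * p + 2, M' 8 j = (positionAngle γ j : ℂ)) → (∀ A, A ≠ 8 → M' A = M A) →
      Q τ' R' M') :
    wp B angleLoop Q τ R M := by
  refine wp_for (r := 40) (a := 8) (T := 4) (by simp [Prog.WritesFrom, Prog.block])
    (fun t R' M' => (∀ j, M' 8 j = if j < t ∨ (2 * p + 1 < j + t ∧ j ≤ 2 * p + 1) then
      (positionAngle γ j : ℂ) else 0) ∧ (∀ A, A ≠ 8 → M' A = M A)) hR.r1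
    (by omega) ⟨fun j => ?_, fun _ _ => rfl⟩ ?_ ?_
  · rw [m8, if_neg (by omega)]
  · rintro t ht τ' R' M' ⟨hInv, hA⟩ hF
    have f3 := hF.reg 3 (by norm_num)
    have f7 := hF.reg 7 (by norm_num)
    have e1 : positionAngle γ t = γ ⟨t, ht⟩ := dif_pos ht
    have e2 : positionAngle γ (2 * p + 1 - t) = -γ ⟨t, ht⟩ := by
      rw [positionAngle, dif_neg (by omega), dif_pos (by omega)]
      congr 2
      exact Fin.ext (by simp only; omega)
    have e3 : M 0 t = (γ ⟨t, ht⟩ : ℂ) := m0 ⟨t, ht⟩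
    simp only [Prog.block, wp, IntOp.eval, CpxOp.eval, CpxFun.eval, Function.update_apply, f3, f7,
      hR.r3, hR.r7, writeCell_apply, hA 0 (by norm_num), hA 6 (by norm_num)]
    norm_num
    refine ⟨by omega, fun j => ?_, fun A h => ?_⟩
    · rw [m6, e3]
      by_cases h1 : j = 2 * p + 1 - t
      · rw [if_pos h1, if_pos (by omega), h1, e2]
        push_cast
        ring
      · rw [if_neg h1]
        by_cases h2 : j = t
        · rw [if_pos h2, if_pos (by omega), h2, e1]
        · rw [if_neg h2, hInv j]
          refine if_congr ?_ rfl rfl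
          omega
    · funext x
      simp [writeCell_apply, h, hA A h]
  · rintro τ' R' M' ht hF ⟨h1, h2⟩
    refine hQ τ' R' M' ht hF (fun j hj => ?_) h2
    rw [h1]
    split_ifs with h
    · rfl
    · rw [positionAngle, dif_neg (by omega), dif_neg (by omega)]
      simp

end

/-! ### The weights of the ditstrings -/

/-- The factor of the weight of the ditstring with index `X` that comes from mixer `s + 1`; the
entries of the mixers are the values of `u`. -/
def mixFactor (k p : ℕ) (u : ℕ → ℂ) (X s : ℕ) : ℂ :=
  star (u ((s * k + X / k ^ (s + 1) % k) * k + X / k ^ s % k)) *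
    u ((s * k + X / k ^ (2 * p + 1 - (s + 1)) % k) * k + X / k ^ (2 * p + 1 - s) % k)

theorem wp_lowDigits {B k X y τ : ℕ} {R : ℕ → ℕ} {M : ℕ → ℕ → ℂ} (hX : X ≤ B) (hy : y * k ≤ B)
    (h0 : R 0 = k) (h40 : R 40 = X) (h41 : R 41 = y) {Q : Assertion}
    (hQ : ∀ R', (∀ x, x ≠ 41 → x ≠ 44 → x ≠ 45 → R' x = R x) → R' 41 = y * k →
      R' 44 = X / y % k → R' 45 = X / (y * k) % k → Q (τ + 6) R' M) :
    wp B lowDigits Q τ R M := by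
  have d1 := Nat.div_le_self X y
  have d2 := Nat.div_le_self X (y * k)
  have e1 := Nat.mod_le (X / y) k
  have e2 := Nat.mod_le (X / (y * k)) k
  simp only [lowDigits, Prog.block, wp, IntOp.eval, Function.update_apply]
  norm_num [h0, h40, h41]
  refine ⟨by omega, by omega, by omega, by omega, by omega, hQ _ (fun x h1 h2 h3 => ?_) ?_ ?_ ?_⟩
  · simp [h1, h2, h3]
  all_goals simp

theorem wp_highDigits {B k X y τ : ℕ} {R : ℕ → ℕ} {M : ℕ → ℕ → ℂ} (hX : X ≤ B) (hy : y / k ≤ B)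
    (h0 : R 0 = k) (h40 : R 40 = X) (h42 : R 42 = y) {Q : Assertion}
    (hQ : ∀ R', (∀ x, x ≠ 42 → x ≠ 46 → x ≠ 47 → R' x = R x) → R' 42 = y / k →
      R' 46 = X / y % k → R' 47 = X / (y / k) % k → Q (τ + 6) R' M) :
    wp B highDigits Q τ R M := by
  have d1 := Nat.div_le_self X y
  have d2 := Nat.div_le_self X (y / k)
  have e1 := Nat.mod_le (X / y) k
  have e2 := Nat.mod_le (X / (y / k)) k
  simp only [highDigits, Prog.block, wp, IntOp.eval, Function.update_apply]
  norm_num [h0, h40, h42]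
  refine ⟨by omega, by omega, by omega, by omega, by omega, hQ _ (fun x h1 h2 h3 => ?_) ?_ ?_ ?_⟩
  · simp [h1, h2, h3]
  all_goals simp

theorem wp_adjointEntry {B k s i j τ : ℕ} {R : ℕ → ℕ} {M : ℕ → ℕ → ℂ} (hk : 1 ≤ k)
    (hB : (s * k + i) * k + j ≤ B) (h0 : R 0 = k) (h3 : R 3 = 0) (h43 : R 43 = s)
    (h45 : R 45 = i) (h44 : R 44 = j) {Q : Assertion}
    (hQ : ∀ R' M', (∀ x, x ≠ 48 → x ≠ 49 → R' x = R x) → R' 48 = s * k →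
      (∀ A, A ≠ 18 → M' A = M A) → M' 18 0 = star (M 4 ((s * k + i) * k + j)) →
      Q (τ + 6) R' M') :
    wp B adjointEntry Q τ R M := by
  have h : s * k + i ≤ (s * k + i) * k := Nat.le_mul_of_pos_right _ hk
  simp only [adjointEntry, Prog.block, wp, IntOp.eval, CpxFun.eval, Function.update_apply]
  norm_num [h0, h3, h43, h44, h45]
  refine ⟨by omega, by omega, by omega, by omega, hQ _ _ (fun x h1 h2 => ?_) ?_ (fun A hA => ?_) ?_⟩
  · simp [h1, h2]
  · simp
  · funext x
    simp [writeCell_apply, hA]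
  · simp [writeCell_apply]

theorem wp_multiplyEntries {B k s i j X τ : ℕ} {R : ℕ → ℕ} {M : ℕ → ℕ → ℂ} (hk : 1 ≤ k)
    (hB : (s * k + i) * k + j ≤ B) (h0 : R 0 = k) (h3 : R 3 = 0) (h40 : R 40 = X)
    (h48 : R 48 = s * k) (h47 : R 47 = i) (h46 : R 46 = j) {Q : Assertion}
    (hQ : ∀ R' M', (∀ x, x ≠ 49 → R' x = R x) →
      M' 10 X = M 10 X * (M 18 0 * M 4 ((s * k + i) * k + j)) →
      (∀ Y, Y ≠ X → M' 10 Y = M 10 Y) → Q (τ + 6) R' M') :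
    wp B multiplyEntries Q τ R M := by
  have h : s * k + i ≤ (s * k + i) * k := Nat.le_mul_of_pos_right _ hk
  simp only [multiplyEntries, Prog.block, wp, IntOp.eval, CpxOp.eval, Function.update_apply]
  norm_num [h0, h3, h40, h46, h47, h48]
  refine ⟨by omega, by omega, by omega, hQ _ _ (fun x h1 => ?_) ?_ (fun Y hY => ?_)⟩
  · simp [h1]
  · simp [writeCell_apply]
  · simp [writeCell_apply, hY]

/-- Registers `41` and `42` carry the divisors `k ^ s` and `k ^ (2p + 1 - s)` from one mixer to the
next, so no power is recomputed. The bound on `p * k * k` covers the addresses of the mixer entries.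
-/
theorem wp_weightFactors {B k p X τ : ℕ} {R : ℕ → ℕ} {M : ℕ → ℕ → ℂ} (hk : 1 ≤ k)
    (hB : k * k ^ (2 * p + 1) ≤ B) (hpB : p * k * k ≤ B) (hX : X < k * k ^ (2 * p + 1))
    (h0 : R 0 = k) (h1 : R 1 = p) (h3 : R 3 = 0) (h40 : R 40 = X) (h41 : R 41 = 1)
    (h42 : R 42 = k ^ (2 * p + 1)) {Q : Assertion}
    (hQ : ∀ τ' R' M', τ' ≤ τ + (1 + p * 26) → Frame 41 10 R R' M M' →
      R' 41 = k ^ p → R' 42 = k ^ (p + 1) →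
      M' 10 X = M 10 X * ∏ s ∈ Finset.range p, mixFactor k p (M 4) X s →
      (∀ Y, Y ≠ X → M' 10 Y = M 10 Y) → Q τ' R' M') :
    wp B weightFactors Q τ R M := by
  have hp : p ≤ B := by
    have h1 : p * 1 ≤ p * k := Nat.mul_le_mul_left p hk
    have h2 : p * k * 1 ≤ p * k * k := Nat.mul_le_mul_left _ hk
    omega
  refine wp_for (r := 41) (a := 10) (T := 25) (by simp [Prog.WritesFrom, Prog.block, lowDigits,
      highDigits, adjointEntry, multiplyEntries])
    (fun s R' M' => R' 41 = k ^ s ∧ R' 42 = k ^ (2 * p + 1 - s) ∧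
      M' 10 X = M 10 X * ∏ s ∈ Finset.range s, mixFactor k p (M 4) X s ∧
      (∀ Y, Y ≠ X → M' 10 Y = M 10 Y)) h1 hp
    ⟨by simpa using h41, by simpa using h42, by simp, fun _ _ => rfl⟩ ?_ ?_
  · rintro s hs τ' R' M' ⟨i41, i42, i10, iY⟩ hF
    have f0 := hF.reg 0 (by norm_num)
    have f3 := hF.reg 3 (by norm_num)
    have f40 := hF.reg 40 (by norm_num)
    have f4 := hF.mem 4 (by norm_num)
    have hdiv : k ^ (2 * p + 1 - s) / k = k ^ (2 * p + 1 - (s + 1)) := by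
      rw [show 2 * p + 1 - s = (2 * p + 1 - (s + 1)) + 1 by omega, pow_succ,
        Nat.mul_div_cancel _ (by omega)]
    have hpow : k ^ s * k ≤ B := by
      refine le_trans ?_ hB
      rw [← pow_succ', ← pow_succ]
      exact Nat.pow_le_pow_right hk (by omega)
    have hpow' : k ^ (2 * p + 1 - s) / k ≤ B := by
      refine le_trans ?_ hB
      rw [hdiv, ← pow_succ']
      exact Nat.pow_le_pow_right hk (by omega)
    have hidx (x y : ℕ) : (s * k + x % k) * k + y % k ≤ B := by
      have h1 : s * k + x % k + 1 ≤ p * k := by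
        have := Nat.mod_lt x hk
        have h2 := Nat.mul_le_mul_right k hs
        rw [Nat.succ_mul] at h2
        omega
      have h3 := Nat.mul_le_mul_right k h1
      rw [Nat.succ_mul] at h3
      have := Nat.mod_lt y hk
      omega
    refine wp_lowDigits (k := k) (X := X) (y := k ^ s) (by omega) hpow (by simp [f0, h0])
      (by simp [f40, h40]) (by simp [i41]) fun R1 F1 a41 a44 a45 => ?_
    refine wp_highDigits (k := k) (X := X) (y := k ^ (2 * p + 1 - s)) (by omega) hpow'
      (by simp [F1, f0, h0]) (by simp [F1, f40, h40]) (by simp [F1, i42])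
      fun R2 F2 a42 a46 a47 => ?_
    refine wp_adjointEntry (k := k) (s := s) (i := X / (k ^ s * k) % k) (j := X / k ^ s % k) hk
      (hidx _ _) (by simp [F2, F1, f0, h0]) (by simp [F2, F1, f3, h3]) (by simp [F2, F1])
      (by simp [F2, a45]) (by simp [F2, a44]) fun R3 M3 F3 a48 g3 g18 => ?_
    refine wp_multiplyEntries (k := k) (s := s) (i := X / (k ^ (2 * p + 1 - s) / k) % k)
      (j := X / k ^ (2 * p + 1 - s) % k) (X := X) hk (hidx _ _) (by simp [F3, F2, F1, f0, h0])
      (by simp [F3, F2, F1, f3, h3]) (by simp [F3, F2, F1, f40, h40]) a48 (by simp [F3, a47])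
      (by simp [F3, a46]) fun R4 M4 F4 g10 gY => ?_
    refine ⟨by omega, ?_, ?_, ?_, fun Y hY => ?_⟩
    · simp [F4, F3, F2, a41, pow_succ]
    · simp [F4, F3, a42, hdiv]
    · rw [g10, g18, g3 10 (by norm_num), g3 4 (by norm_num), i10, f4, Finset.prod_range_succ,
        hdiv, ← pow_succ, mul_assoc]
      rfl
    · rw [gY Y hY, g3 10 (by norm_num), iY Y hY]
  · rintro τ' R' M' ht hF ⟨h1, h2, h3, h4⟩
    exact hQ τ' R' M' ht hF h1 (by rw [h2]; congr 1; omega) h3 h4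

/-- Applied with `y = k ^ p` and `z = k ^ (p + 1)`, the divisors that `weightFactors` leaves behind,
this is the indicator in `f`. -/
theorem wp_weightDiagonal {B k X y z τ : ℕ} {R : ℕ → ℕ} {M : ℕ → ℕ → ℂ} (hX : X ≤ B)
    (h0 : R 0 = k) (h3 : R 3 = 0) (h40 : R 40 = X) (h41 : R 41 = y) (h42 : R 42 = z)
    (m6 : M 6 0 = 0) {Q : Assertion}
    (hQ : ∀ τ' R' M', τ' ≤ τ + 8 → Frame 41 10 R R' M M' →
      M' 10 X = (if X / y % k = X / z % k then M 10 X else 0) →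
      (∀ Y, Y ≠ X → M' 10 Y = M 10 Y) → Q τ' R' M') :
    wp B weightDiagonal Q τ R M := by
  refine wp_mono (wp_frame (r := 41) (a := 10)
    (Q := fun τ' R' M' => τ' ≤ τ + 8 ∧
      M' 10 X = (if X / y % k = X / z % k then M 10 X else 0) ∧
      (∀ Y, Y ≠ X → M' 10 Y = M 10 Y))
    (by simp [Prog.WritesFrom, Prog.block, weightDiagonal]) ?_)
    fun τ' R' M' h => hQ τ' R' M' h.1.1 h.2 h.1.2.1 h.1.2.2
  have d1 := Nat.div_le_self X y
  have d2 := Nat.div_le_self X z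
  have e1 := Nat.mod_le (X / y) k
  have e2 := Nat.mod_le (X / z) k
  simp only [weightDiagonal, Prog.block, wp, IntOp.eval, CpxFun.eval, Function.update_apply]
  norm_num [h0, h3, h40, h41, h42]
  refine ⟨by omega, by omega, by omega, by omega, fun h => ?_, fun h => ⟨fun h' => ?_, fun h' => ?_⟩⟩
  · rw [if_neg (by omega)]
    simp +contextual [writeCell_apply, m6]
  · rw [if_neg (by omega)]
    simp +contextual [writeCell_apply, m6]
  · exact fun hne => absurd (by omega) hne

theorem wp_weightEnds {B k X z τ : ℕ} {R : ℕ → ℕ} {M : ℕ → ℕ → ℂ} (hX : X ≤ B)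
    (h0 : R 0 = k) (h3 : R 3 = 0) (h9 : R 9 = z) (h40 : R 40 = X) {Q : Assertion}
    (hQ : ∀ τ' R' M', τ' ≤ τ + 7 →
      M' 10 X = M 10 X * star (M 3 (X % k)) * M 3 (X / z % k) →
      (∀ Y, Y ≠ X → M' 10 Y = M 10 Y) → Q τ' R' M') :
    wp B weightEnds Q τ R M := by
  have d1 := Nat.div_le_self X z
  have e1 := Nat.mod_le (X / z) k
  have e2 := Nat.mod_le X k
  simp only [weightEnds, Prog.block, wp, IntOp.eval, CpxFun.eval, CpxOp.eval,
    Function.update_apply]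
  norm_num [h0, h3, h9, h40]
  refine ⟨by omega, by omega, by omega, hQ _ _ _ (by omega) ?_ fun Y hY => ?_⟩
  · simp [writeCell_apply]
  · simp [writeCell_apply, hY]

section

variable {k p : ℕ} [NeZero k] {U : Fin p → Matrix (ZMod k) (ZMod k) ℂ} {ψ : ZMod k → ℂ}

theorem natCast_digit_inj {x y : ℕ} (hx : x < k) (hy : y < k) :
    ((x : ZMod k) = (y : ZMod k)) ↔ x = y := by
  constructor
  · intro h
    have := congrArg ZMod.val h
    rwa [ZMod.val_natCast_of_lt hx, ZMod.val_natCast_of_lt hy] at this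
  · rintro rfl
    rfl

theorem pathWeight_digitString {u v : ℕ → ℂ}
    (hu : ∀ (t : Fin p) (i j : ℕ), i < k → j < k →
      u ((t * k + i) * k + j) = U t (i : ZMod k) (j : ZMod k))
    (hv : ∀ i < k, v i = ψ (i : ZMod k)) (X : ℕ) :
    pathWeight U ψ (digitString k (2 * p + 2) X) =
      (if X / k ^ p % k = X / k ^ (p + 1) % k then ∏ s ∈ Finset.range p, mixFactor k p u X s
        else 0) * star (v (X % k)) * v (X / k ^ (2 * p + 1) % k) := by
  have hk : 0 < k := NeZero.pos k
  have hlast : digitString k (2 * p + 2) X (posIdx (Fin.last p)) =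
      digitString k (2 * p + 2) X (negIdx (Fin.last p)) ↔
      X / k ^ p % k = X / k ^ (p + 1) % k := by
    rw [← natCast_digit_inj (Nat.mod_lt _ hk) (Nat.mod_lt _ hk)]
    simp only [digitString, posIdx, negIdx, Fin.val_last]
    rw [show 2 * p + 1 - p = p + 1 by omega]
  have h0 : digitString k (2 * p + 2) X (posIdx 0) = ((X % k : ℕ) : ZMod k) := by
    simp [digitString, posIdx]
  have h1 : digitString k (2 * p + 2) X (negIdx 0) =
      ((X / k ^ (2 * p + 1) % k : ℕ) : ZMod k) := by
    simp [digitString, negIdx]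
  have h2 : ∏ s ∈ Finset.range p, mixFactor k p u X s = ∏ t : Fin p,
      ((U t)ᴴ (digitString k (2 * p + 2) X (posIdx t.castSucc))
        (digitString k (2 * p + 2) X (posIdx t.succ)) *
      U t (digitString k (2 * p + 2) X (negIdx t.succ))
        (digitString k (2 * p + 2) X (negIdx t.castSucc))) := by
    rw [← Fin.prod_univ_eq_prod_range]
    refine Finset.prod_congr rfl fun t _ => ?_
    rw [mixFactor, hu t _ _ (Nat.mod_lt _ hk) (Nat.mod_lt _ hk),
      hu t _ _ (Nat.mod_lt _ hk) (Nat.mod_lt _ hk), Matrix.conjTranspose_apply]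
    rfl
  rw [pathWeight, h0, h1, hv _ (Nat.mod_lt _ hk), hv _ (Nat.mod_lt _ hk), h2]
  simp only [hlast]
  split_ifs <;> simp

theorem wp_weightLoop {B d m τ : ℕ} {R : ℕ → ℕ} {M : ℕ → ℕ → ℂ}
    (hB : k * k ^ (2 * p + 1) ≤ B) (hpB : p * k * k ≤ B) (hR : RegistersReady k p d m R)
    (hu : ∀ (t : Fin p) (i j : ℕ), i < k → j < k →
      M 4 ((t * k + i) * k + j) = U t (i : ZMod k) (j : ZMod k))
    (hv : ∀ i < k, M 3 i = ψ (i : ZMod k)) (m6 : M 6 0 = 0) {Q : Assertion}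
    (hQ : ∀ τ' R' M', τ' ≤ τ + (1 + k * k ^ (2 * p + 1) * (p * 26 + 22)) → Frame 40 10 R R' M M' →
      (∀ X < k * k ^ (2 * p + 1), M' 10 X = pathWeight U ψ (digitString k (2 * p + 2) X)) →
      Q τ' R' M') :
    wp B weightLoop Q τ R M := by
  have hk : 1 ≤ k := NeZero.one_le
  have hkK : k ≤ k * k ^ (2 * p + 1) := Nat.le_mul_of_pos_right k (by positivity)
  have hKk : k ^ (2 * p + 1) ≤ k * k ^ (2 * p + 1) := Nat.le_mul_of_pos_left _ hk
  refine wp_for (r := 40) (a := 10) (T := p * 26 + 21)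
    (by simp [Prog.WritesFrom, Prog.block, weightFactors, lowDigits, highDigits, adjointEntry,
      multiplyEntries, weightDiagonal, weightEnds])
    (fun j R' M' => ∀ X < j, M' 10 X = pathWeight U ψ (digitString k (2 * p + 2) X))
    hR.r10 hB (by simp) ?_ hQ
  rintro X hX τ' R' M' hInv hF
  have f0 := (hF.reg 0 (by norm_num)).trans hR.r0
  have f1 := (hF.reg 1 (by norm_num)).trans hR.r1
  have f3 := (hF.reg 3 (by norm_num)).trans hR.r3
  have f4 := (hF.reg 4 (by norm_num)).trans hR.r4
  have f9 := (hF.reg 9 (by norm_num)).trans hR.r9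
  have hF' (x : ℂ) : Frame 40 10 R R' M (writeCell M' 10 X x) := hF.writeCell le_rfl _ _
  simp only [Prog.block, wp, IntOp.eval, Function.update_apply]
  norm_num [f9, f3, f4]
  refine ⟨by omega, by omega, ?_⟩
  refine wp_weightFactors (k := k) (p := p) (X := X) hk hB hpB hX (by simp [f0]) (by simp [f1])
    (by simp [f3]) (by simp) (by simp) (by simp) fun τ1 R1 M1 t1 F1 a41 a42 g10 gY => ?_
  have q0 : R1 0 = k := by rw [F1.reg 0 (by norm_num)]; simp [f0]
  have q3 : R1 3 = 0 := by rw [F1.reg 3 (by norm_num)]; simp [f3]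
  have q9 : R1 9 = k ^ (2 * p + 1) := by rw [F1.reg 9 (by norm_num)]; simp [f9]
  have q40 : R1 40 = X := by rw [F1.reg 40 (by norm_num)]; simp
  have p3 : M1 3 = M 3 := by rw [F1.mem 3 (by norm_num), (hF' _).mem 3 (by norm_num)]
  have p6 : M1 6 = M 6 := by rw [F1.mem 6 (by norm_num), (hF' _).mem 6 (by norm_num)]
  rw [(hF' _).mem 4 (by norm_num)] at g10
  refine wp_weightDiagonal (k := k) (X := X) (by omega) q0 q3 q40 a41 a42 (by rw [p6, m6])
    fun τ2 R2 M2 t2 F2 g2 gY2 => ?_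
  refine wp_weightEnds (k := k) (X := X) (z := k ^ (2 * p + 1)) (by omega)
    (by rw [F2.reg 0 (by norm_num), q0]) (by rw [F2.reg 3 (by norm_num), q3])
    (by rw [F2.reg 9 (by norm_num), q9]) (by rw [F2.reg 40 (by norm_num), q40])
    fun τ3 R3 M3 t3 g3 gY3 => ⟨by omega, fun Y hY => ?_⟩
  by_cases h : Y = X
  · subst h
    rw [g3, g2, g10, F2.mem 3 (by norm_num), p3, pathWeight_digitString hu hv]
    simp [writeCell_apply]
  · rw [gY3 Y h, gY2 Y h, gY Y h, writeCell_apply, if_pos rfl, if_neg h, hInv Y (by omega)]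

end

/-! ### Resources and correctness of the whole program -/

/-- The number of steps of the whole program. -/
def runTime (k p m : ℕ) : ℕ :=
  40 + 9 * p + 5 * k + 6 * 2 ^ m + k * k ^ (2 * p + 1) * (p * 26 + 24) +
    (p + 1) * (roundTime k p m + 1)

/-- The dominant term comes from `p + 1` rounds, `2 * p + 2` axes, `k ^ (2 * p + 1)` lines and O(m
2^m) steps per line, where `2 ^ m ≤ 4 * k`. The weights cost only O(p) steps per ditstring. The
constants are generous. -/
theorem runTime_le {k p m : ℕ} (hk : 1 ≤ k) (hp : 1 ≤ p) (hm : 1 ≤ m) (hT : 2 ^ m ≤ 4 * k) :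
    runTime k p m ≤ 6000 * (p ^ 2 * (k * k ^ (2 * p + 1)) * m) := by
  have hline : lineTime m + 1 ≤ 356 * (m * k) := by
    have h1 : m * 2 ^ m ≤ m * (4 * k) := Nat.mul_le_mul_left m hT
    have h2 : k ≤ m * k := Nat.le_mul_of_pos_left k hm
    have h3 : m ≤ m * k := Nat.le_mul_of_pos_right m hk
    have h4 : lineTime m = 30 + 20 * m + 26 * (m * 2 ^ m) + 12 * 2 ^ m := by
      rw [lineTime]
      ring
    linarith
  have hK : 1 ≤ k ^ (2 * p + 1) := Nat.one_le_pow _ _ hk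
  have hkn : k ≤ k * k ^ (2 * p + 1) := Nat.le_mul_of_pos_right k hK
  have haxis : axisTime k (k ^ (2 * p + 1)) m + 1 ≤ 600 * (m * (k * k ^ (2 * p + 1))) := by
    rw [axisTime]
    generalize k ^ (2 * p + 1) = K at *
    have h1 : m * 2 ^ m ≤ m * (4 * k) := Nat.mul_le_mul_left m hT
    have h2 : k * K ≤ m * (k * K) := Nat.le_mul_of_pos_left _ hm
    have h3 : m * 1 ≤ m * (k * K) := Nat.mul_le_mul_left m (by omega)
    have h4 : m * k ≤ m * (k * K) := Nat.mul_le_mul_left m hkn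
    have h5 : K * (lineTime m + 1) ≤ K * (356 * (m * k)) := Nat.mul_le_mul_left K hline
    have h6 : K * (356 * (m * k)) = 356 * (m * (k * K)) := by ring
    have h7 : m * (10 + 2 ^ m * 13) = 10 * m + 13 * (m * 2 ^ m) := by ring
    linarith
  rw [runTime, roundTime]
  generalize axisTime k (k ^ (2 * p + 1)) m = A at *
  generalize k * k ^ (2 * p + 1) = n at *
  have hround : 20 + n * 7 + (2 * p + 2) * (A + 1) + 1 ≤ 2440 * (p * (n * m)) := by
    have h1 : (2 * p + 2) * (A + 1) ≤ (4 * p) * (600 * (m * n)) :=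
      Nat.mul_le_mul (by omega) haxis
    have h2 : (4 * p) * (600 * (m * n)) = 2400 * (p * (n * m)) := by ring
    have h3 : n ≤ n * m := Nat.le_mul_of_pos_right n hm
    have h4 : n * m ≤ p * (n * m) := Nat.le_mul_of_pos_left _ hp
    omega
  have h1 : (p + 1) * (20 + n * 7 + (2 * p + 2) * (A + 1) + 1) ≤
      (2 * p) * (2440 * (p * (n * m))) := Nat.mul_le_mul (by omega) hround
  have h2 : (2 * p) * (2440 * (p * (n * m))) = 4880 * (p ^ 2 * n * m) := by ring
  have h3 : p ≤ p ^ 2 := Nat.le_self_pow (by norm_num) p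
  have h4 : p ^ 2 * n ≤ p ^ 2 * n * m := Nat.le_mul_of_pos_right _ hm
  have h5 : p * n ≤ p ^ 2 * n := Nat.mul_le_mul_right n h3
  have h6 : n ≤ p * n := Nat.le_mul_of_pos_left n hp
  have h7 : p ≤ p * n := Nat.le_mul_of_pos_right p (by omega)
  have h8 : n * (p * 26 + 24) = 26 * (p * n) + 24 * n := by ring
  omega

/-- For `k ≥ 2`, `2 ^ m ≤ 4 * k ≤ k ^ 3`; taking logarithms and using log 2 > 1/2 gives the factor
`6`. -/
theorem natCast_le_log {k m : ℕ} (hk : 2 ≤ k) (hT : 2 ^ m ≤ 4 * k) :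
    (m : ℝ) ≤ 6 * Real.log k := by
  have h1 : 2 ^ m ≤ k ^ 3 := by
    have : 4 ≤ k ^ 2 := Nat.pow_le_pow_left hk 2
    calc 2 ^ m ≤ 4 * k := hT
      _ ≤ k ^ 2 * k := Nat.mul_le_mul_right k this
      _ = k ^ 3 := by ring
  have h2 : (m : ℝ) * Real.log 2 ≤ 3 * Real.log k := by
    have h3 : (2 : ℝ) ^ m ≤ (k : ℝ) ^ 3 := by exact_mod_cast h1
    have := Real.log_le_log (by positivity) h3
    rw [Real.log_pow, Real.log_pow] at this
    exact_mod_cast this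
  have h3 := Real.log_two_gt_d9
  have h4 : (m : ℝ) * (1 / 2) ≤ m * Real.log 2 :=
    mul_le_mul_of_nonneg_left (by linarith) (Nat.cast_nonneg m)
  linarith

section

variable {k p : ℕ} [NeZero k] {γ : Fin p → ℝ} {U : Fin p → Matrix (ZMod k) (ZMod k) ℂ}
  {ψ : ZMod k → ℂ} {φ ξ : ZMod k → ℝ} {d : ℕ}

theorem inputConfig_mixer_entry (t : Fin p) {i j : ℕ} (hi : i < k) (hj : j < k) :
    (inputConfig d γ U ψ φ ξ).mem 4 ((t * k + i) * k + j) =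
      U t (i : ZMod k) (j : ZMod k) := by
  have hk : 0 < k := NeZero.pos k
  have h1 : ((t * k + i) * k + j) / k = t * k + i := by
    rw [mul_comm _ k, Nat.mul_add_div hk, Nat.div_eq_of_lt hj, add_zero]
  have h2 : ((t * k + i) * k + j) / (k * k) = t := by
    rw [← Nat.div_div_eq_div_mul, h1, mul_comm _ k, Nat.mul_add_div hk, Nat.div_eq_of_lt hi,
      add_zero]
  have h3 : ((t * k + i) * k + j) % k = j := by
    rw [mul_comm _ k, Nat.mul_add_mod, Nat.mod_eq_of_lt hj]
  have h4 : (t * k + i) % k = i := by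
    rw [mul_comm _ k, Nat.mul_add_mod, Nat.mod_eq_of_lt hi]
  have h5 : ((t * k + i) * k + j) / (k * k) < p := by
    rw [h2]
    exact t.2
  have h6 : (⟨((t * k + i) * k + j) / (k * k), h5⟩ : Fin p) = t := Fin.ext h2
  refine (dif_pos h5).trans ?_
  rw [h1, h3, h4, h6]

theorem wp_qaoaProg (hk : 2 ≤ k) (hp : 1 ≤ p) :
    wp (8 * (k * k ^ (2 * p + 1))) qaoaProg
      (fun τ _ M => (∃ m, 1 ≤ m ∧ 2 ^ m ≤ 4 * k ∧ τ ≤ runTime k p m) ∧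
        M 5 0 = ∑ a, pathWeight U ψ a * branchTensor d γ U ψ (onDiff φ) p a *
          (lossMatrix γ (onDiff φ) (onDiff ξ) *ᵥ
            fun b => pathWeight U ψ b * branchTensor d γ U ψ (onDiff φ) p b) a)
      0 (inputConfig d γ U ψ φ ξ).reg (inputConfig d γ U ψ φ ξ).mem := by
  have hpow : 2 * p + 2 ≤ k * k ^ (2 * p + 1) := by
    rw [← pow_succ']
    exact (Nat.lt_pow_self hk).le
  have hkn : k ≤ k * k ^ (2 * p + 1) := Nat.le_mul_of_pos_right k (by positivity)
  -- The addresses of the mixer entries stay within the integer bound, since `p ≤ k ^ p`.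
  have hpk : p * k * k ≤ k * k ^ (2 * p + 1) := by
    have h1 : p ≤ k ^ p := (Nat.lt_pow_self hk).le
    calc p * k * k ≤ k ^ p * k * k :=
          Nat.mul_le_mul_right _ (Nat.mul_le_mul_right _ h1)
      _ = k ^ (p + 2) := by ring
      _ ≤ k ^ (2 * p + 2) := Nat.pow_le_pow_right (by omega) (by omega)
      _ = k * k ^ (2 * p + 1) := pow_succ' k (2 * p + 1)
  set s := inputConfig d γ U ψ φ ξ with hs
  have s0 : ∀ t : Fin p, s.mem 0 t = (γ t : ℂ) := fun t => by simp [hs, inputConfig]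
  have s1 : ∀ x < k, s.mem 1 x = (φ (x : ZMod k) : ℂ) := fun x hx => by
    simp [hs, inputConfig, hx]
  have s2 : ∀ x < k, s.mem 2 x = (ξ (x : ZMod k) : ℂ) := fun x hx => by
    simp [hs, inputConfig, hx]
  have s3 : ∀ x < k, s.mem 3 x = ψ (x : ZMod k) := fun x hx => by
    simp [hs, inputConfig, hx]
  have s4 : ∀ (t : Fin p) (i j : ℕ), i < k → j < k →
      s.mem 4 ((t * k + i) * k + j) = U t (i : ZMod k) (j : ZMod k) :=
    fun t i j hi hj => inputConfig_mixer_entry t hi hj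
  have s6 : s.mem 6 0 = 0 := by simp [hs, inputConfig]
  have s8 : ∀ x, s.mem 8 x = 0 := fun x => by simp [hs, inputConfig]
  simp only [qaoaProg, Prog.block, wp]
  refine wp_setupRegisters (k := k) (p := p) (d := d) hk (by omega) (by omega)
    (by simp [hs, inputConfig]) (by simp [hs, inputConfig]) (by simp [hs, inputConfig])
    fun m τ1 R1 M1 m1 m2 t1 F1 hR1 => ?_
  have e1 : ∀ A < 100, M1 A = s.mem A := F1.mem
  refine wp_setupConstants hR1 fun τ2 R2 M2 t2 F2 c0 c1 c2 e2 => ?_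
  have hR2 := hR1.frame F2 (by norm_num)
  refine wp_angleLoop (γ := γ) (by omega) hR2
    (fun t => by rw [e2 0 (by norm_num), e1 0 (by norm_num), s0])
    (by rw [e2 6 (by norm_num), e1 6 (by norm_num), s6])
    (fun x => by rw [e2 8 (by norm_num), e1 8 (by norm_num), s8])
    fun τ3 R3 M3 t3 F3 c8 e3 => ?_
  have hR3 := hR2.frame F3 (by norm_num)
  refine wp_twiddleLoop (m := m) (by omega) hR3.r4 hR3.r5 hR3.r11
    (by rw [e3 7 (by norm_num), c1]) fun τ4 R4 M4 t4 F4 c9 e4 => ?_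
  have hR4 := hR3.frame F4 (by norm_num)
  have e5 : ∀ A, A ≠ 7 → A ≠ 8 → A ≠ 9 → A < 100 → M4 A = s.mem A := fun A h7 h8 h9 h => by
    rw [e4 A h9, e3 A h8, e2 A h7, e1 A h]
  refine wp_weightLoop (U := U) (ψ := ψ) (by omega) (by omega) hR4
    (by rw [e5 4 (by norm_num) (by norm_num) (by norm_num) (by norm_num)]; exact s4)
    (by rw [e5 3 (by norm_num) (by norm_num) (by norm_num) (by norm_num)]; exact s3)
    (by rw [e5 6 (by norm_num) (by norm_num) (by norm_num) (by norm_num), s6])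
    fun τ5 R5 M5 t5 F5 c10 => ?_
  have hR5 := hR4.frame F5 (by norm_num)
  refine wp_onesLoop (by omega) hR5.r4 hR5.r10 fun τ6 R6 M6 t6 F6 c11 => ?_
  have hR6 := hR5.frame F6 (by norm_num)
  have hL : Loaded γ φ ξ d m R6 M6 := by
    refine ⟨hR6.r0, hR6.r1, hR6.r2, hR6.r3, hR6.r4, hR6.r5, hR6.r8, hR6.r9, hR6.r10, hR6.r11,
      hR6.r12, hR6.r13, ?_, ?_, ?_, ?_, ?_, ?_, ?_⟩
    · rw [F6.mem 1 (by norm_num), F5.mem 1 (by norm_num), e5 1] <;> first | exact s1 | norm_num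
    · rw [F6.mem 2 (by norm_num), F5.mem 2 (by norm_num), e5 2] <;> first | exact s2 | norm_num
    · rw [F6.mem 6 (by norm_num), F5.mem 6 (by norm_num), e5 6] <;> first | exact s6 | norm_num
    · rw [F6.mem 7 (by norm_num), F5.mem 7 (by norm_num), e4 7 (by norm_num),
        e3 7 (by norm_num), c0]
    · rw [F6.mem 7 (by norm_num), F5.mem 7 (by norm_num), e4 7 (by norm_num),
        e3 7 (by norm_num), c2]
    · rw [F6.mem 8 (by norm_num), F5.mem 8 (by norm_num), e4 8 (by norm_num)]
      exact c8
    · rw [F6.mem 9 (by norm_num), F5.mem 9 (by norm_num)]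
      exact c9
  simp only [CpxFun.eval]
  have hF := (Frame.refl 40 12 R6 M6).writeCell (A := 12) le_rfl (R6 3) (M6 6 (R6 3))
  refine wp_mainLoop (U := U) (ψ := ψ) (hL.frame hF (by norm_num) (by norm_num)) (by omega) m1
    (by omega) (by omega)
    (by rw [hF.mem 10 (by norm_num), F6.mem 10 (by norm_num)]; exact c10)
    (by rw [hF.mem 11 (by norm_num)]; exact c11)
    (by simp [writeCell_apply, hR6.r3, hL.m6]) fun τ7 R7 M7 t7 F7 c12 => ?_
  have h3 : R7 3 = 0 := by rw [F7.reg 3 (by norm_num), hR6.r3]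
  rw [h3]
  refine ⟨⟨m, ?_, m2, ?_⟩, ?_⟩
  · by_contra h
    have : m = 0 := by omega
    subst this
    omega
  · have h8 : k * k ^ (2 * p + 1) * (p * 26 + 24) =
        k * k ^ (2 * p + 1) * (p * 26 + 22) + k * k ^ (2 * p + 1) * 2 := by ring
    rw [runTime, h8]
    omega
  · rw [writeCell_apply, if_pos rfl, if_pos rfl, c12]

/-- The registers of `k`, `p`, `d` never serve as an index, and all array names are below `19`; so
the integers written bound the memory, independently of `d`. -/
theorem qaoaProg_addressesIn : qaoaProg.AddressesIn 3 19 := by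
  simp [Prog.AddressesIn, Prog.block, qaoaProg, setupRegisters, powerLoop, sizeLoop,
    setupConstants, angleLoop, twiddleLoop, weightLoop, weightFactors, lowDigits, highDigits,
    adjointEntry, multiplyEntries, weightDiagonal, weightEnds, onesLoop, mainLoop, tensorLoad,
    branchPower, accumulate, convProg, axisProg, kernelLoad, kernelStore, lineLoop, tensorCopy,
    lineProg, lineLoad, lineScale, lineStore, fftProg, fftStages, fftButterflies, fftCopy]

theorem inputConfig_bounded : (inputConfig d γ U ψ φ ξ).Bounded 3 19 := by
  refine ⟨fun x hx => ?_, Finset.empty_subset _⟩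
  simp only [inputConfig]
  rw [if_neg (by omega), if_neg (by omega), if_neg (by omega)]

theorem qaoaProg_resources (hk : 2 ≤ k) (hp : 1 ≤ p) :
    (((qaoaProg.run (inputConfig d γ U ψ φ ξ)).time : ℝ) ≤
        36000 * ((p : ℝ) ^ 2 * (k : ℝ) ^ (2 * p + 2) * Real.log k) ∧
      ((qaoaProg.run (inputConfig d γ U ψ φ ξ)).touched.card : ℝ) ≤
        36000 * (k : ℝ) ^ (2 * p + 2) ∧
      ((qaoaProg.run (inputConfig d γ U ψ φ ξ)).word : ℝ) ≤ 36000 * (k : ℝ) ^ (2 * p + 2)) ∧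
    (qaoaProg.run (inputConfig d γ U ψ φ ξ)).output =
      ∑ a, pathWeight U ψ a * branchTensor d γ U ψ (onDiff φ) p a *
        (lossMatrix γ (onDiff φ) (onDiff ξ) *ᵥ
          fun b => pathWeight U ψ b * branchTensor d γ U ψ (onDiff φ) p b) a := by
  obtain ⟨⟨⟨m, hm, hT, ht⟩, hout⟩, hword⟩ := wp_sound (8 * (k * k ^ (2 * p + 1))) qaoaProg _
    (inputConfig d γ U ψ φ ξ) (Nat.zero_le _) (wp_qaoaProg hk hp)
  have hcard := (qaoaProg_addressesIn.bounded_run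
    (inputConfig_bounded (d := d) (γ := γ) (U := U) (ψ := ψ) (φ := φ) (ξ := ξ))).card_touched_le
  have htime := ht.trans (runTime_le (by omega) hp hm hT)
  have hpos : 1 ≤ k * k ^ (2 * p + 1) := Nat.mul_pos (by omega) (by positivity)
  rw [← pow_succ'] at htime hword hpos
  have hlog := natCast_le_log hk hT
  refine ⟨⟨?_, ?_, ?_⟩, hout⟩
  -- The constant `36000` is `6000` from `runTime_le` times `6` from `natCast_le_log`.
  · have h1 : ((qaoaProg.run (inputConfig d γ U ψ φ ξ)).time : ℝ) ≤
        6000 * ((p : ℝ) ^ 2 * (k : ℝ) ^ (2 * p + 2) * m) := by exact_mod_cast htime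
    have h2 : (p : ℝ) ^ 2 * (k : ℝ) ^ (2 * p + 2) * m ≤
        (p : ℝ) ^ 2 * (k : ℝ) ^ (2 * p + 2) * (6 * Real.log k) :=
      mul_le_mul_of_nonneg_left hlog (by positivity)
    linarith
  · have h1 : (qaoaProg.run (inputConfig d γ U ψ φ ξ)).touched.card ≤
        36000 * k ^ (2 * p + 1 + 1) := by omega
    exact_mod_cast h1
  · have h1 : (qaoaProg.run (inputConfig d γ U ψ φ ξ)).word ≤
        36000 * k ^ (2 * p + 1 + 1) := by omega
    exact_mod_cast h1

end

end

theorem proposition2 :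
    ∃ (P : Prog) (K : ℝ),
      ∀ (k p d : ℕ) [NeZero k], 2 ≤ k → 1 ≤ p →
      ∀ (ℓ : ℕ) (γ : Fin p → ℝ) (β : Fin p → Fin ℓ → ℝ)
        (UB : (Fin ℓ → ℝ) → Matrix.unitaryGroup (ZMod k) ℂ)
        (ψ : ZMod k → ℂ), ∑ a, ‖ψ a‖ ^ 2 = 1 →
      ∀ (φ ξ : ZMod k → ℝ) (hφ : ∀ x y : ZMod k, φ (x - y) = φ (y - x))
        (U : Fin p → Matrix (ZMod k) (ZMod k) ℂ),
        (∀ t, U t = (UB (β t) : Matrix (ZMod k) (ZMod k) ℂ)) →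
        -- the matrix-vector steps are convolutions, diagonalized by the Hadamard transform
        (hadamard k (2 * p + 2) ∈ Matrix.unitaryGroup (Fin (2 * p + 2) → ZMod k) ℂ ∧
          IsHadamardConvolution (phaseMatrix γ (onDiff φ)) (phaseKernel γ φ) ∧
          IsHadamardConvolution (lossMatrix γ (onDiff φ) (onDiff ξ)) (lossKernel γ φ ξ) ∧
          ∀ (r : ℕ) (a : Fin (2 * p + 2) → ZMod k),
            branchTensor d γ U ψ (onDiff φ) (r + 1) a =
              ((phaseMatrix γ (onDiff φ) *ᵥ
                fun b => pathWeight U ψ b * branchTensor d γ U ψ (onDiff φ) r b) a) ^ d) ∧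
        -- the program runs within the claimed resources
        (((P.run (inputConfig d γ U ψ φ ξ)).time : ℝ) ≤
            K * ((p : ℝ) ^ 2 * (k : ℝ) ^ (2 * p + 2) * Real.log k) ∧
          ((P.run (inputConfig d γ U ψ φ ξ)).touched.card : ℝ) ≤ K * (k : ℝ) ^ (2 * p + 2) ∧
          ((P.run (inputConfig d γ U ψ φ ξ)).word : ℝ) ≤ K * (k : ℝ) ^ (2 * p + 2)) ∧
        -- on every graph and edge, the final sum and the program's output are the expectation
        ∀ (V : Type*) [Fintype V] [DecidableEq V] (G : SimpleGraph V) [DecidableRel G.Adj],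
          G.IsRegularOfDegree (d + 1) → ((2 * p + 2 : ℕ) : ℕ∞) ≤ G.egirth →
          ∀ u v : V, G.Adj u v →
            edgeExpectation (onDiff ξ) u v
                (qaoaState (qaoaCost G (onDiff φ) hφ) γ U ψ) =
              ∑ a, pathWeight U ψ a * branchTensor d γ U ψ (onDiff φ) p a *
                (lossMatrix γ (onDiff φ) (onDiff ξ) *ᵥ
                  fun b => pathWeight U ψ b * branchTensor d γ U ψ (onDiff φ) p b) a ∧
            (P.run (inputConfig d γ U ψ φ ξ)).output =
              edgeExpectation (onDiff ξ) u v
                (qaoaState (qaoaCost G (onDiff φ) hφ) γ U ψ) := by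
  refine ⟨qaoaProg, 36000, ?_⟩
  intro k p d _ hk hp ℓ γ β UB ψ hψ φ ξ hφ U hU
  have hres := qaoaProg_resources (d := d) (γ := γ) (U := U) (ψ := ψ) (φ := φ) (ξ := ξ) hk hp
  refine ⟨⟨hadamard_mem_unitaryGroup k _, phaseMatrix_isHadamardConvolution γ φ,
    lossMatrix_isHadamardConvolution γ φ ξ,
    fun r a => branchTensor_succ d γ U ψ (onDiff φ) r a⟩, hres.1, ?_⟩
  intro V _ _ G _ hreg hg u v huv
  -- The family of mixers enters only through the unitarity of its values at the given angles.
  have hU' : ∀ t, (U t)ᴴ * U t = 1 := fun t => by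
    rw [hU t, ← Matrix.star_eq_conjTranspose]
    exact Matrix.mem_unitaryGroup_iff'.1 (UB (β t)).2
  have h := edgeExpectation_eq_iteration hp huv hg hreg hU' hψ γ (onDiff φ) (onDiff ξ) hφ
  exact ⟨h, hres.2.trans h.symm⟩
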